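/- Proposition 5.1. Let $\mathcal V\subset S^3\subset\mathbb R^4$ be a finite set that lies in an open half-sphere, lies in no hyperplane $\Pi_\nu=\{x\in S^3:\langle x,\nu\rangle=0\}$ ($\nu\in S^3$), and each of whose points $v$ is extremal, i.e. not in the convex hull $CH(\mathcal V\setminus\{v\})$, where $CH(W)=\{\sum_{w\in W}a_ww: a_w\ge 0\}\cap S^3$. Let $P=\partial\,CH(\mathcal V)$ be the convex polyhedral sphere generated by $\mathcal V$ (boundary in $S^3$) and let $P^*=\partial Q^*$ be its dual, where $Q^*=\{x\in S^3:\langle x,y\rangle\le 0\ \text{for all } y\in CH(\mathcal V)\}$. Put $\Delta_\nu=\{x\in S^3:\langle x,\nu\rangle\le 0\}$. The faces (resp. edges) of $P$ are the sets $P\cap\Pi_\nu$ with $\nu\in S^3$, $P\subset\Delta_\nu$, that span a linear subspace of dimension $3$ (resp. $2$); likewise for $P^*$, and likewise for the edges and vertices (dimensions $2$ and $1$) of spherical polygons and arcs. For a face, an edge or a vertex $g$ of $P$ (the vertices being the points of $\mathcal V$) let $g^*=\{x\in P^*:\langle x,y\rangle=0\ \text{for all } y\in g\}$. Let $$\widetilde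 P=\{(x,\nu)\in T^1S^3: x\in P,\ P\subset\Delta_\nu,\ \langle x,\nu\rangle=0\}$$ be the set of outward unit normal vectors to $P$, with the topology induced from $T^1S^3\subset\mathbb R^4\times\mathbb R^4$, and put $\tilde f=f\times f^*$, $\tilde e=e\times e^*$, $\tilde v=\{v\}\times v^*$ for the faces $f$, edges $e$ and vertices $v$ of $P$, each with the metric induced from the product of the spherical metrics. An ordered basis $(w_1,w_2)$ of the tangent plane of a piece at a point $(x,\nu)$ is called positive * on $\tilde f$, if $w_i=(\xi_i,0)$ with $\det(x,\xi_1,\xi_2,\nu)>0$ (the orientation of $f$ given by the outward normal $f^*$); * on $\tilde v$, if $w_i=(0,\eta_i)$ with $\det(\nu,\eta_1,\eta_2,-v)>0$ (the orientation of the face $v^*$ of $P^*$ given by its inward normal $-v$); * on $\tilde e$, if it has the orientation opposite to $((\xi,0),(0,\eta))$, where $\xi$ and $\eta$ are unit tangent vectors of $e$ at $x$ and of $e^*$ at $\nu$ with $\det(x,\xi,\nu,\eta)>0$. Then the following hold. 1. For each face $f$ of $P$, $f^*$ is a single point, $f$ is a convex spherical polygon in the great sphere $\Pi_{f^*}$,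 and $x\mapsto(x,f^*)$ is an isometry of $f$ onto $\tilde f$. The map $v\mapsto v^*$ is a bijection from $\mathcal V$ onto the set of faces of $P^*$, each $v^*$ is a convex spherical polygon in $\Pi_v$, and $\nu\mapsto(v,\nu)$ is an isometry of $v^*$ onto $\tilde v$. The map $e\mapsto e^*$ is a bijection from the edges of $P$ onto the edges of $P^*$, and for each edge $e$ of $P$ the arcs $e$, $e^*$ have lengths $a,b\in(0,\pi)$ and arc length parametrizations $e(s)$, $e^*(t)$ along dual oriented great circles (given by a positive orthonormal basis $(u_1,u_2)$, $(u_3,u_4)$ of $\mathbb R^4$) such that $(s,t)\mapsto(e(s),e^*(t))$ is an orientation-reversing isometry of the Euclidean rectangle $[0,a]\times[0,b]$ onto $\tilde e$. 2. $\widetilde P$ is tiled by the pieces $\tilde f,\tilde e,\tilde v$: they are finitely many, their union is $\widetilde P$, and distinct pieces have disjoint interiors. 3. The tiling is edge-to-edge: two distinct pieces are disjoint, or meet in exactly one point, which is a vertex of both, or meet in exactly one edge, which is an edge of both; and every edge of a piece is an edge of exactly one other piece. 4. The orientations of the pieces fit together to give an orientation of $\widetilde P$: two distinct pieces with a common edge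 induce opposite boundary orientations on it, and $\widetilde P$ is homeomorphic to $S^2$ by a homeomorphism that is differentiable and orientation preserving in the interior of every piece. In particular $\widetilde P$ is homeomorphic to $S^2$. -/

import Mathlib

open scoped RealInnerProductSpace

noncomputable section

namespace SphPoly

/-- Euclidean 4-space. -/
abbrev E4 := EuclideanSpace ℝ (Fin 4)

/-- Euclidean 3-space. -/
abbrev E3 := EuclideanSpace ℝ (Fin 3)

/-- The unit sphere of dimension 3. -/
def S3 : Set E4 := Metric.sphere 0 1

/-- The unit tangent bundle of the 3-sphere inside `ℝ⁴ × ℝ⁴`. -/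
def T1S3 : Set (E4 × E4) := {p | ⟪p.1, p.1⟫ = 1 ∧ ⟪p.2, p.2⟫ = 1 ∧ ⟪p.1, p.2⟫ = 0}

/-- The hyperplane (totally geodesic 2-sphere) with unit normal `ν`. -/
def Pl (ν : E4) : Set E4 := {x | x ∈ S3 ∧ ⟪x, ν⟫ = 0}

/-- The closed half-sphere with outward unit normal `ν`. -/
def HalfSphere (ν : E4) : Set E4 := {x | x ∈ S3 ∧ ⟪x, ν⟫ ≤ 0}

/-- Determinant of four vectors; an ordered basis of `ℝ⁴` is positive iff it is `> 0`. -/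
def det4 (a b c d : E4) : ℝ := Matrix.det (Matrix.of fun i j : Fin 4 => (![a, b, c, d] i) j)

/-- Determinant of three vectors of `ℝ³`. -/
def det3 (a b c : E3) : ℝ := Matrix.det (Matrix.of fun i j : Fin 3 => (![a, b, c] i) j)

/-! ### Convex polyhedra and their duals -/

/-- Contained in an open half-sphere. -/
def Hemispherical (X : Set E4) : Prop := ∃ x₀ ∈ S3, ∀ x ∈ X, 0 < ⟪x, x₀⟫

/-- Not contained in a hyperplane of the 3-sphere. -/
def NonPlanar (X : Set E4) : Prop := ¬ ∃ ν ∈ S3, X ⊆ Pl ν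

/-- The cone spanned by a finite set. -/
def cone (V : Finset E4) : Set E4 :=
  {y | ∃ a : E4 → ℝ, (∀ v ∈ V, 0 ≤ a v) ∧ y = ∑ v ∈ V, a v • v}

/-- The spherical convex hull of a finite set. -/
def CH (V : Finset E4) : Set E4 := cone V ∩ S3

open Classical in
/-- `V` is the vertex set of a convex polyhedron: a hemispherical, non-planar finite subset of the
3-sphere, each element of which is extremal in the convex hull. -/
structure IsVertexSet (V : Finset E4) : Prop where
  subset_sphere : (V : Set E4) ⊆ S3
  hemispherical : Hemispherical (V : Set E4)
  nonPlanar : NonPlanar (V : Set E4)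
  extremal : ∀ v ∈ V, v ∉ CH (V.erase v)

/-- Relative boundary in the 3-sphere. -/
def bd (X : Set E4) : Set E4 :=
  Subtype.val '' frontier (Subtype.val ⁻¹' X : Set (Metric.sphere (0 : E4) 1))

/-- The convex polyhedral sphere `P` generated by `V`. -/
def P (V : Finset E4) : Set E4 := bd (CH V)

/-- The dual cone. -/
def dualCone (V : Finset E4) : Set E4 := {x | ∀ y ∈ cone V, ⟪x, y⟫ ≤ 0}

/-- The dual polyhedral sphere `P*`. -/
def Pdual (V : Finset E4) : Set E4 := bd (dualCone V ∩ S3)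

/-- The cells of dimension `k - 1` of `X`: the intersections of `X` with its support planes that
span a linear subspace of dimension `k`. This applies to a polyhedral sphere, to a
spherical polygon and to a geodesic arc; `X` itself is a cell if it lies in a hyperplane. -/
def cells (X : Set E4) (k : ℕ) : Set (Set E4) :=
  {g | ∃ ν ∈ S3, X ⊆ HalfSphere ν ∧ g = X ∩ Pl ν ∧ Module.finrank ℝ (Submodule.span ℝ g) = k}

/-- The faces of a polyhedral sphere. -/
def faces (X : Set E4) : Set (Set E4) := cells X 3

/-- The edges of a polyhedral sphere or of a spherical polygon. -/
def edges (X : Set E4) : Set (Set E4) := cells X 2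

/-- The vertices (as points) of a polyhedral sphere, a spherical polygon or an arc. -/
def vertices (X : Set E4) : Set E4 := {x | {x} ∈ cells X 1}

/-- The dual cell `g* = {x ∈ P* : ⟪x, y⟫ = 0 for all y ∈ g}` of a vertex, an edge or a face `g`. -/
def dual (V : Finset E4) (g : Set E4) : Set E4 := {x | x ∈ Pdual V ∧ ∀ y ∈ g, ⟪x, y⟫ = 0}

/-! ### Outward unit normal vectors -/

/-- `ν` is an outward unit normal vector to `P` at `x`: its hyperplane is a support plane at `x`. -/
def IsOutwardNormal (V : Finset E4) (x ν : E4) : Prop :=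
  ν ∈ S3 ∧ P V ⊆ HalfSphere ν ∧ x ∈ Pl ν ∩ P V

/-- The set of outward unit normal vectors to `P`. -/
def Ptilde (V : Finset E4) : Set (E4 × E4) :=
  {p | p ∈ T1S3 ∧ p.1 ∈ P V ∧ IsOutwardNormal V p.1 p.2}

/-- The product of the spherical distances on the two factors. On the pieces below, which are
products of convex subsets of the 3-sphere, it is the distance of the Riemannian metric for which
`f → f̃`, `v* → ṽ` and the arc length parametrization of `ẽ` are isometries. -/
def tileDist (p q : E4 × E4) : ℝ :=
  Real.sqrt (InnerProductGeometry.angle p.1 q.1 ^ 2 + InnerProductGeometry.angle p.2 q.2 ^ 2)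

/-- `A` is a convex geodesic polygon (with non-empty interior) in the great 2-sphere
with normal `ν`. -/
def IsSphericalPolygon (ν : E4) (A : Set E4) : Prop :=
  ν ∈ S3 ∧ A ⊆ Pl ν ∧ Module.finrank ℝ (Submodule.span ℝ A) = 3 ∧
    ∃ W : Finset E4, (W : Set E4) ⊆ S3 ∧ Hemispherical (W : Set E4) ∧ A = CH W

/-- An oriented polygon in `ℝ⁴ × ℝ⁴`: the underlying set, its edges, its vertices, and,
at each of its points, the positively oriented ordered bases of its tangent plane. -/
structure Tile where
  carrier : Set (E4 × E4)
  edges : Set (Set (E4 × E4))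
  vertices : Set (E4 × E4)
  pos : E4 × E4 → E4 × E4 → E4 × E4 → Prop

/-- The interior of a polygon: the polygon without its edges. -/
def Tile.inner (T : Tile) : Set (E4 × E4) := T.carrier \ ⋃₀ T.edges

/-- The piece `f̃ = f × f*`, where `f*` is a single point. It is oriented as the face `f`, that is,
by the outward unit normal vector `f*`. -/
def faceTile (V : Finset E4) (f : Set E4) : Tile where
  carrier := f ×ˢ dual V f
  edges := {ε | ∃ g ∈ edges f, ε = g ×ˢ dual V f}
  vertices := vertices f ×ˢ dual V f
  pos p w₁ w₂ := ∃ ξ₁ ξ₂ : E4, w₁ = (ξ₁, 0) ∧ w₂ = (ξ₂, 0) ∧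
    ⟪p.1, ξ₁⟫ = 0 ∧ ⟪p.2, ξ₁⟫ = 0 ∧ ⟪p.1, ξ₂⟫ = 0 ∧ ⟪p.2, ξ₂⟫ = 0 ∧
    0 < det4 p.1 ξ₁ ξ₂ p.2

/-- The piece `ẽ = e × e*`. If `e` is oriented by its unit tangent vector `ξ` at `x`, then `e*` has
the associated orientation by its unit tangent vector `η` at `ν` for which the basis `(x, ξ, ν, η)`
of `ℝ⁴` is positive; the basis `((ξ, 0), (0, η))` of the tangent plane is then negative. -/
def edgeTile (V : Finset E4) (e : Set E4) : Tile where
  carrier := e ×ˢ dual V e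
  edges := {ε | (∃ ν ∈ vertices (dual V e), ε = e ×ˢ {ν}) ∨ ∃ v ∈ vertices e, ε = {v} ×ˢ dual V e}
  vertices := vertices e ×ˢ vertices (dual V e)
  pos p w₁ w₂ := ∃ ξ η : E4, ξ ∈ Submodule.span ℝ e ∧ ‖ξ‖ = 1 ∧ ⟪p.1, ξ⟫ = 0 ∧
    η ∈ (Submodule.span ℝ e)ᗮ ∧ ‖η‖ = 1 ∧ ⟪p.2, η⟫ = 0 ∧ 0 < det4 p.1 ξ p.2 η ∧
    ∃ a₁ b₁ a₂ b₂ : ℝ, w₁ = (a₁ • ξ, b₁ • η) ∧ w₂ = (a₂ • ξ, b₂ • η) ∧ a₁ * b₂ - a₂ * b₁ < 0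

/-- The piece `ṽ = {v} × v*`. It is oriented as the face `v*` of `P*`, that is, by the inward unit
normal vector `-v` to `P*`. -/
def vertexTile (V : Finset E4) (v : E4) : Tile where
  carrier := {v} ×ˢ dual V {v}
  edges := {ε | ∃ g ∈ edges (dual V {v}), ε = {v} ×ˢ g}
  vertices := {v} ×ˢ vertices (dual V {v})
  pos p w₁ w₂ := ∃ η₁ η₂ : E4, w₁ = (0, η₁) ∧ w₂ = (0, η₂) ∧
    ⟪p.1, η₁⟫ = 0 ∧ ⟪p.2, η₁⟫ = 0 ∧ ⟪p.1, η₂⟫ = 0 ∧ ⟪p.2, η₂⟫ = 0 ∧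
    0 < det4 p.2 η₁ η₂ (-p.1)

/-- The set of all pieces of `P̃`. -/
def tiles (V : Finset E4) : Set Tile :=
  faceTile V '' faces (P V) ∪ edgeTile V '' edges (P V) ∪ vertexTile V '' (V : Set E4)

/-- The parametrization `(s, t) ↦ (e(s), e*(t))` by arc length of a product of two dual great
circles. -/
def arcs (u : Fin 4 → E4) (s t : ℝ) : E4 × E4 :=
  (Real.cos s • u 0 + Real.sin s • u 1, Real.cos t • u 2 + Real.sin t • u 3)

/-- The oriented polygon `T` is the Euclidean rectangle `e × e*`: in a positive orthonormal basis
`u` of `ℝ⁴` the map `arcs u` is an orientation-reversing isometry of `[0, a] × [0, b]` onto `T`,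
and `e`, `e*` are its two factors. -/
def IsRectangle (T : Tile) (e e' : Set E4) : Prop :=
  ∃ (u : Fin 4 → E4) (a b : ℝ), Orthonormal ℝ u ∧ 0 < det4 (u 0) (u 1) (u 2) (u 3) ∧
    0 < a ∧ a < Real.pi ∧ 0 < b ∧ b < Real.pi ∧
    e = (fun s => (arcs u s 0).1) '' Set.Icc 0 a ∧
    e' = (fun t => (arcs u 0 t).2) '' Set.Icc 0 b ∧
    T.carrier = (fun q : ℝ × ℝ => arcs u q.1 q.2) '' (Set.Icc 0 a ×ˢ Set.Icc 0 b) ∧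
    (∀ q ∈ Set.Icc 0 a ×ˢ Set.Icc 0 b, ∀ r ∈ Set.Icc 0 a ×ˢ Set.Icc 0 b,
      tileDist (arcs u q.1 q.2) (arcs u r.1 r.2) =
        Real.sqrt ((q.1 - r.1) ^ 2 + (q.2 - r.2) ^ 2)) ∧
    ∀ q ∈ Set.Icc 0 a ×ˢ Set.Icc 0 b,
      T.pos (arcs u q.1 q.2) (deriv (fun t => arcs u q.1 t) q.2) (deriv (fun s => arcs u s q.2) q.1)

/-- The vector `w` is positive for the orientation that `T` induces on its boundary at `p`:
together with some vector that points into `T` it is a positive basis, so that `T` lies to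
the left of `w`. -/
def BoundaryPos (T : Tile) (p w : E4 × E4) : Prop :=
  ∃ n ∈ posTangentConeAt T.carrier p, T.pos p w n

/-- The tiles `T` and `T'` induce opposite orientations on their common edge `ε`. -/
def OppositeAlong (T T' : Tile) (ε : Set (E4 × E4)) : Prop :=
  ∀ p ∈ ε, ∀ w ∈ tangentConeAt ℝ ε p, w ≠ 0 →
    (BoundaryPos T p w ↔ ¬ BoundaryPos T p (-w)) ∧
    (BoundaryPos T' p w ↔ ¬ BoundaryPos T' p (-w)) ∧
    (BoundaryPos T' p w ↔ BoundaryPos T p (-w))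

/-- The map `F` into the unit 2-sphere of `ℝ³` (with its usual orientation) is differentiable and
orientation preserving in the interior of `T`. -/
def OrientationPreservingOn (F : E4 × E4 → E3) (T : Tile) : Prop :=
  ∀ p ∈ T.inner, ∃ F' : E4 × E4 →L[ℝ] E3, HasFDerivWithinAt F F' T.carrier p ∧
    ∀ w₁ w₂, T.pos p w₁ w₂ → 0 < det3 (F p) (F' w₁) (F' w₂)

end SphPoly

end

open SphPoly

namespace SphPoly

open Module

/-! ### Finitely generated cones -/

/-! Everything rests on two mutually polar cones in ℝ⁴: the cone over `V`, and the cone over the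
finite set `W` of unit vectors on the extremal rays of its polar (`IsVertexSet.exists_dualPair`).
The conditions of `DualPair` are symmetric in `V` and `W`, and P* is the polyhedral sphere generated
by `W`, so every statement about P has a twin about P*. Faces, edges and vertices are the cells of
linear dimension 3, 2, 1; `dual` carries k-cells to (4 - k)-cells spanning the orthogonal
complement, reverses inclusions and is an involution.

A pair (x, ν) is in P̃ exactly when x and ν are orthogonal unit vectors of the two cones. Every
piece has the form g × g*, and its edges are the products a × b of cells of P and P* with a ⊆ g, b ⊆
g* and dimensions adding up to 3. The combinatorics becomes a dimension count: g × g* and g' × g'*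
meet in (g ∩ g') × (g* ∩ g'*), whose dimensions add up to at most 4, with equality only if g = g'
(`edge_to_edge`); and a × b is an edge of a × a* and b* × b only (`eq_or_eq_of_edge`).

Orientations are compared through the map (x, ν) ↦ x + ν. The vector ν - x is normal to its image,
and the three sign conventions are all the sign of the single form det(x + ν, dw₁, dw₂, ν - x),
where dw is the image of w (`pos_iff`). Along a common edge there is a conormal m with the two
pieces on opposite sides of m^⊥ (`exists_conormal`), so the induced boundary orientations are
opposite.

For the homeomorphism, take u positive on one cone and negative on the other, project x + ν along u
to u^⊥ ≅ ℝ³ and normalise. Injectivity follows from pairing a hypothetical coincidence with the four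
vectors involved (`sphereMap_injOn`). Surjectivity comes from the Moreau decomposition along a line
parallel to u: by the intermediate value theorem the two components have equal length somewhere
(`sphereMap_surjOn`). The projection replaces ν - x by -u in the orientation form, and ⟪-u, ν - x⟫ =
⟪x, u⟫ - ⟪ν, u⟫ > 0, so orientation is preserved. -/

lemma zero_mem_cone (V : Finset E4) : (0 : E4) ∈ cone V := ⟨0, by simp, by simp⟩

lemma add_mem_cone {V : Finset E4} {x y : E4} (hx : x ∈ cone V) (hy : y ∈ cone V) :
    x + y ∈ cone V := by
  obtain ⟨a, ha, rfl⟩ := hx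
  obtain ⟨b, hb, rfl⟩ := hy
  exact ⟨a + b, fun v hv => add_nonneg (ha v hv) (hb v hv), by
    simp [add_smul, Finset.sum_add_distrib]⟩

lemma smul_mem_cone {V : Finset E4} {x : E4} {c : ℝ} (hc : 0 ≤ c) (hx : x ∈ cone V) :
    c • x ∈ cone V := by
  obtain ⟨a, ha, rfl⟩ := hx
  exact ⟨fun v => c * a v, fun v hv => mul_nonneg hc (ha v hv), by
    simp [Finset.smul_sum, mul_smul]⟩

lemma mem_cone_of_mem {V : Finset E4} {v : E4} (hv : v ∈ V) : v ∈ cone V := by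
  classical
  refine ⟨fun w => if w = v then 1 else 0, fun w _ => by dsimp only; split_ifs <;> norm_num, ?_⟩
  simp [ite_smul, hv]

lemma sum_mem_cone {V : Finset E4} {ι : Type*} (s : Finset ι) (f : ι → E4)
    (h : ∀ i ∈ s, f i ∈ cone V) : ∑ i ∈ s, f i ∈ cone V :=
  Finset.sum_induction f (· ∈ cone V) (fun _ _ => add_mem_cone) (zero_mem_cone V) h

lemma cone_subset_cone {V W : Finset E4} (h : ∀ v ∈ V, v ∈ cone W) : cone V ⊆ cone W := by
  rintro _ ⟨a, ha, rfl⟩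
  exact sum_mem_cone _ _ fun v hv => smul_mem_cone (ha v hv) (h v hv)

lemma cone_mono {V W : Finset E4} (h : V ⊆ W) : cone V ⊆ cone W :=
  cone_subset_cone fun _ hv => mem_cone_of_mem (h hv)

lemma inner_nonneg_of_mem_cone {V : Finset E4} {x y : E4} (h : ∀ v ∈ V, 0 ≤ ⟪v, y⟫)
    (hx : x ∈ cone V) : 0 ≤ ⟪x, y⟫ := by
  obtain ⟨a, ha, rfl⟩ := hx
  rw [sum_inner]
  exact Finset.sum_nonneg fun v hv => by
    rw [real_inner_smul_left]; exact mul_nonneg (ha v hv) (h v hv)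

lemma inner_nonpos_of_mem_cone {V : Finset E4} {x y : E4} (h : ∀ v ∈ V, ⟪v, y⟫ ≤ 0)
    (hx : x ∈ cone V) : ⟪x, y⟫ ≤ 0 := by
  have := inner_nonneg_of_mem_cone (V := V) (y := -y) (fun v hv => by
    rw [inner_neg_right]; linarith [h v hv]) hx
  rw [inner_neg_right] at this; linarith

lemma inner_pos_of_mem_cone {V : Finset E4} {x y : E4} (h : ∀ v ∈ V, 0 < ⟪v, y⟫)
    (hx : x ∈ cone V) (hx0 : x ≠ 0) : 0 < ⟪x, y⟫ := by
  obtain ⟨a, ha, rfl⟩ := hx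
  rw [sum_inner]
  have hnn : ∀ v ∈ V, 0 ≤ ⟪a v • v, y⟫ := fun v hv => by
    rw [real_inner_smul_left]; exact mul_nonneg (ha v hv) (h v hv).le
  refine lt_of_le_of_ne (Finset.sum_nonneg hnn) fun h0 => hx0 ?_
  have h1 := (Finset.sum_eq_zero_iff_of_nonneg hnn).1 h0.symm
  refine Finset.sum_eq_zero fun v hv => ?_
  have h2 := h1 v hv
  rw [real_inner_smul_left] at h2
  rcases mul_eq_zero.1 h2 with h3 | h3
  · rw [h3, zero_smul]
  · exact absurd h3 (h v hv).ne'

lemma inner_neg_of_mem_cone {V : Finset E4} {x y : E4} (h : ∀ v ∈ V, ⟪v, y⟫ < 0)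
    (hx : x ∈ cone V) (hx0 : x ≠ 0) : ⟪x, y⟫ < 0 := by
  have := inner_pos_of_mem_cone (V := V) (y := -y) (fun v hv => by
    rw [inner_neg_right]; linarith [h v hv]) hx hx0
  rw [inner_neg_right] at this; linarith

lemma mem_S3 {x : E4} : x ∈ S3 ↔ ‖x‖ = 1 := by simp [S3]

lemma ne_zero_of_mem_S3 {x : E4} (h : x ∈ S3) : x ≠ 0 := by
  rintro rfl; simp [mem_S3] at h

lemma normalize_mem_S3 {x : E4} (h : x ≠ 0) : ‖x‖⁻¹ • x ∈ S3 := by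
  rw [mem_S3, norm_smul, norm_inv, norm_norm, inv_mul_cancel₀ (norm_ne_zero_iff.2 h)]

/-- Pairing with `u` bounds the coefficients of a combination by its norm, so near any point the
cone lies in the continuous image of a compact box of coefficients. -/
lemma isClosed_cone {V : Finset E4} {u : E4} (hu : ∀ v ∈ V, 0 < ⟪v, u⟫) : IsClosed (cone V) := by
  classical
  obtain ⟨δ, hδ, hδV⟩ : ∃ δ > 0, ∀ v ∈ V, δ ≤ ⟪v, u⟫ := by
    rcases V.eq_empty_or_nonempty with rfl | hne
    · exact ⟨1, one_pos, by simp⟩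
    · obtain ⟨v, hv, hmin⟩ := V.exists_min_image (fun v => ⟪v, u⟫) hne
      exact ⟨_, hu v hv, hmin⟩
  refine isClosed_of_closure_subset fun x hx => ?_
  set R : ℝ := (‖x‖ + 1) * ‖u‖ / δ with hR
  -- Coefficients outside `V` are irrelevant; pinning them to 0 makes the infinite product compact.
  let A : Set (E4 → ℝ) := Set.pi Set.univ fun v => if v ∈ V then Set.Icc 0 R else {0}
  have hA : IsCompact A := isCompact_univ_pi fun v => by
    split_ifs
    · exact isCompact_Icc
    · exact isCompact_singleton
  have hcont : Continuous fun a : E4 → ℝ => ∑ v ∈ V, a v • v :=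
    continuous_finsetSum _ fun v _ => (continuous_apply v).smul continuous_const
  have hK := (hA.image hcont).isClosed
  have hsub : Metric.ball x 1 ∩ cone V ⊆ (fun a : E4 → ℝ => ∑ v ∈ V, a v • v) '' A := by
    rintro _ ⟨hyb, a, ha, rfl⟩
    refine ⟨fun v => if v ∈ V then a v else 0, fun v _ => ?_, ?_⟩
    · by_cases hv : v ∈ V
      · simp only [hv, if_true]
        refine ⟨ha v hv, ?_⟩
        rw [hR, le_div_iff₀ hδ]
        have h1 : a v * ⟪v, u⟫ ≤ ∑ w ∈ V, a w * ⟪w, u⟫ :=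
          Finset.single_le_sum (f := fun w => a w * ⟪w, u⟫)
            (fun w hw => mul_nonneg (ha w hw) (hu w hw).le) hv
        have h2 : ∑ w ∈ V, a w * ⟪w, u⟫ = ⟪∑ w ∈ V, a w • w, u⟫ := by
          rw [sum_inner]; simp [real_inner_smul_left]
        have h3 : ‖∑ w ∈ V, a w • w‖ ≤ ‖x‖ + 1 := by
          have h4 := norm_sub_norm_le (∑ w ∈ V, a w • w) x
          rw [Metric.mem_ball, dist_eq_norm] at hyb
          linarith
        calc a v * δ ≤ a v * ⟪v, u⟫ := mul_le_mul_of_nonneg_left (hδV v hv) (ha v hv)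
          _ ≤ ‖∑ w ∈ V, a w • w‖ * ‖u‖ := by
            rw [h2] at h1; exact h1.trans (real_inner_le_norm _ _)
          _ ≤ _ := mul_le_mul_of_nonneg_right h3 (norm_nonneg _)
      · simp [hv]
    · exact Finset.sum_congr rfl fun v hv => by simp [hv]
  have hx' : x ∈ closure (Metric.ball x 1 ∩ cone V) :=
    Metric.isOpen_ball.inter_closure ⟨Metric.mem_ball_self one_pos, hx⟩
  obtain ⟨a, ha, rfl⟩ := closure_minimal hsub hK hx'
  refine ⟨a, fun v hv => ?_, rfl⟩
  have := ha v (Set.mem_univ v)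
  simp only [hv, if_true] at this
  exact this.1

/-- Moreau decomposition with respect to a closed finitely generated cone. -/
lemma exists_moreau {V : Finset E4} (hcl : IsClosed (cone V)) (z : E4) :
    ∃ x ∈ cone V, (∀ v ∈ V, ⟪v, z - x⟫ ≤ 0) ∧ ⟪x, z - x⟫ = 0 := by
  have hconv : Convex ℝ (cone V) := fun x hx y hy a b ha hb _ =>
    add_mem_cone (smul_mem_cone ha hx) (smul_mem_cone hb hy)
  obtain ⟨x, hx, hmin⟩ :=
    exists_norm_eq_iInf_of_complete_convex ⟨0, zero_mem_cone V⟩ hcl.isComplete hconv z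
  have h := (norm_eq_iInf_iff_real_inner_le_zero hconv hx).1 hmin
  -- Testing the variational inequality at 0 and at 2x gives both signs of ⟪z - x, x⟫.
  have h0 := h 0 (zero_mem_cone V)
  have h2 := h ((2 : ℝ) • x) (smul_mem_cone (by norm_num) hx)
  rw [two_smul, add_sub_cancel_right] at h2
  rw [zero_sub, inner_neg_right] at h0
  have hxz : ⟪z - x, x⟫ = 0 := by linarith
  refine ⟨x, hx, fun v hv => ?_, by rw [real_inner_comm, hxz]⟩
  have h3 := h v (mem_cone_of_mem hv)
  rw [inner_sub_right, hxz, sub_zero, real_inner_comm] at h3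
  exact h3

/-! ### Rays of the polar cone -/

open Classical in
/-- The elements of `V` orthogonal to `y`. -/
noncomputable def zeros (V : Finset E4) (y : E4) : Finset E4 := V.filter fun v => ⟪v, y⟫ = 0

lemma mem_zeros {V : Finset E4} {y v : E4} : v ∈ zeros V y ↔ v ∈ V ∧ ⟪v, y⟫ = 0 := by
  simp [zeros]

/-- The dimension of the span of the elements of `V` orthogonal to `y`. -/
noncomputable def zdim (V : Finset E4) (y : E4) : ℕ := finrank ℝ (Submodule.span ℝ (zeros V y : Set E4))

lemma exists_ne_zero_orthogonal {S : Submodule ℝ E4} (h : finrank ℝ S < 4) :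
    ∃ d ∈ Sᗮ, d ≠ 0 := by
  have h1 := S.finrank_add_finrank_orthogonal
  rw [finrank_euclideanSpace_fin] at h1
  exact Submodule.exists_mem_ne_zero_of_ne_bot (by
    rintro h2; rw [h2, finrank_bot] at h1; omega)

lemma mem_orthogonal_span {s : Set E4} {d : E4} :
    d ∈ (Submodule.span ℝ s)ᗮ ↔ ∀ v ∈ s, ⟪v, d⟫ = 0 := by
  rw [Submodule.mem_orthogonal]
  refine ⟨fun h v hv => h v (Submodule.subset_span hv), fun h v hv => ?_⟩
  induction hv using Submodule.span_induction with
  | mem x hx => exact h x hx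
  | zero => simp
  | add x y _ _ hx hy => rw [inner_add_left, hx, hy, add_zero]
  | smul a x _ hx => rw [real_inner_smul_left, hx, mul_zero]

lemma zdim_le_three {V : Finset E4} {y : E4} (hy : y ≠ 0) : zdim V y ≤ 3 := by
  by_contra hlt
  have h1 := (Submodule.span ℝ (zeros V y : Set E4)).finrank_add_finrank_orthogonal
  rw [finrank_euclideanSpace_fin] at h1
  have h2 : finrank ℝ (Submodule.span ℝ (zeros V y : Set E4))ᗮ = 0 := by
    unfold zdim at hlt; omega
  have h3 : y ∈ (Submodule.span ℝ (zeros V y : Set E4))ᗮ :=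
    mem_orthogonal_span.2 fun v hv => (mem_zeros.1 hv).2
  rw [Submodule.finrank_eq_zero.1 h2] at h3
  exact hy (by simpa using h3)

/-- Moving from a point `y` of the polar cone in a direction `d` orthogonal to the constraints that
are tight at `y`, one reaches a point with more tight constraints. -/
lemma exists_exit {V : Finset E4} {y d : E4} (hy : ∀ v ∈ V, ⟪v, y⟫ ≤ 0)
    (hd : ∀ v ∈ zeros V y, ⟪v, d⟫ = 0) (hpos : ∃ v ∈ V, 0 < ⟪v, d⟫) :
    ∃ t : ℝ, 0 < t ∧ (∀ v ∈ V, ⟪v, y + t • d⟫ ≤ 0) ∧ zdim V y < zdim V (y + t • d) := by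
  classical
  obtain ⟨v₁, hv₁, hv₁d⟩ := hpos
  -- `v₀` is the first constraint to become tight along the ray, and `t` is the time when it does.
  obtain ⟨v₀, hv₀, hmin⟩ := (V.filter fun v => 0 < ⟪v, d⟫).exists_min_image
    (fun v => -⟪v, y⟫ / ⟪v, d⟫) ⟨v₁, Finset.mem_filter.2 ⟨hv₁, hv₁d⟩⟩
  obtain ⟨hv₀, hv₀d⟩ := Finset.mem_filter.1 hv₀
  have hv₀y : ⟪v₀, y⟫ < 0 := lt_of_le_of_ne (hy v₀ hv₀) fun h =>
    hv₀d.ne' (hd v₀ (mem_zeros.2 ⟨hv₀, h⟩))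
  set t := -⟪v₀, y⟫ / ⟪v₀, d⟫ with ht
  have ht0 : 0 < t := div_pos (by linarith) hv₀d
  have hexp : ∀ v, ⟪v, y + t • d⟫ = ⟪v, y⟫ + t * ⟪v, d⟫ := fun v => by
    rw [inner_add_right, real_inner_smul_right]
  have hzero : ⟪v₀, y + t • d⟫ = 0 := by
    rw [hexp, ht]; field_simp; ring
  refine ⟨t, ht0, fun v hv => ?_, ?_⟩
  · rw [hexp]
    rcases le_or_gt ⟪v, d⟫ 0 with h | h
    · nlinarith [hy v hv]
    · have := hmin v (Finset.mem_filter.2 ⟨hv, h⟩)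
      rw [le_div_iff₀ h] at this
      linarith
  -- The old tight constraints stay tight, and `v₀` is new: `d` is orthogonal to their span but not
  -- to `v₀`.
  · refine Submodule.finrank_lt_finrank_of_lt (lt_of_le_of_ne ?_ fun heq => ?_)
    · refine Submodule.span_mono fun v hv => ?_
      obtain ⟨hvV, hvy⟩ := mem_zeros.1 hv
      exact mem_zeros.2 ⟨hvV, by rw [hexp, hvy, hd v hv]; ring⟩
    · have h1 : v₀ ∈ Submodule.span ℝ (zeros V y : Set E4) := by
        rw [heq]; exact Submodule.subset_span (mem_zeros.2 ⟨hv₀, hzero⟩)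
      have h2 : d ∈ (Submodule.span ℝ (zeros V y : Set E4))ᗮ := mem_orthogonal_span.2 hd
      exact hv₀d.ne' (Submodule.inner_right_of_mem_orthogonal h1 h2)

/-- The unit vectors on the extremal rays of the polar cone. -/
def polarRays (V : Finset E4) : Set E4 :=
  {y | y ∈ S3 ∧ (∀ v ∈ V, ⟪v, y⟫ ≤ 0) ∧ zdim V y = 3}

/-- A sum of nonpositive terms vanishes only if each does, and then `V` would lie in the hyperplane
orthogonal to `y`. -/
lemma NonPlanar.sum_inner_neg {V : Finset E4} (hV : NonPlanar (V : Set E4))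
    (hVS : (V : Set E4) ⊆ S3) {y : E4} (hy0 : y ≠ 0)
    (hy : ∀ v ∈ V, ⟪v, y⟫ ≤ 0) : ⟪∑ v ∈ V, v, y⟫ < 0 := by
  rw [sum_inner]
  refine lt_of_le_of_ne (Finset.sum_nonpos hy) fun h => hV ⟨_, normalize_mem_S3 hy0, ?_⟩
  intro v hv
  refine ⟨hVS hv, ?_⟩
  rw [real_inner_smul_right, (Finset.sum_eq_zero_iff_of_nonpos hy).1 h v hv, mul_zero]

/-- A polar ray is determined by its set of tight constraints: these span a hyperplane, whose unit
normal is unique up to sign, and the sign is fixed by the pairing with the sum of `V`. -/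
lemma polarRays_finite {V : Finset E4} (hV : NonPlanar (V : Set E4))
    (hVS : (V : Set E4) ⊆ S3) : (polarRays V).Finite := by
  refine Set.Finite.of_injOn (f := zeros V) (t := (V.powerset : Set (Finset E4)))
    (fun y _ => by
      simp only [Finset.coe_powerset, Set.mem_preimage, Set.mem_powerset_iff, Finset.coe_subset]
      exact fun v hv => (mem_zeros.1 hv).1) ?_ V.powerset.finite_toSet
  rintro y ⟨hyS, hyV, hy3⟩ z ⟨hzS, hzV, -⟩ hyz
  set A := Submodule.span ℝ (zeros V y : Set E4) with hA
  have h1 := A.finrank_add_finrank_orthogonal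
  rw [finrank_euclideanSpace_fin] at h1
  have h2 : finrank ℝ Aᗮ = 1 := by
    have hy3' : finrank ℝ A = 3 := hy3
    omega
  have hyA : y ∈ Aᗮ := mem_orthogonal_span.2 fun v hv => (mem_zeros.1 hv).2
  have hzA : z ∈ Aᗮ := mem_orthogonal_span.2 fun v hv => by
    rw [hyz] at hv; exact (mem_zeros.1 hv).2
  obtain ⟨c, hc⟩ := (finrank_eq_one_iff_of_nonzero' (⟨y, hyA⟩ : Aᗮ) (fun h =>
    ne_zero_of_mem_S3 hyS (congrArg Subtype.val h))).1 h2 ⟨z, hzA⟩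
  have hc : c • y = z := congrArg Subtype.val hc
  have hneg := hV.sum_inner_neg hVS (ne_zero_of_mem_S3 hyS) hyV
  have hneg' := hV.sum_inner_neg hVS (ne_zero_of_mem_S3 hzS) hzV
  rw [← hc, real_inner_smul_right] at hneg'
  have hcpos : 0 < c := by
    by_contra hle
    nlinarith
  rw [mem_S3] at hyS hzS
  rw [← hc, norm_smul, hyS, mul_one, Real.norm_of_nonneg hcpos.le] at hzS
  rw [← hc, hzS, one_smul]

/-- This is the Minkowski–Weyl theorem for the polar cone, by induction on the number of dimensions
that the tight constraints lack: a point not on an extremal ray lies on a segment between two points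
of the polar cone with more tight constraints. -/
lemma mem_cone_of_polar {V W : Finset E4} (hV : NonPlanar (V : Set E4))
    (hVS : (V : Set E4) ⊆ S3) (hW : ∀ y, y ∈ W ↔ y ∈ polarRays V) :
    ∀ (n : ℕ) (y : E4), (∀ v ∈ V, ⟪v, y⟫ ≤ 0) → 3 ≤ zdim V y + n → y ∈ cone W := by
  intro n
  induction n with
  | zero =>
    intro y hy h3
    rcases eq_or_ne y 0 with rfl | hy0
    · exact zero_mem_cone W
    have hmem : ‖y‖⁻¹ • y ∈ W := by
      rw [hW]
      have hn : ‖y‖⁻¹ ≠ 0 := inv_ne_zero (norm_ne_zero_iff.2 hy0)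
      refine ⟨normalize_mem_S3 hy0, fun v hv => ?_, ?_⟩
      · rw [real_inner_smul_right]
        exact mul_nonpos_of_nonneg_of_nonpos (inv_nonneg.2 (norm_nonneg _)) (hy v hv)
      · have : zeros V (‖y‖⁻¹ • y) = zeros V y := by
          ext v; simp only [mem_zeros, real_inner_smul_right, mul_eq_zero, hn, false_or]
        rw [zdim, this]
        exact le_antisymm (zdim_le_three hy0) h3
    have := smul_mem_cone (norm_nonneg y) (mem_cone_of_mem hmem)
    rwa [smul_smul, mul_inv_cancel₀ (norm_ne_zero_iff.2 hy0), one_smul] at this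
  | succ n ih =>
    intro y hy h3
    rcases eq_or_ne y 0 with rfl | hy0
    · exact zero_mem_cone W
    by_cases hlt : 3 ≤ zdim V y + n
    · exact ih y hy hlt
    by_cases h3' : 3 ≤ zdim V y
    · exact ih y hy (by omega)
    set u := ∑ v ∈ V, v with hu
    -- Orthogonality to `u`, the sum of `V`, ensures that neither `d` nor `-d` lies in the polar
    -- cone, so one exits it in both directions.
    obtain ⟨d, hd, hd0⟩ := exists_ne_zero_orthogonal
      (S := Submodule.span ℝ (zeros V y : Set E4) ⊔ Submodule.span ℝ {u}) (by
        have h1 := Submodule.finrank_add_le_finrank_add_finrank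
          (Submodule.span ℝ (zeros V y : Set E4)) (Submodule.span ℝ {u})
        have h2 := finrank_span_le_card (R := ℝ) ({u} : Set E4)
        simp only [Set.toFinset_card, Fintype.card_unique] at h2
        unfold zdim at h3'
        omega)
    have hdz : ∀ v ∈ zeros V y, ⟪v, d⟫ = 0 := fun v hv =>
      Submodule.inner_right_of_mem_orthogonal
        (Submodule.mem_sup_left (Submodule.subset_span hv)) hd
    have hdu : ⟪u, d⟫ = 0 := Submodule.inner_right_of_mem_orthogonal
        (Submodule.mem_sup_right (Submodule.mem_span_singleton_self u)) hd
    have hex : ∀ d : E4, d ≠ 0 → ⟪u, d⟫ = 0 → ∃ v ∈ V, 0 < ⟪v, d⟫ := by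
      intro d hd0 hdu
      by_contra! hcon
      exact (hV.sum_inner_neg hVS hd0 hcon).ne hdu
    obtain ⟨t, ht, h1, h2⟩ := exists_exit hy hdz (hex d hd0 hdu)
    obtain ⟨s, hs, h4, h5⟩ := exists_exit (d := -d) hy
      (fun v hv => by rw [inner_neg_right, hdz v hv, neg_zero])
      (hex (-d) (neg_ne_zero.2 hd0) (by rw [inner_neg_right, hdu, neg_zero]))
    have hy1 := ih _ h1 (by omega)
    have hy2 := ih _ h4 (by omega)
    have key : y = (s / (s + t)) • (y + t • d) + (t / (s + t)) • (y + s • -d) := by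
      have : s + t ≠ 0 := by positivity
      match_scalars
      · field_simp
      · field_simp
        ring
    rw [key]
    exact add_mem_cone (smul_mem_cone (by positivity) hy1) (smul_mem_cone (by positivity) hy2)

/-! ### Dual pairs of polyhedral cones -/

/-- `V` and `W` are the sets of unit vectors on the extremal rays of two mutually polar
full-dimensional cones. -/
structure DualPair (V W : Finset E4) : Prop where
  left_sphere : ∀ v ∈ V, v ∈ S3
  right_sphere : ∀ w ∈ W, w ∈ S3
  mem_left : ∀ x, x ∈ cone V ↔ ∀ w ∈ W, ⟪w, x⟫ ≤ 0
  mem_right : ∀ y, y ∈ cone W ↔ ∀ v ∈ V, ⟪v, y⟫ ≤ 0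
  left_facet : ∀ v ∈ V, zdim W v = 3
  right_facet : ∀ w ∈ W, zdim V w = 3
  interior : ∃ u, (∀ v ∈ V, 0 < ⟪v, u⟫) ∧ ∀ w ∈ W, ⟪w, u⟫ < 0

lemma DualPair.symm {V W : Finset E4} (h : DualPair V W) : DualPair W V where
  left_sphere := h.right_sphere
  right_sphere := h.left_sphere
  mem_left := h.mem_right
  mem_right := h.mem_left
  left_facet := h.right_facet
  right_facet := h.left_facet
  interior := by
    obtain ⟨u, h1, h2⟩ := h.interior
    exact ⟨-u, fun w hw => by rw [inner_neg_right]; linarith [h2 w hw],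
      fun v hv => by rw [inner_neg_right]; linarith [h1 v hv]⟩

lemma IsVertexSet.exists_pos {V : Finset E4} (hV : IsVertexSet V) :
    ∃ u, ∀ v ∈ V, 0 < ⟪v, u⟫ := by
  obtain ⟨u, -, h⟩ := hV.hemispherical
  exact ⟨u, h⟩

lemma finite_eventually_pos {V : Finset E4} {p q : E4} (h : ∀ v ∈ V, 0 < ⟪v, p⟫) :
    ∃ ε : ℝ, 0 < ε ∧ ∀ v ∈ V, 0 < ⟪v, p + ε • q⟫ := by
  have h1 : ∀ᶠ ε in nhdsWithin (0 : ℝ) (Set.Ioi 0), ∀ v ∈ V, 0 < ⟪v, p + ε • q⟫ := by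
    rw [Filter.eventually_all_finset]
    intro v hv
    have hc : Continuous fun ε : ℝ => ⟪v, p + ε • q⟫ := by fun_prop
    refine nhdsWithin_le_nhds ((hc.tendsto 0).eventually_const_lt ?_)
    simpa using h v hv
  obtain ⟨ε, h2, h3⟩ := (h1.and self_mem_nhdsWithin).exists
  exact ⟨ε, h3, h2⟩

/-- If `ν` belongs to the polar cone, so does `ν + ε w` for small `ε`, when `w` is orthogonal to
the constraints that are tight at `ν`. -/
lemma exists_perturb {V : Finset E4} {ν w : E4} (hν : ∀ v ∈ V, ⟪v, ν⟫ ≤ 0)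
    (hw : ∀ v ∈ V, ⟪v, ν⟫ = 0 → ⟪v, w⟫ ≤ 0) :
    ∃ ε : ℝ, 0 < ε ∧ ∀ v ∈ V, ⟪v, ν + ε • w⟫ ≤ 0 ∧ (⟪v, ν⟫ < 0 → ⟪v, ν + ε • w⟫ < 0) := by
  classical
  obtain ⟨ε, hε, h⟩ := finite_eventually_pos (V := V.filter fun v => ⟪v, ν⟫ < 0) (p := -ν) (q := -w)
    (fun v hv => by rw [inner_neg_right]; linarith [(Finset.mem_filter.1 hv).2])
  have key : ∀ v ∈ V, ⟪v, ν⟫ < 0 → ⟪v, ν + ε • w⟫ < 0 := fun v hv hlt => by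
    have h1 := h v (Finset.mem_filter.2 ⟨hv, hlt⟩)
    rw [smul_neg, ← neg_add, inner_neg_right] at h1
    linarith
  refine ⟨ε, hε, fun v hv => ⟨?_, key v hv⟩⟩
  rcases (hν v hv).lt_or_eq with hlt | heq
  · exact (key v hv hlt).le
  · rw [inner_add_right, heq, real_inner_smul_right, zero_add]
    exact mul_nonpos_of_nonneg_of_nonpos hε.le (hw v hv heq)

/-- An extremal point of a convex polyhedron is exposed. -/
lemma IsVertexSet.exists_exposing {V : Finset E4} (hV : IsVertexSet V) {v : E4} (hv : v ∈ V) :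
    ∃ ν, ⟪v, ν⟫ = 0 ∧ ∀ w ∈ V, w ≠ v → ⟪w, ν⟫ < 0 := by
  classical
  obtain ⟨u, hu⟩ := hV.exists_pos
  have hcl : IsClosed (cone (V.erase v)) :=
    isClosed_cone fun w hw => hu w (Finset.mem_of_mem_erase hw)
  obtain ⟨x, hx, h1, h2⟩ := exists_moreau hcl v
  have hne : v - x ≠ 0 := fun h => by
    rw [sub_eq_zero] at h
    refine hV.extremal v hv ⟨?_, hV.subset_sphere hv⟩
    convert hx
  have hpos : 0 < ⟪v, v - x⟫ := by
    have h3 : ⟪v, v - x⟫ = ⟪v - x, v - x⟫ := by rw [inner_sub_left (𝕜 := ℝ) v x, h2, sub_zero]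
    rw [h3]; exact real_inner_self_pos.2 hne
  have huv := hu v hv
  -- The residual `v - x` is positive at `v` and nonpositive at the other points. Subtracting the
  -- multiple of `u` that makes it vanish at `v` makes it strictly negative at the others.
  refine ⟨(v - x) - (⟪v, v - x⟫ / ⟪v, u⟫) • u, ?_, fun w hw hwv => ?_⟩
  · rw [inner_sub_right, real_inner_smul_right]; field_simp; ring
  · rw [inner_sub_right, real_inner_smul_right]
    have h4 := h1 w (Finset.mem_erase.2 ⟨hwv, hw⟩)
    have h5 := mul_pos (div_pos hpos huv) (hu w hw)
    linarith

lemma finrank_orthogonal_singleton {v : E4} (hv : v ≠ 0) :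
    finrank ℝ (Submodule.span ℝ ({v} : Set E4))ᗮ = 3 := by
  have h1 := (Submodule.span ℝ ({v} : Set E4)).finrank_add_finrank_orthogonal
  rw [finrank_euclideanSpace_fin, finrank_span_singleton hv] at h1
  omega

/-- An element of a cone that is orthogonal to a support vector is spanned by generators that are
orthogonal to it. -/
lemma mem_cone_zeros {V : Finset E4} {ν x : E4} (hν : ∀ v ∈ V, ⟪v, ν⟫ ≤ 0) (hx : x ∈ cone V)
    (hxν : ⟪x, ν⟫ = 0) : x ∈ cone (zeros V ν) := by
  obtain ⟨a, ha, rfl⟩ := hx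
  have hnp : ∀ v ∈ V, ⟪a v • v, ν⟫ ≤ 0 := fun v hv => by
    rw [real_inner_smul_left]; exact mul_nonpos_of_nonneg_of_nonpos (ha v hv) (hν v hv)
  rw [sum_inner, Finset.sum_eq_zero_iff_of_nonpos hnp] at hxν
  refine sum_mem_cone _ _ fun v hv => ?_
  have h := hxν v hv
  rw [real_inner_smul_left] at h
  rcases mul_eq_zero.1 h with h | h
  · rw [h, zero_smul]; exact zero_mem_cone _
  · exact smul_mem_cone (ha v hv) (mem_cone_of_mem (mem_zeros.2 ⟨hv, h⟩))

lemma cone_subset_span (V : Finset E4) : cone V ⊆ Submodule.span ℝ (V : Set E4) := by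
  rintro _ ⟨a, -, rfl⟩
  exact Submodule.sum_mem _ fun v hv => Submodule.smul_mem _ _ (Submodule.subset_span hv)

/-- `W` consists of the extremal rays of the polar cone. Non-planarity gives their finiteness and
generation, the open half-sphere gives closedness of the cone and hence biduality, and extremality
gives that every point of `V` is dual to a full facet of the polar cone. -/
theorem IsVertexSet.exists_dualPair {V : Finset E4} (hV : IsVertexSet V) :
    ∃ W, DualPair V W := by
  have hfin := polarRays_finite hV.nonPlanar hV.subset_sphere
  set W := hfin.toFinset with hWdef
  have hW : ∀ y, y ∈ W ↔ y ∈ polarRays V := fun y => hfin.mem_toFinset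
  obtain ⟨u₀, hu₀⟩ := hV.exists_pos
  have hcl := isClosed_cone hu₀
  have mem_right : ∀ y, y ∈ cone W ↔ ∀ v ∈ V, ⟪v, y⟫ ≤ 0 := fun y =>
    ⟨fun hy v hv => by
      rw [real_inner_comm]
      exact inner_nonpos_of_mem_cone (fun w hw => by
        rw [real_inner_comm]; exact ((hW w).1 hw).2.1 v hv) hy,
    fun hy => mem_cone_of_polar hV.nonPlanar hV.subset_sphere hW 3 y hy (by omega)⟩
  have hneg : ∀ w ∈ W, ⟪w, ∑ v ∈ V, v⟫ < 0 := fun w hw => by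
    rw [real_inner_comm]
    exact hV.nonPlanar.sum_inner_neg hV.subset_sphere (ne_zero_of_mem_S3 ((hW w).1 hw).1)
      ((hW w).1 hw).2.1
  refine ⟨W, fun v hv => hV.subset_sphere hv, fun w hw => ((hW w).1 hw).1, fun x => ?_, mem_right,
    fun v hv => ?_, fun w hw => ((hW w).1 hw).2.2, ?_⟩
  · refine ⟨fun hx w hw => ?_, fun hx => ?_⟩
    · rw [real_inner_comm]; exact inner_nonpos_of_mem_cone ((hW w).1 hw).2.1 hx
    -- Bipolar argument: the residual `x - k` is in the polar cone, so ‖x - k‖² = ⟪x - k, x⟫ ≤ 0.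
    · obtain ⟨k, hk, h1, h2⟩ := exists_moreau hcl x
      have h3 : ⟪x - k, x⟫ ≤ 0 := inner_nonpos_of_mem_cone hx ((mem_right _).2 h1)
      have h4 : ⟪x - k, x - k⟫ ≤ 0 := by
        rw [inner_sub_right (x - k) x k, real_inner_comm k (x - k), h2]; linarith
      rw [real_inner_self_nonpos, sub_eq_zero] at h4
      rwa [h4]
  · have hv0 := ne_zero_of_mem_S3 (hV.subset_sphere hv)
    refine le_antisymm (zdim_le_three hv0) ?_
    rw [← finrank_orthogonal_singleton hv0]
    refine Submodule.finrank_mono fun z hz => ?_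
    rw [mem_orthogonal_span] at hz
    have hvz : ⟪v, z⟫ = 0 := hz v rfl
    -- Only `v` is tight at `ν`, so `ν` can be moved slightly in every direction `z` orthogonal to
    -- `v` without leaving the polar cone. Hence the polar face orthogonal to `v` spans a
    -- hyperplane.
    obtain ⟨ν, hν, hνV⟩ := hV.exists_exposing hv
    have hνle : ∀ w ∈ V, ⟪w, ν⟫ ≤ 0 := fun w hw => by
      by_cases h : w = v
      · rw [h, hν]
      · exact (hνV w hw h).le
    obtain ⟨ε, hε, hpert⟩ := exists_perturb (w := z) hνle fun w hw hw0 => by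
      by_cases h : w = v
      · rw [h, hvz]
      · exact absurd hw0 (hνV w hw h).ne
    have hspan : ∀ y, (∀ v ∈ V, ⟪v, y⟫ ≤ 0) → ⟪v, y⟫ = 0 →
        y ∈ Submodule.span ℝ (zeros W v : Set E4) := fun y hy hvy =>
      cone_subset_span _ (mem_cone_zeros (fun w hw => by
        rw [real_inner_comm]; exact ((hW w).1 hw).2.1 v hv) ((mem_right y).2 hy)
        (by rw [real_inner_comm]; exact hvy))
    have h1 := hspan ν hνle hν
    have h2 := hspan (ν + ε • z) (fun w hw => (hpert w hw).1) (by
      rw [inner_add_right, real_inner_smul_right, hν, hvz]; ring)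
    have h3 := (Submodule.add_mem_iff_right _ h1).1 h2
    exact (Submodule.smul_mem_iff _ hε.ne').1 h3
  -- Projecting `u₀` to the cone does not decrease its pairings with `V`, and makes those with `W`
  -- nonpositive; a small multiple of the sum of `V` makes the latter strict.
  · obtain ⟨u₁, hu₁, h1, h2⟩ := exists_moreau hcl u₀
    have hpos : ∀ v ∈ V, 0 < ⟪v, u₁⟫ := fun v hv => by
      have := h1 v hv
      rw [inner_sub_right] at this
      linarith [hu₀ v hv]
    obtain ⟨ε, hε, h⟩ := finite_eventually_pos (q := ∑ v ∈ V, v) hpos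
    refine ⟨_, h, fun w hw => ?_⟩
    rw [inner_add_right, real_inner_smul_right]
    have h3 : ⟪w, u₁⟫ ≤ 0 := by
      rw [real_inner_comm]; exact inner_nonpos_of_mem_cone ((hW w).1 hw).2.1 hu₁
    nlinarith [hneg w hw]

section

variable {V W : Finset E4}

/-! ### Cells of a polyhedral sphere -/

lemma DualPair.inner_nonpos (h : DualPair V W) {x y : E4} (hx : x ∈ cone V) (hy : y ∈ cone W) :
    ⟪x, y⟫ ≤ 0 :=
  inner_nonpos_of_mem_cone (fun v hv => (h.mem_right y).1 hy v hv) hx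

lemma DualPair.dualCone_eq (h : DualPair V W) : dualCone V = cone W := by
  ext y
  rw [h.mem_right]
  refine ⟨fun hy v hv => ?_, fun hy x hx => ?_⟩
  · rw [real_inner_comm]; exact hy v (mem_cone_of_mem hv)
  · rw [real_inner_comm]; exact inner_nonpos_of_mem_cone hy hx

lemma DualPair.Pdual_eq (h : DualPair V W) : Pdual V = P W := by
  rw [Pdual, h.dualCone_eq]; rfl

lemma CH_subset_S3 (V : Finset E4) : CH V ⊆ S3 := fun _ hx => hx.2

lemma DualPair.pos_of_mem_cone (h : DualPair V W) :
    ∃ u, (∀ x ∈ cone V, x ≠ 0 → 0 < ⟪x, u⟫) ∧ ∀ y ∈ cone W, y ≠ 0 → ⟪y, u⟫ < 0 := by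
  obtain ⟨u, h1, h2⟩ := h.interior
  exact ⟨u, fun x hx => inner_pos_of_mem_cone h1 hx, fun y hy => inner_neg_of_mem_cone h2 hy⟩

lemma DualPair.add_ne_zero (h : DualPair V W) {x y : E4} (hx : x ∈ cone V) (hx0 : x ≠ 0)
    (hy : y ∈ cone V) : x + y ≠ 0 := fun h0 => by
  obtain ⟨u, h1, -⟩ := h.pos_of_mem_cone
  have h2 := h1 x hx hx0
  rcases eq_or_ne y 0 with rfl | hy0
  · exact hx0 (by simpa using h0)
  · have h3 := h1 y hy hy0
    have h4 : ⟪x + y, u⟫ = 0 := by rw [h0, inner_zero_left]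
    rw [inner_add_left] at h4
    linarith

lemma DualPair.isClosed_cone (h : DualPair V W) : IsClosed (cone V) := by
  obtain ⟨u, h1, -⟩ := h.interior
  exact SphPoly.isClosed_cone h1

/-- Moving from `x` in the direction of its support vector `ν` leaves the hull at once, so `x` is
not an interior point. -/
lemma DualPair.mem_P_of_inner_eq_zero (h : DualPair V W) {x ν : E4} (hx : x ∈ CH V)
    (hν : ν ∈ cone W) (hν0 : ν ≠ 0) (hxν : ⟪x, ν⟫ = 0) : x ∈ P V := by
  refine ⟨⟨x, hx.2⟩, ⟨subset_closure hx, fun hint => ?_⟩, rfl⟩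
  have hne : ∀ t : ℝ, x + t • ν ≠ 0 := fun t h0 => by
    have h1 : ⟪x, x + t • ν⟫ = 1 := by
      rw [inner_add_right, real_inner_smul_right, hxν, real_inner_self_eq_norm_sq, mem_S3.1 hx.2]
      norm_num
    rw [h0, inner_zero_right] at h1
    exact zero_ne_one h1
  let γ : ℝ → Metric.sphere (0 : E4) 1 := fun t =>
    ⟨‖x + t • ν‖⁻¹ • (x + t • ν), normalize_mem_S3 (hne t)⟩
  have hγ : Continuous γ := by
    have hc : Continuous fun t : ℝ => x + t • ν := by fun_prop
    exact (((hc.norm).inv₀ fun t => norm_ne_zero_iff.2 (hne t)).smul hc).subtype_mk _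
  have hγ0 : γ 0 = ⟨x, hx.2⟩ := by
    ext1; simp [γ, mem_S3.1 hx.2]
  have h1 : ∀ᶠ t in nhdsWithin (0 : ℝ) (Set.Ioi 0), γ t ∈ (Subtype.val ⁻¹' CH V : Set _) := by
    refine nhdsWithin_le_nhds (hγ.tendsto 0 ?_)
    rw [hγ0]
    exact mem_interior_iff_mem_nhds.1 hint
  obtain ⟨t, h2, h3⟩ := (h1.and self_mem_nhdsWithin).exists
  have h4 : ⟪‖x + t • ν‖⁻¹ • (x + t • ν), ν⟫ ≤ 0 := h.inner_nonpos h2.1 hν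
  rw [real_inner_smul_left, inner_add_left, real_inner_smul_left, hxν, zero_add] at h4
  have h5 : 0 < ‖x + t • ν‖⁻¹ * (t * ⟪ν, ν⟫) :=
    mul_pos (inv_pos.2 (norm_pos_iff.2 (hne t))) (mul_pos h3 (real_inner_self_pos.2 hν0))
  linarith

lemma DualPair.P_subset (h : DualPair V W) : P V ⊆ CH V := by
  rintro _ ⟨x, hx, rfl⟩
  have hcl : IsClosed (Subtype.val ⁻¹' CH V : Set (Metric.sphere (0 : E4) 1)) := by
    have : (Subtype.val ⁻¹' CH V : Set (Metric.sphere (0 : E4) 1)) = Subtype.val ⁻¹' cone V := by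
      ext y; exact and_iff_left y.2
    rw [this]
    exact h.isClosed_cone.preimage continuous_subtype_val
  exact hcl.frontier_subset hx

lemma DualPair.vertex_mem_P (h : DualPair V W) {v : E4} (hv : v ∈ V) : v ∈ P V := by
  have h3 := h.left_facet v hv
  have hne : (zeros W v).Nonempty := by
    by_contra hcon
    rw [Finset.not_nonempty_iff_eq_empty] at hcon
    rw [zdim, hcon, Finset.coe_empty, Submodule.span_empty, finrank_bot] at h3
    exact absurd h3 (by norm_num)
  obtain ⟨w, hw⟩ := hne
  obtain ⟨hwW, hwv⟩ := mem_zeros.1 hw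
  exact h.mem_P_of_inner_eq_zero ⟨mem_cone_of_mem hv, h.left_sphere v hv⟩ (mem_cone_of_mem hwW)
    (ne_zero_of_mem_S3 (h.right_sphere w hwW)) (by rw [real_inner_comm]; exact hwv)

/-- The generators of the cone lie on P itself, so a half-sphere that contains P contains the whole
hull. -/
lemma DualPair.P_subset_halfSphere_iff (h : DualPair V W) {ν : E4} :
    P V ⊆ HalfSphere ν ↔ ν ∈ cone W := by
  refine ⟨fun hP => (h.mem_right ν).2 fun v hv => (hP (h.vertex_mem_P hv)).2, fun hν x hx => ?_⟩
  exact ⟨(h.P_subset hx).2, h.inner_nonpos (h.P_subset hx).1 hν⟩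

/-- The intersection of the convex hull with the plane with normal `ν`. -/
def face (V : Finset E4) (ν : E4) : Set E4 := {x | x ∈ CH V ∧ ⟪x, ν⟫ = 0}

lemma DualPair.P_inter_Pl (h : DualPair V W) {ν : E4} (hν : ν ∈ CH W) :
    P V ∩ Pl ν = face V ν := by
  ext x
  exact ⟨fun hx => ⟨h.P_subset hx.1, hx.2.2⟩, fun hx => ⟨h.mem_P_of_inner_eq_zero hx.1 hν.1
    (ne_zero_of_mem_S3 hν.2) hx.2, hx.1.2, hx.2⟩⟩

/-- The dimension of the linear span. -/
noncomputable def sdim (g : Set E4) : ℕ := finrank ℝ (Submodule.span ℝ g)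

lemma DualPair.mem_cells (h : DualPair V W) {g : Set E4} {k : ℕ} :
    g ∈ cells (P V) k ↔ ∃ ν ∈ CH W, g = face V ν ∧ sdim g = k := by
  constructor
  · rintro ⟨ν, hν, hP, rfl, hk⟩
    have hν' : ν ∈ CH W := ⟨h.P_subset_halfSphere_iff.1 hP, hν⟩
    exact ⟨ν, hν', h.P_inter_Pl hν', hk⟩
  · rintro ⟨ν, hν, rfl, hk⟩
    exact ⟨ν, hν.2, h.P_subset_halfSphere_iff.2 hν.1, (h.P_inter_Pl hν).symm, hk⟩

lemma face_subset_CH {ν : E4} : face V ν ⊆ CH V := fun _ hx => hx.1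

lemma DualPair.face_eq_CH (h : DualPair V W) {ν : E4} (hν : ν ∈ cone W) :
    face V ν = CH (zeros V ν) := by
  ext x
  refine ⟨fun hx => ⟨mem_cone_zeros ((h.mem_right ν).1 hν) hx.1.1 hx.2, hx.1.2⟩,
    fun hx => ⟨⟨cone_mono (fun v hv => (mem_zeros.1 hv).1) hx.1, hx.2⟩, ?_⟩⟩
  refine le_antisymm (inner_nonpos_of_mem_cone (fun v hv => (mem_zeros.1 hv).2.le) hx.1)
    (inner_nonneg_of_mem_cone (fun v hv => (mem_zeros.1 hv).2.ge) hx.1)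

lemma DualPair.zeros_subset_face (h : DualPair V W) {ν : E4} :
    (zeros V ν : Set E4) ⊆ face V ν := fun v hv => by
  obtain ⟨h1, h2⟩ := mem_zeros.1 hv
  exact ⟨⟨mem_cone_of_mem h1, h.left_sphere v h1⟩, h2⟩

lemma DualPair.span_face (h : DualPair V W) {ν : E4} (hν : ν ∈ cone W) :
    Submodule.span ℝ (face V ν) = Submodule.span ℝ (zeros V ν : Set E4) := by
  refine le_antisymm (Submodule.span_le.2 ?_) (Submodule.span_mono h.zeros_subset_face)
  rw [h.face_eq_CH hν]
  exact fun x hx => cone_subset_span _ hx.1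

lemma nonempty_of_sdim {g : Set E4} (h : sdim g ≠ 0) : g.Nonempty := by
  by_contra hne
  rw [Set.not_nonempty_iff_eq_empty] at hne
  rw [hne, sdim, Submodule.span_empty, finrank_bot] at h
  exact h rfl

lemma sdim_pos {g : Set E4} (hg : g.Nonempty) (hS : g ⊆ S3) : 1 ≤ sdim g := by
  obtain ⟨x, hx⟩ := hg
  rw [Nat.one_le_iff_ne_zero]
  intro h0
  have := Submodule.finrank_eq_zero.1 h0
  rw [Submodule.span_eq_bot] at this
  exact ne_zero_of_mem_S3 (hS hx) (this x hx)

lemma sdim_mono {g g' : Set E4} (h : g ⊆ g') : sdim g ≤ sdim g' :=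
  Submodule.finrank_mono (Submodule.span_mono h)

/-! ### Duality between the cells of P and of P* -/

/-- The part of the polar polyhedron that is orthogonal to `g`. -/
def polarFace (W : Finset E4) (g : Set E4) : Set E4 := {y | y ∈ CH W ∧ ∀ x ∈ g, ⟪x, y⟫ = 0}

/-- The requirement to lie on P*, and not just in its convex hull, is automatic: a unit vector of
the polar cone orthogonal to a point of the hull is on the boundary. -/
lemma DualPair.dual_eq (h : DualPair V W) {g : Set E4} (hg : g.Nonempty) (hgV : g ⊆ CH V) :
    dual V g = polarFace W g := by
  ext y
  rw [dual, h.Pdual_eq]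
  constructor
  · rintro ⟨h1, h2⟩
    exact ⟨h.symm.P_subset h1, fun x hx => by rw [real_inner_comm]; exact h2 x hx⟩
  · rintro ⟨h1, h2⟩
    obtain ⟨x, hx⟩ := hg
    exact ⟨h.symm.mem_P_of_inner_eq_zero h1 (hgV hx).1 (ne_zero_of_mem_S3 (hgV hx).2)
      (by rw [real_inner_comm]; exact h2 x hx), fun x hx => by rw [real_inner_comm]; exact h2 x hx⟩

lemma DualPair.cell_nonempty (_ : DualPair V W) {g : Set E4} {k : ℕ} (hk : k ≠ 0)
    (hg : g ∈ cells (P V) k) : g.Nonempty := by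
  obtain ⟨ν, -, -, -, h2⟩ := hg
  exact nonempty_of_sdim (by rw [sdim, h2]; exact hk)

lemma DualPair.cell_subset (h : DualPair V W) {g : Set E4} {k : ℕ}
    (hg : g ∈ cells (P V) k) : g ⊆ CH V := by
  obtain ⟨ν, -, rfl, -⟩ := h.mem_cells.1 hg
  exact face_subset_CH

lemma DualPair.sdim_cell (h : DualPair V W) {g : Set E4} {k : ℕ}
    (hg : g ∈ cells (P V) k) : sdim g = k := by
  obtain ⟨ν, -, rfl, h2⟩ := h.mem_cells.1 hg
  exact h2

lemma DualPair.dual_cell (h : DualPair V W) {g : Set E4} {k : ℕ} (hk : k ≠ 0)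
    (hg : g ∈ cells (P V) k) : dual V g = polarFace W g :=
  h.dual_eq (h.cell_nonempty hk hg) (h.cell_subset hg)

lemma inv_norm_mul_eq_zero {x : E4} (hx : x ≠ 0) {c : ℝ} : ‖x‖⁻¹ * c = 0 ↔ c = 0 := by
  rw [mul_eq_zero, or_iff_right (inv_ne_zero (norm_ne_zero_iff.2 hx))]

lemma normalize_mem_CH {x : E4} (hx : x ∈ cone V) (hx0 : x ≠ 0) : ‖x‖⁻¹ • x ∈ CH V :=
  ⟨smul_mem_cone (inv_nonneg.2 (norm_nonneg _)) hx, normalize_mem_S3 hx0⟩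

lemma face_normalize {ν : E4} (hν : ν ≠ 0) : face V (‖ν‖⁻¹ • ν) = face V ν := by
  ext x
  simp only [face, Set.mem_ofPred_eq, real_inner_smul_right, inv_norm_mul_eq_zero hν]

lemma DualPair.zeros_nonempty (h : DualPair V W) {ν : E4} (hν : ν ∈ cone W)
    (hne : sdim (face V ν) ≠ 0) : (zeros V ν).Nonempty := by
  rw [sdim, h.span_face hν] at hne
  exact Finset.coe_nonempty.1 (nonempty_of_sdim hne)

lemma DualPair.sum_ne_zero (h : DualPair V W) {s : Finset E4} (hs : s ⊆ V) (hne : s.Nonempty) :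
    ∑ v ∈ s, v ≠ 0 := fun h0 => by
  obtain ⟨u, hu, -⟩ := h.interior
  have : 0 < ∑ v ∈ s, ⟪v, u⟫ := Finset.sum_pos (fun v hv => hu v (hs hv)) hne
  rw [← sum_inner, h0, inner_zero_left] at this
  exact lt_irrefl _ this

/-- The normalised sum of the generators in a face is a relative interior point of it. All pairings
with the polar cone are nonpositive, so orthogonality to the sum forces orthogonality to each
generator; thus the polar face is exposed by this one point. -/
lemma DualPair.polarFace_face (h : DualPair V W) {ν : E4} (hν : ν ∈ cone W)
    (hne : sdim (face V ν) ≠ 0) :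
    ∃ x ∈ face V ν, polarFace W (face V ν) = face W x := by
  have hs : zeros V ν ⊆ V := fun v hv => (mem_zeros.1 hv).1
  have h0 := h.sum_ne_zero hs (h.zeros_nonempty hν hne)
  have hmem : ‖∑ v ∈ zeros V ν, v‖⁻¹ • ∑ v ∈ zeros V ν, v ∈ face V ν := by
    rw [h.face_eq_CH hν]
    exact normalize_mem_CH (sum_mem_cone _ _ fun v hv => mem_cone_of_mem hv) h0
  refine ⟨_, hmem, ?_⟩
  rw [face_normalize h0]
  ext y
  refine ⟨fun hy => ⟨hy.1, ?_⟩, fun hy => ⟨hy.1, fun x hx => ?_⟩⟩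
  · have := hy.2 _ hmem
    rw [real_inner_smul_left, inv_norm_mul_eq_zero h0] at this
    rw [real_inner_comm]; exact this
  · have h1 := hy.2
    rw [real_inner_comm, sum_inner, Finset.sum_eq_zero_iff_of_nonpos fun v hv =>
      (h.mem_right y).1 hy.1.1 v (hs hv)] at h1
    rw [h.face_eq_CH hν] at hx
    exact le_antisymm (inner_nonpos_of_mem_cone (fun v hv => (h1 v hv).le) hx.1)
      (inner_nonneg_of_mem_cone (fun v hv => (h1 v hv).ge) hx.1)

/-- `ν` belongs to the polar face, and remains in the corresponding face of the cone after a small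
move in any direction orthogonal to `face V ν`; so these directions are all spanned. -/
lemma DualPair.span_polarFace (h : DualPair V W) {ν : E4} (hν : ν ∈ CH W) :
    Submodule.span ℝ (polarFace W (face V ν)) = (Submodule.span ℝ (face V ν))ᗮ := by
  refine le_antisymm (Submodule.span_le.2 fun y hy => mem_orthogonal_span.2 hy.2) fun z hz => ?_
  rw [mem_orthogonal_span] at hz
  have hνle := (h.mem_right ν).1 hν.1
  have hmem : ∀ y ∈ cone W, (∀ x ∈ face V ν, ⟪x, y⟫ = 0) →
      y ∈ Submodule.span ℝ (polarFace W (face V ν)) := fun y hy hyx => by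
    rcases eq_or_ne y 0 with rfl | hy0
    · exact Submodule.zero_mem _
    · have h1 : ‖y‖⁻¹ • y ∈ Submodule.span ℝ (polarFace W (face V ν)) :=
        Submodule.subset_span ⟨normalize_mem_CH hy hy0, fun x hx => by
          rw [real_inner_smul_right, hyx x hx, mul_zero]⟩
      exact (Submodule.smul_mem_iff _ (inv_ne_zero (norm_ne_zero_iff.2 hy0))).1 h1
  obtain ⟨ε, hε, hp⟩ := exists_perturb (w := z) hνle fun v hv hv0 =>
    (hz v (h.zeros_subset_face (mem_zeros.2 ⟨hv, hv0⟩))).le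
  have h1 := hmem ν hν.1 fun x hx => hx.2
  have h2 := hmem (ν + ε • z) ((h.mem_right _).2 fun v hv => (hp v hv).1) fun x hx => by
    rw [inner_add_right, real_inner_smul_right, hx.2, hz x hx]; ring
  exact (Submodule.smul_mem_iff _ hε.ne').1 ((Submodule.add_mem_iff_right _ h1).1 h2)

lemma finrank_orthogonal (S : Submodule ℝ E4) : finrank ℝ Sᗮ = 4 - finrank ℝ S := by
  have := S.finrank_add_finrank_orthogonal
  rw [finrank_euclideanSpace_fin] at this
  omega

lemma DualPair.span_dual (h : DualPair V W) {g : Set E4} {k : ℕ} (hk : k ≠ 0)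
    (hg : g ∈ cells (P V) k) : Submodule.span ℝ (dual V g) = (Submodule.span ℝ g)ᗮ := by
  rw [h.dual_cell hk hg]
  obtain ⟨ν, hν, rfl, -⟩ := h.mem_cells.1 hg
  exact h.span_polarFace hν

lemma DualPair.dual_mem_cells (h : DualPair V W) {g : Set E4} {k : ℕ} (hk : k ≠ 0)
    (hg : g ∈ cells (P V) k) : dual V g ∈ cells (P W) (4 - k) := by
  have hspan := h.span_dual hk hg
  have hd := h.dual_cell hk hg
  rw [hd] at hspan ⊢
  obtain ⟨ν, hν, rfl, hk'⟩ := h.mem_cells.1 hg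
  obtain ⟨x, hx, heq⟩ := h.polarFace_face hν.1 (by rw [hk']; exact hk)
  refine h.symm.mem_cells.2 ⟨x, hx.1, heq, ?_⟩
  rw [sdim, hspan, finrank_orthogonal, ← hk', sdim]

lemma DualPair.cell_le_three (h : DualPair V W) {g : Set E4} {k : ℕ}
    (hg : g ∈ cells (P V) k) : k ≤ 3 := by
  obtain ⟨ν, hν, rfl, hk⟩ := h.mem_cells.1 hg
  rw [← hk, sdim, h.span_face hν.1]
  exact zdim_le_three (ne_zero_of_mem_S3 hν.2)

/-- The vector that exposes `g` lies in `g*`, so what is orthogonal to `g*` lies in `g`. -/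
lemma DualPair.dual_dual (h : DualPair V W) {g : Set E4} {k : ℕ} (hk : k ≠ 0)
    (hg : g ∈ cells (P V) k) : dual W (dual V g) = g := by
  have h3 := h.cell_le_three hg
  have h1 := h.dual_mem_cells hk hg
  rw [h.symm.dual_cell (by omega) h1, h.dual_cell hk hg]
  obtain ⟨ν, hν, rfl, -⟩ := h.mem_cells.1 hg
  ext x
  refine ⟨fun hx => ⟨hx.1, ?_⟩, fun hx => ⟨hx.1, fun y hy => ?_⟩⟩
  · rw [real_inner_comm]
    exact hx.2 ν ⟨hν, fun y hy => hy.2⟩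
  · rw [real_inner_comm]; exact hy.2 x hx

lemma dual_anti {g g' : Set E4} (h : g ⊆ g') : dual V g' ⊆ dual V g :=
  fun _ hy => ⟨hy.1, fun x hx => hy.2 x (h hx)⟩

/-- The two spans coincide, so the normal that exposes the smaller cell also vanishes on the larger
one. -/
lemma DualPair.cell_eq_of_subset (h : DualPair V W) {g g' : Set E4} {k : ℕ}
    (hg : g ∈ cells (P V) k) (hg' : g' ∈ cells (P V) k) (hsub : g ⊆ g') : g = g' := by
  have h1 := h.sdim_cell hg
  have h2 := h.sdim_cell hg'
  have hspan : Submodule.span ℝ g = Submodule.span ℝ g' :=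
    Submodule.eq_of_le_of_finrank_eq (Submodule.span_mono hsub) (h1.trans h2.symm)
  obtain ⟨ν, hν, rfl, -⟩ := h.mem_cells.1 hg
  refine hsub.antisymm fun x hx => ⟨h.cell_subset hg' hx, ?_⟩
  have h3 : x ∈ Submodule.span ℝ (face V ν) := hspan ▸ Submodule.subset_span hx
  have h4 : ν ∈ (Submodule.span ℝ (face V ν))ᗮ := mem_orthogonal_span.2 fun y hy => hy.2
  exact Submodule.inner_right_of_mem_orthogonal h3 h4

/-- The sum of the two exposing normals exposes the intersection, since both pairings are
nonpositive on the hull. -/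
lemma DualPair.inter_mem_cells (h : DualPair V W) {g g' : Set E4} {k k' : ℕ}
    (hg : g ∈ cells (P V) k) (hg' : g' ∈ cells (P V) k') :
    g ∩ g' ∈ cells (P V) (sdim (g ∩ g')) := by
  obtain ⟨ν, hν, rfl, -⟩ := h.mem_cells.1 hg
  obtain ⟨μ, hμ, rfl, -⟩ := h.mem_cells.1 hg'
  have h0 := h.symm.add_ne_zero hν.1 (ne_zero_of_mem_S3 hν.2) hμ.1
  refine h.mem_cells.2 ⟨_, normalize_mem_CH (add_mem_cone hν.1 hμ.1) h0, ?_, rfl⟩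
  rw [face_normalize h0]
  ext x
  constructor
  · rintro ⟨h1, h2⟩
    exact ⟨h1.1, by rw [inner_add_right, h1.2, h2.2, add_zero]⟩
  · rintro ⟨h1, h2⟩
    have h3 := h.inner_nonpos h1.1 hν.1
    have h4 := h.inner_nonpos h1.1 hμ.1
    rw [inner_add_right] at h2
    exact ⟨⟨h1, by linarith⟩, ⟨h1, by linarith⟩⟩

/-- The cells of a cell of a polyhedral sphere are the cells contained in it. -/
lemma DualPair.mem_cells_cell (h : DualPair V W) {g g' : Set E4} {k m : ℕ}
    (hg : g ∈ cells (P V) m) : g' ∈ cells g k ↔ g' ∈ cells (P V) k ∧ g' ⊆ g := by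
  obtain ⟨ν, hν, rfl, -⟩ := h.mem_cells.1 hg
  have hνle := (h.mem_right ν).1 hν.1
  constructor
  · rintro ⟨μ, hμ, hhalf, rfl, hk⟩
    refine ⟨?_, Set.inter_subset_left⟩
    -- Tilting `ν` slightly towards `μ` gives a normal that exposes, in all of P, the part of the
    -- cell where `μ` vanishes.
    obtain ⟨ε, hε, hp⟩ := exists_perturb (w := μ) hνle fun v hv hv0 =>
      (hhalf (h.zeros_subset_face (mem_zeros.2 ⟨hv, hv0⟩))).2
    -- If the tilted vector is zero, `μ` is a multiple of `ν` and cuts out the whole cell.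
    rcases eq_or_ne (ν + ε • μ) 0 with h0 | h0
    · refine h.mem_cells.2 ⟨ν, hν, ?_, hk⟩
      refine Set.inter_subset_left.antisymm fun x hx => ⟨hx, hx.1.2, ?_⟩
      have h1 : ⟪x, ν + ε • μ⟫ = 0 := by rw [h0, inner_zero_right]
      rw [inner_add_right, hx.2, zero_add, real_inner_smul_right] at h1
      exact (mul_eq_zero.1 h1).resolve_left hε.ne'
    · have hmem : ν + ε • μ ∈ cone W := (h.mem_right _).2 fun v hv => (hp v hv).1
      refine h.mem_cells.2 ⟨_, normalize_mem_CH hmem h0, ?_, hk⟩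
      rw [face_normalize h0]
      ext x
      constructor
      · rintro ⟨h1, h2⟩
        exact ⟨h1.1, by rw [inner_add_right, real_inner_smul_right, h1.2, h2.2]; ring⟩
      · intro hx
        rw [h.face_eq_CH hmem] at hx
        have hz : ∀ v ∈ zeros V (ν + ε • μ), ⟪v, ν⟫ = 0 ∧ ⟪v, μ⟫ = 0 := fun v hv => by
          obtain ⟨hv, hv0⟩ := mem_zeros.1 hv
          have h1 : ⟪v, ν⟫ = 0 := by
            by_contra hne
            exact ((hp v hv).2 (lt_of_le_of_ne (hνle v hv) hne)).ne hv0
          refine ⟨h1, ?_⟩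
          rw [inner_add_right, h1, zero_add, real_inner_smul_right] at hv0
          exact (mul_eq_zero.1 hv0).resolve_left hε.ne'
        have hxV : x ∈ CH V := ⟨cone_mono (fun v hv => (mem_zeros.1 hv).1) hx.1, hx.2⟩
        exact ⟨⟨hxV, le_antisymm (inner_nonpos_of_mem_cone (fun v hv => (hz v hv).1.le) hx.1)
          (inner_nonneg_of_mem_cone (fun v hv => (hz v hv).1.ge) hx.1)⟩, hx.2,
          le_antisymm (inner_nonpos_of_mem_cone (fun v hv => (hz v hv).2.le) hx.1)
          (inner_nonneg_of_mem_cone (fun v hv => (hz v hv).2.ge) hx.1)⟩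
  · rintro ⟨hg', hsub⟩
    obtain ⟨μ, hμ, rfl, hk⟩ := h.mem_cells.1 hg'
    refine ⟨μ, hμ.2, fun x hx => ⟨hx.1.2, h.inner_nonpos hx.1.1 hμ.1⟩, ?_, hk⟩
    ext x
    exact ⟨fun hx => ⟨hsub hx, hx.1.2, hx.2⟩, fun hx => ⟨hx.1.1, hx.2.2⟩⟩

lemma DualPair.eq_of_smul (h : DualPair V W) {x y : E4} (hx : x ∈ CH V) (hy : y ∈ CH V) {c : ℝ}
    (hc : c • x = y) : x = y := by
  obtain ⟨u, hu, -⟩ := h.pos_of_mem_cone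
  have h1 := hu x hx.1 (ne_zero_of_mem_S3 hx.2)
  have h2 := hu y hy.1 (ne_zero_of_mem_S3 hy.2)
  rw [← hc, real_inner_smul_left] at h2
  have hc0 : 0 < c := by by_contra hle; nlinarith
  have h3 := mem_S3.1 hy.2
  rw [← hc, norm_smul, mem_S3.1 hx.2, mul_one, Real.norm_of_nonneg hc0.le] at h3
  rw [← hc, h3, one_smul]

lemma DualPair.subsingleton_of_sdim (h : DualPair V W) {g : Set E4} (hgV : g ⊆ CH V)
    (hg : sdim g = 1) : g.Subsingleton := by
  intro x hx y hy
  have hx0 := ne_zero_of_mem_S3 (hgV hx).2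
  obtain ⟨c, hc⟩ := (finrank_eq_one_iff_of_nonzero'
    (⟨x, Submodule.subset_span hx⟩ : Submodule.span ℝ g)
    (fun h0 => hx0 (congrArg Subtype.val h0))).1 hg ⟨y, Submodule.subset_span hy⟩
  exact h.eq_of_smul (hgV hx) (hgV hy) (congrArg Subtype.val hc)

lemma DualPair.exists_vertex (h : DualPair V W) {g : Set E4} (hg : g ∈ cells (P V) 1) :
    ∃ v ∈ V, g = {v} := by
  have hk := h.sdim_cell hg
  have hsub := h.subsingleton_of_sdim (h.cell_subset hg) hk
  obtain ⟨ν, hν, rfl, -⟩ := h.mem_cells.1 hg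
  obtain ⟨v, hv⟩ := h.zeros_nonempty hν.1 (by rw [hk]; exact one_ne_zero)
  exact ⟨v, (mem_zeros.1 hv).1, hsub.eq_singleton_of_mem (h.zeros_subset_face hv)⟩

/-- The face of the polar cone orthogonal to `v` has full dimension 3 by `left_facet`, so its dual
is a one-dimensional cell, and it contains `v`. -/
lemma DualPair.singleton_mem_cells (h : DualPair V W) {v : E4} (hv : v ∈ V) :
    {v} ∈ cells (P V) 1 := by
  have hvC : v ∈ CH V := ⟨mem_cone_of_mem hv, h.left_sphere v hv⟩
  have h3 : face W v ∈ cells (P W) 3 := h.symm.mem_cells.2 ⟨v, hvC, rfl, by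
    rw [sdim, h.symm.span_face hvC.1]; exact h.left_facet v hv⟩
  have h1 := h.symm.dual_mem_cells (by norm_num) h3
  have hmem : v ∈ dual W (face W v) := by
    rw [h.symm.dual_cell (by norm_num) h3]
    exact ⟨hvC, fun y hy => hy.2⟩
  rwa [(h.subsingleton_of_sdim (h.cell_subset h1) (h.sdim_cell h1)).eq_singleton_of_mem hmem] at h1

lemma DualPair.singleton_mem_cells_iff (h : DualPair V W) {v : E4} :
    {v} ∈ cells (P V) 1 ↔ v ∈ V := by
  refine ⟨fun hv => ?_, h.singleton_mem_cells⟩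
  obtain ⟨w, hw, heq⟩ := h.exists_vertex hv
  rwa [Set.singleton_eq_singleton_iff.1 heq]

lemma DualPair.mem_polarFace_iff (h : DualPair V W) {g : Set E4} {k : ℕ} (hk : k ≠ 0)
    (hg : g ∈ cells (P V) k) {y : E4} : y ∈ dual V g ↔ y ∈ CH W ∧ ∀ x ∈ g, ⟪x, y⟫ = 0 := by
  rw [h.dual_cell hk hg]; rfl

lemma DualPair.finite_cells (h : DualPair V W) (k : ℕ) : (cells (P V) k).Finite := by
  classical
  refine Set.Finite.subset ((V.powerset.finite_toSet).image fun s => CH s) ?_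
  intro g hg
  obtain ⟨ν, hν, rfl, -⟩ := h.mem_cells.1 hg
  exact ⟨zeros V ν, Finset.mem_powerset.2 fun v hv => (mem_zeros.1 hv).1, (h.face_eq_CH hν.1).symm⟩

/-- A vertex of a face of a polyhedral sphere lies on an edge of that face. -/
lemma DualPair.exists_edge_between (h : DualPair V W) {f : Set E4} {v : E4}
    (hf : f ∈ cells (P V) 3) (hv : v ∈ V) (hvf : v ∈ f) : ∃ e ∈ cells (P V) 2, v ∈ e ∧ e ⊆ f := by
  have hfcell := hf
  obtain ⟨ν, hν, rfl, hf3⟩ := h.mem_cells.1 hf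
  obtain ⟨μ, hμ, hvμ, -⟩ := h.mem_cells.1 (h.singleton_mem_cells hv)
  -- The normal `μ`, which exposes `v`, will be rotated about `v` until it touches another vertex of
  -- the face. Orthogonality of `d` to `ν` keeps `d` in the span of the face, to `v` keeps `v`
  -- tight, and to `μ` makes the pairing of `d` with the rotated normal positive.
  obtain ⟨d, hd, hd0⟩ := exists_ne_zero_orthogonal (S := Submodule.span ℝ {ν, v, μ}) (by
    classical
    have h1 := finrank_span_le_card (R := ℝ) ({ν, v, μ} : Set E4)
    have h2 : ({ν, v, μ} : Set E4).toFinset.card ≤ 3 := by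
      simpa using Finset.card_le_three (a := ν) (b := v) (c := μ)
    omega)
  rw [mem_orthogonal_span] at hd
  have hdν : ⟪ν, d⟫ = 0 := hd ν (by simp)
  have hdv : ⟪v, d⟫ = 0 := hd v (by simp)
  have hdμ : ⟪μ, d⟫ = 0 := hd μ (by simp)
  have hspan : d ∈ Submodule.span ℝ (zeros V ν : Set E4) := by
    rw [← h.span_face hν.1, ← Submodule.orthogonal_orthogonal (Submodule.span ℝ (face V ν))]
    have h1 : (Submodule.span ℝ (face V ν))ᗮ = Submodule.span ℝ {ν} := by
      symm
      refine Submodule.eq_of_le_of_finrank_eq ?_ ?_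
      · rw [Submodule.span_singleton_le_iff_mem]
        exact mem_orthogonal_span.2 fun x hx => hx.2
      · rw [finrank_orthogonal, finrank_span_singleton (ne_zero_of_mem_S3 hν.2)]
        unfold sdim at hf3; omega
    rw [h1]
    exact mem_orthogonal_span.2 fun x hx => by rw [Set.mem_singleton_iff.1 hx, hdν]
  -- One of `d`, `-d` pairs positively with some vertex of the face; otherwise `d` would be
  -- orthogonal to the span that contains it.
  obtain ⟨d, hd0, hdv, hdμ, hspan, hpos⟩ : ∃ d : E4, d ≠ 0 ∧ ⟪v, d⟫ = 0 ∧ ⟪μ, d⟫ = 0 ∧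
      d ∈ Submodule.span ℝ (zeros V ν : Set E4) ∧ ∃ w ∈ zeros V ν, 0 < ⟪w, d⟫ := by
    by_cases hp : ∃ w ∈ zeros V ν, 0 < ⟪w, d⟫
    · exact ⟨d, hd0, hdv, hdμ, hspan, hp⟩
    · refine ⟨-d, neg_ne_zero.2 hd0, by simp [hdv], by simp [hdμ], Submodule.neg_mem _ hspan, ?_⟩
      push Not at hp
      by_contra! hcon
      have h1 : d ∈ (Submodule.span ℝ (zeros V ν : Set E4))ᗮ := mem_orthogonal_span.2 fun w hw => by
        have h2 := hcon w hw
        rw [inner_neg_right] at h2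
        linarith [hp w hw]
      exact hd0 (inner_self_eq_zero.1 (Submodule.inner_right_of_mem_orthogonal hspan h1))
  have hzV : ∀ w ∈ zeros V ν, w ∈ V := fun w hw => (mem_zeros.1 hw).1
  have hvz : v ∈ zeros (zeros V ν) μ := by
    have : v ∈ face V μ := hvμ ▸ rfl
    exact mem_zeros.2 ⟨mem_zeros.2 ⟨hv, hvf.2⟩, this.2⟩
  obtain ⟨t, ht, hle, hlt⟩ := exists_exit (V := zeros V ν) (y := μ) (d := d)
    (fun w hw => (h.mem_right μ).1 hμ.1 w (hzV w hw)) (fun w hw => by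
      obtain ⟨hw1, hw2⟩ := mem_zeros.1 hw
      have h1 : w ∈ face V μ :=
        ⟨⟨mem_cone_of_mem (hzV w hw1), h.left_sphere w (hzV w hw1)⟩, hw2⟩
      rw [← hvμ] at h1
      rw [Set.mem_singleton_iff.1 h1, hdv]) hpos
  have hdθ : ⟪d, μ + t • d⟫ ≠ 0 := by
    rw [inner_add_right, real_inner_comm, hdμ, zero_add, real_inner_smul_right]
    exact (mul_pos ht (real_inner_self_pos.2 hd0)).ne'
  set θ := μ + t • d with hθ
  have hθ0 : θ ≠ 0 := fun h0 => hdθ (by rw [h0, inner_zero_right])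
  set e := face V ν ∩ Pl (‖θ‖⁻¹ • θ) with he
  have hein : ∀ x, x ∈ e ↔ x ∈ face V ν ∧ ⟪x, θ⟫ = 0 := fun x => by
    refine ⟨fun hx => ⟨hx.1, ?_⟩, fun hx => ⟨hx.1, hx.1.1.2, ?_⟩⟩
    · have := hx.2.2
      rwa [real_inner_smul_right, inv_norm_mul_eq_zero hθ0] at this
    · rw [real_inner_smul_right, hx.2, mul_zero]
  have hcell : e ∈ cells (face V ν) (sdim e) := by
    refine ⟨_, normalize_mem_S3 hθ0, fun x hx => ⟨hx.1.2, ?_⟩, rfl, rfl⟩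
    rw [h.face_eq_CH hν.1] at hx
    rw [real_inner_smul_right]
    exact mul_nonpos_of_nonneg_of_nonpos (inv_nonneg.2 (norm_nonneg _))
      (inner_nonpos_of_mem_cone hle hx.1)
  obtain ⟨hcell', hsub⟩ := (h.mem_cells_cell hf).1 hcell
  have hsubz : (zeros (zeros V ν) θ : Set E4) ⊆ e := fun w hw => by
    obtain ⟨h1, h2⟩ := mem_zeros.1 hw
    exact (hein w).2 ⟨h.zeros_subset_face h1, h2⟩
  have hge : zdim (zeros V ν) θ ≤ sdim e := sdim_mono hsubz
  have hone : 1 ≤ zdim (zeros V ν) μ := sdim_pos ⟨v, hvz⟩ fun w hw =>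
    h.left_sphere w (hzV w (mem_zeros.1 hw).1)
  have hle3 := h.cell_le_three hcell'
  -- Dimension 3 would make `θ` orthogonal to the whole face, hence to `d`. Since dimension at least
  -- 2 is already known, `e` is an edge.
  have hne3 : sdim e ≠ 3 := fun h3 => by
    rw [h3] at hcell'
    have h4 := h.cell_eq_of_subset hcell' hfcell hsub
    have h5 : θ ∈ (Submodule.span ℝ (zeros V ν : Set E4))ᗮ := mem_orthogonal_span.2 fun w hw => by
      have h6 := h.zeros_subset_face hw
      rw [← h4] at h6
      exact ((hein w).1 h6).2
    exact hdθ (Submodule.inner_right_of_mem_orthogonal hspan h5)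
  have h2 : sdim e = 2 := by omega
  rw [h2] at hcell'
  have hvθ : ⟪v, θ⟫ = 0 := by
    rw [hθ, inner_add_right, real_inner_smul_right, hdv, (mem_zeros.1 hvz).2]; ring
  exact ⟨e, hcell', (hein v).2 ⟨hvf, hvθ⟩, hsub⟩

/-! ### Edges as arcs of great circles -/

/-- Orthonormal coordinates in a plane. -/
lemma exists_plane_basis {S : Submodule ℝ E4} (hS : finrank ℝ S = 2) {p : E4} (hp : p ∈ S)
    (hp1 : ‖p‖ = 1) : ∃ q ∈ S, ‖q‖ = 1 ∧ ⟪p, q⟫ = 0 ∧ ∀ x ∈ S, x = ⟪x, p⟫ • p + ⟪x, q⟫ • q := by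
  have hp0 : p ≠ 0 := by rintro rfl; simp at hp1
  obtain ⟨d, hd, hd0⟩ := exists_ne_zero_orthogonal (S := Sᗮ ⊔ Submodule.span ℝ {p}) (by
    have h1 := Submodule.finrank_add_le_finrank_add_finrank Sᗮ (Submodule.span ℝ {p})
    rw [finrank_orthogonal, finrank_span_singleton hp0] at h1
    omega)
  have hdS : d ∈ S := by
    rw [← Submodule.orthogonal_orthogonal S]
    exact (Submodule.orthogonal_le le_sup_left) hd
  have hpd : ⟪p, d⟫ = 0 := Submodule.inner_right_of_mem_orthogonal
    (Submodule.mem_sup_right (Submodule.mem_span_singleton_self p)) hd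
  have hq1 : ‖‖d‖⁻¹ • d‖ = 1 := mem_S3.1 (normalize_mem_S3 hd0)
  have hpq : ⟪p, ‖d‖⁻¹ • d⟫ = 0 := by rw [real_inner_smul_right, hpd, mul_zero]
  have hqS : ‖d‖⁻¹ • d ∈ S := S.smul_mem _ hdS
  set q := ‖d‖⁻¹ • d
  refine ⟨q, hqS, hq1, hpq, fun x hx => ?_⟩
  have hon : Orthonormal ℝ ![p, q] := by
    rw [orthonormal_iff_ite]
    intro i j
    fin_cases i <;> fin_cases j <;> simp [hp1, hq1, hpq, real_inner_comm p q]
  have hspan : Submodule.span ℝ (Set.range ![p, q]) = S := by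
    refine Submodule.eq_of_le_of_finrank_eq (Submodule.span_le.2 ?_) ?_
    · rintro _ ⟨i, rfl⟩
      fin_cases i
      · exact hp
      · exact hqS
    · rw [finrank_span_eq_card hon.linearIndependent, hS]; rfl
  rw [← hspan, Matrix.range_cons, Matrix.range_cons, Matrix.range_empty, Set.union_empty,
    Set.singleton_union, Submodule.mem_span_pair] at hx
  obtain ⟨a, b, rfl⟩ := hx
  simp [inner_add_left, real_inner_smul_left, hpq, real_inner_comm p q, hp1, hq1]

/-- The point at distance `s` on the great circle through `p` with unit tangent vector `q`. -/
noncomputable def circ (p q : E4) (s : ℝ) : E4 := Real.cos s • p + Real.sin s • q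

lemma inner_circ {p q : E4} (hp : ‖p‖ = 1) (hq : ‖q‖ = 1) (hpq : ⟪p, q⟫ = 0) (s t : ℝ) :
    ⟪circ p q s, circ p q t⟫ = Real.cos (s - t) := by
  simp only [circ, inner_add_left, inner_add_right, real_inner_smul_left, real_inner_smul_right,
    hpq, real_inner_comm p q, real_inner_self_eq_norm_sq, hp, hq, Real.cos_sub]
  ring

lemma norm_circ {p q : E4} (hp : ‖p‖ = 1) (hq : ‖q‖ = 1) (hpq : ⟪p, q⟫ = 0) (s : ℝ) :
    ‖circ p q s‖ = 1 := by
  have h1 := inner_circ hp hq hpq s s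
  rw [sub_self, Real.cos_zero, real_inner_self_eq_norm_sq] at h1
  nlinarith [norm_nonneg (circ p q s)]

/-- An edge of a polyhedral sphere is an arc of a great circle, shorter than a half circle. -/
lemma DualPair.exists_arc (h : DualPair V W) {e : Set E4} (he : e ∈ cells (P V) 2) :
    ∃ (p q : E4) (a : ℝ), p ∈ Submodule.span ℝ e ∧ q ∈ Submodule.span ℝ e ∧ ‖p‖ = 1 ∧ ‖q‖ = 1 ∧
      ⟪p, q⟫ = 0 ∧ 0 < a ∧ a < Real.pi ∧ e = circ p q '' Set.Icc 0 a := by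
  obtain ⟨ν, hν, rfl, he2⟩ := h.mem_cells.1 he
  obtain ⟨u, hu, -⟩ := h.pos_of_mem_cone
  have hu' : ∀ x ∈ face V ν, 0 < ⟪x, u⟫ := fun x hx => hu x hx.1.1 (ne_zero_of_mem_S3 hx.1.2)
  set S := Submodule.span ℝ (face V ν) with hSdef
  have hS2 : finrank ℝ S = 2 := he2
  have hZ := h.zeros_nonempty hν.1 (by rw [he2]; exact two_ne_zero)
  have hZf : ∀ v ∈ zeros V ν, v ∈ face V ν := fun v hv => h.zeros_subset_face hv
  have hfS : ∀ x ∈ face V ν, x ∈ S := fun x hx => Submodule.subset_span hx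
  have hcone : ∀ x ∈ face V ν, x ∈ cone (zeros V ν) := fun x hx =>
    mem_cone_zeros ((h.mem_right ν).1 hν.1) hx.1.1 hx.2
  have hf1 : ∀ x ∈ face V ν, ‖x‖ = 1 := fun x hx => mem_S3.1 hx.1.2
  -- With `r` in the plane of the edge and orthogonal to `u`, the quotient ⟪v, r⟫ / ⟪v, u⟫ is an
  -- affine coordinate along the edge; its minimiser `p` is an endpoint.
  obtain ⟨r, hr, hr0⟩ := exists_ne_zero_orthogonal (S := Sᗮ ⊔ Submodule.span ℝ {u}) (by
    have h1 := Submodule.finrank_add_le_finrank_add_finrank Sᗮ (Submodule.span ℝ {u})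
    have h2 := finrank_span_le_card (R := ℝ) ({u} : Set E4)
    simp only [Set.toFinset_card, Fintype.card_unique] at h2
    rw [finrank_orthogonal] at h1
    omega)
  have hrS : r ∈ S := by
    rw [← Submodule.orthogonal_orthogonal S]
    exact (Submodule.orthogonal_le le_sup_left) hr
  have hur : ⟪u, r⟫ = 0 := Submodule.inner_right_of_mem_orthogonal
    (Submodule.mem_sup_right (Submodule.mem_span_singleton_self u)) hr
  obtain ⟨p, hpZ, hpmin⟩ := (zeros V ν).exists_min_image (fun v => ⟪v, r⟫ / ⟪v, u⟫) hZ
  have hpf := hZf p hpZ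
  have hp1 := hf1 p hpf
  -- `T` vanishes at `p` and is nonnegative on the edge, so it determines on which side of `p` the
  -- edge lies and hence the sign of `q`.
  set T : E4 := ⟪p, u⟫ • r - ⟪p, r⟫ • u with hT
  have hTZ : ∀ v ∈ zeros V ν, 0 ≤ ⟪v, T⟫ := fun v hv => by
    have h1 := hpmin v hv
    rw [div_le_div_iff₀ (hu' p hpf) (hu' v (hZf v hv))] at h1
    rw [hT, inner_sub_right, real_inner_smul_right, real_inner_smul_right]
    linarith
  have hpT : ⟪p, T⟫ = 0 := by
    rw [hT, inner_sub_right, real_inner_smul_right, real_inner_smul_right]; ring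
  have hrT : 0 < ⟪r, T⟫ := by
    rw [hT, inner_sub_right, real_inner_smul_right, real_inner_smul_right, real_inner_comm u r, hur,
      mul_zero, sub_zero]
    exact mul_pos (hu' p hpf) (real_inner_self_pos.2 hr0)
  obtain ⟨q, hqS, hq1, hpq, hcoord, hqT⟩ : ∃ q ∈ S, ‖q‖ = 1 ∧ ⟪p, q⟫ = 0 ∧
      (∀ x ∈ S, x = ⟪x, p⟫ • p + ⟪x, q⟫ • q) ∧ 0 ≤ ⟪q, T⟫ := by
    obtain ⟨q, h1, h2, h3, h4⟩ := exists_plane_basis hS2 (hfS p hpf) hp1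
    rcases le_total 0 ⟪q, T⟫ with h5 | h5
    · exact ⟨q, h1, h2, h3, h4, h5⟩
    · refine ⟨-q, S.neg_mem h1, by rwa [norm_neg], by rw [inner_neg_right, h3, neg_zero],
        fun x hx => ?_, by rw [inner_neg_left]; linarith⟩
      rw [inner_neg_right, smul_neg, neg_smul, neg_neg]
      exact h4 x hx
  have hcT : ∀ x ∈ S, ⟪x, T⟫ = ⟪x, q⟫ * ⟪q, T⟫ := fun x hx => by
    nth_rewrite 1 [hcoord x hx]
    rw [inner_add_left, real_inner_smul_left, real_inner_smul_left, hpT]; ring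
  have hqT' : 0 < ⟪q, T⟫ := lt_of_le_of_ne hqT fun h0 => by
    rw [hcT r hrS, ← h0, mul_zero] at hrT
    exact lt_irrefl _ hrT
  have hpos : ∀ x ∈ face V ν, 0 ≤ ⟪x, q⟫ := fun x hx => by
    have h1 := inner_nonneg_of_mem_cone hTZ (hcone x hx)
    rw [hcT x (hfS x hx)] at h1
    exact nonneg_of_mul_nonneg_left h1 hqT'
  have hang : ∀ x ∈ face V ν, x = circ p q (Real.arccos ⟪x, p⟫) := fun x hx => by
    have hx1 := hf1 x hx
    have h1 : ⟪x, p⟫ ^ 2 + ⟪x, q⟫ ^ 2 = 1 := by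
      have h2 : ⟪x, x⟫ = 1 := by rw [real_inner_self_eq_norm_sq, hx1]; norm_num
      nth_rewrite 2 [hcoord x (hfS x hx)] at h2
      rw [inner_add_right, real_inner_smul_right, real_inner_smul_right] at h2
      linarith
    have h3 : -1 ≤ ⟪x, p⟫ ∧ ⟪x, p⟫ ≤ 1 :=
      abs_le.1 ((sq_le_one_iff_abs_le_one _).1 (by linarith [sq_nonneg ⟪x, q⟫]))
    rw [circ, Real.cos_arccos h3.1 h3.2, Real.sin_arccos,
      show 1 - ⟪x, p⟫ ^ 2 = ⟪x, q⟫ ^ 2 by linarith, Real.sqrt_sq (hpos x hx)]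
    exact hcoord x (hfS x hx)
  -- The other endpoint is the generator at the largest angle `a` from `p`.
  obtain ⟨p', hp'Z, hp'min⟩ := (zeros V ν).exists_min_image (fun v => ⟪v, p⟫) hZ
  set a := Real.arccos ⟪p', p⟫ with ha
  have hp' : p' = circ p q a := hang p' (hZf p' hp'Z)
  have hle : ∀ v ∈ zeros V ν, Real.arccos ⟪v, p⟫ ≤ a := fun v hv =>
    Real.arccos_le_arccos (hp'min v hv)
  have ha0 : 0 < a := by
    by_contra hcon
    have h1 : ∀ v ∈ zeros V ν, ⟪v, q⟫ = 0 := fun v hv => by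
      have h2 : Real.arccos ⟪v, p⟫ = 0 :=
        le_antisymm ((hle v hv).trans (not_lt.1 hcon)) (Real.arccos_nonneg _)
      rw [hang v (hZf v hv), h2]
      simp [circ, hpq]
    have h3 : q ∈ Submodule.span ℝ (zeros V ν : Set E4) := by rwa [← h.span_face hν.1]
    have h4 := Submodule.inner_right_of_mem_orthogonal h3 (mem_orthogonal_span.2 h1)
    rw [real_inner_self_eq_norm_sq, hq1] at h4
    norm_num at h4
  have haπ : a < Real.pi := by
    refine lt_of_le_of_ne (Real.arccos_le_pi _) fun h0 => ?_
    have h1 := hu' p' (hZf p' hp'Z)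
    rw [hp', h0] at h1
    simp only [circ, Real.cos_pi, Real.sin_pi, zero_smul, add_zero, neg_smul, one_smul,
      inner_neg_left] at h1
    linarith [hu' p hpf]
  have hsin : 0 < Real.sin a := Real.sin_pos_of_pos_of_lt_pi ha0 haπ
  -- This functional is nonnegative on the generators, so on the edge; that bounds the angle of each
  -- of its points by `a`.
  have hN : ∀ s, ⟪circ p q s, Real.sin a • p - Real.cos a • q⟫ = Real.sin (a - s) := fun s => by
    simp only [circ, inner_add_left, inner_sub_right, real_inner_smul_left, real_inner_smul_right,
      hpq, real_inner_comm p q, real_inner_self_eq_norm_sq, hp1, hq1, Real.sin_sub]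
    ring
  refine ⟨p, q, a, hfS p hpf, hqS, hp1, hq1, hpq, ha0, haπ, Set.Subset.antisymm ?_ ?_⟩
  · intro x hx
    refine ⟨Real.arccos ⟪x, p⟫, ⟨Real.arccos_nonneg _, ?_⟩, (hang x hx).symm⟩
    have h1 : 0 ≤ ⟪x, Real.sin a • p - Real.cos a • q⟫ :=
      inner_nonneg_of_mem_cone (fun v hv => by
        rw [hang v (hZf v hv), hN]
        refine Real.sin_nonneg_of_nonneg_of_le_pi (by linarith [hle v hv]) ?_
        linarith [Real.arccos_nonneg ⟪v, p⟫]) (hcone x hx)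
    rw [hang x hx, hN] at h1
    by_contra! hcon
    have h2 := Real.sin_neg_of_neg_of_neg_pi_lt (x := a - Real.arccos ⟪x, p⟫) (by linarith)
      (by linarith [Real.arccos_le_pi ⟪x, p⟫])
    linarith
  · rintro _ ⟨s, ⟨hs0, hsa⟩, rfl⟩
    -- Spherical linear interpolation between the endpoints `p` and `p'`, with nonnegative weights.
    have h1 : circ p q s = (Real.sin (a - s) / Real.sin a) • p + (Real.sin s / Real.sin a) • p' := by
      rw [hp', circ, circ, Real.sin_sub]
      match_scalars
      · field_simp; ring
      · field_simp
    have h2 : 0 ≤ Real.sin (a - s) := Real.sin_nonneg_of_nonneg_of_le_pi (by linarith) (by linarith)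
    have h3 : 0 ≤ Real.sin s := Real.sin_nonneg_of_nonneg_of_le_pi hs0 (by linarith)
    rw [h.face_eq_CH hν.1]
    refine ⟨?_, mem_S3.2 (norm_circ hp1 hq1 hpq s)⟩
    rw [h1]
    exact add_mem_cone (smul_mem_cone (by positivity) (mem_cone_of_mem hpZ))
      (smul_mem_cone (by positivity) (mem_cone_of_mem hp'Z))

/-! ### The combinatorics of the tiling -/

lemma DualPair.bijOn_dual (h : DualPair V W) {k : ℕ} (hk : k ≠ 0) (hk3 : k ≤ 3) :
    Set.BijOn (dual V) (cells (P V) k) (cells (P W) (4 - k)) := by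
  refine ⟨fun g hg => h.dual_mem_cells hk hg, fun g hg g' hg' heq => ?_, fun b hb => ?_⟩
  · rw [← h.dual_dual hk hg, heq, h.dual_dual hk hg']
  · refine ⟨dual W b, ?_, h.symm.dual_dual (by omega) hb⟩
    have := h.symm.dual_mem_cells (by omega) hb
    rwa [show 4 - (4 - k) = k by omega] at this

lemma DualPair.bijOn_singleton (h : DualPair V W) :
    Set.BijOn (fun v : E4 => ({v} : Set E4)) (V : Set E4) (cells (P V) 1) :=
  ⟨fun _ hv => h.singleton_mem_cells hv, fun _ _ _ _ heq => Set.singleton_eq_singleton_iff.1 heq,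
    fun _ hg => by
      obtain ⟨v, hv, rfl⟩ := h.exists_vertex hg
      exact ⟨v, hv, rfl⟩⟩

/-- `T` is the piece of the tiling whose first factor is `g`. -/
def IsPiece (V : Finset E4) (g : Set E4) (T : Tile) : Prop :=
  (g ∈ cells (P V) 3 ∧ T = faceTile V g) ∨ (g ∈ cells (P V) 2 ∧ T = edgeTile V g) ∨
    ∃ v, g = {v} ∧ {v} ∈ cells (P V) 1 ∧ T = vertexTile V v

lemma DualPair.mem_tiles_iff (h : DualPair V W) {T : Tile} :
    T ∈ tiles V ↔ ∃ g, IsPiece V g T := by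
  constructor
  · rintro ((⟨g, hg, rfl⟩ | ⟨g, hg, rfl⟩) | ⟨v, hv, rfl⟩)
    · exact ⟨g, Or.inl ⟨hg, rfl⟩⟩
    · exact ⟨g, Or.inr (Or.inl ⟨hg, rfl⟩)⟩
    · exact ⟨{v}, Or.inr (Or.inr ⟨v, rfl, h.singleton_mem_cells hv, rfl⟩)⟩
  · rintro ⟨g, ⟨hg, rfl⟩ | ⟨hg, rfl⟩ | ⟨v, rfl, hv, rfl⟩⟩
    · exact Or.inl (Or.inl ⟨g, hg, rfl⟩)
    · exact Or.inl (Or.inr ⟨g, hg, rfl⟩)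
    · exact Or.inr ⟨v, h.singleton_mem_cells_iff.1 hv, rfl⟩

lemma IsPiece.exists_cell {g : Set E4} {T : Tile} (hT : IsPiece V g T) :
    ∃ k, k ≠ 0 ∧ g ∈ cells (P V) k := by
  obtain ⟨hg, -⟩ | ⟨hg, -⟩ | ⟨v, rfl, hv, -⟩ := hT
  exacts [⟨3, by norm_num, hg⟩, ⟨2, by norm_num, hg⟩, ⟨1, by norm_num, hv⟩]

lemma DualPair.piece_unique (h : DualPair V W) {g : Set E4} {T T' : Tile} (hT : IsPiece V g T)
    (hT' : IsPiece V g T') : T = T' := by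
  have key : ∀ {i j : ℕ}, g ∈ cells (P V) i → g ∈ cells (P V) j → i = j := fun hi hj =>
    (h.sdim_cell hi).symm.trans (h.sdim_cell hj)
  obtain ⟨hg, rfl⟩ | ⟨hg, rfl⟩ | ⟨v, hgv, hg, rfl⟩ := hT <;>
  obtain ⟨hg', rfl⟩ | ⟨hg', rfl⟩ | ⟨v', hgv', hg', rfl⟩ := hT'
  · rfl
  · exact absurd (key hg hg') (by norm_num)
  · rw [← hgv'] at hg'; exact absurd (key hg hg') (by norm_num)
  · exact absurd (key hg hg') (by norm_num)
  · rfl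
  · rw [← hgv'] at hg'; exact absurd (key hg hg') (by norm_num)
  · rw [← hgv] at hg; exact absurd (key hg hg') (by norm_num)
  · rw [← hgv] at hg; exact absurd (key hg hg') (by norm_num)
  · rw [hgv, Set.singleton_eq_singleton_iff] at hgv'
    rw [hgv']

lemma DualPair.exists_piece (h : DualPair V W) {g : Set E4} {k : ℕ} (hk : k ≠ 0)
    (hg : g ∈ cells (P V) k) : ∃ T, IsPiece V g T := by
  have h3 := h.cell_le_three hg
  interval_cases k
  · exact absurd rfl hk
  · obtain ⟨v, hv, rfl⟩ := h.exists_vertex hg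
    exact ⟨_, Or.inr (Or.inr ⟨v, rfl, hg, rfl⟩)⟩
  · exact ⟨_, Or.inr (Or.inl ⟨hg, rfl⟩)⟩
  · exact ⟨_, Or.inl ⟨hg, rfl⟩⟩

lemma IsPiece.carrier_eq {g : Set E4} {T : Tile} (hT : IsPiece V g T) :
    T.carrier = g ×ˢ dual V g := by
  obtain ⟨-, rfl⟩ | ⟨-, rfl⟩ | ⟨v, rfl, -, rfl⟩ := hT <;> rfl

lemma DualPair.cell_le_of_subset (h : DualPair V W) {g g' : Set E4} {i j : ℕ}
    (hg : g ∈ cells (P V) i) (hg' : g' ∈ cells (P V) j) (hsub : g ⊆ g') : i ≤ j := by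
  rw [← h.sdim_cell hg, ← h.sdim_cell hg']
  exact sdim_mono hsub

/-- `a` and `b` are cells of `P` and `P*` of positive dimensions with sum `m`. -/
def CellPair (V W : Finset E4) (m : ℕ) (a b : Set E4) : Prop :=
  ∃ i j, i ≠ 0 ∧ j ≠ 0 ∧ i + j = m ∧ a ∈ cells (P V) i ∧ b ∈ cells (P W) j

/-- A uniform description of the edges of the three kinds of pieces. Containment bounds the
dimensions of the factors, and a factor of the same dimension as the cell that contains it equals
that cell. -/
lemma DualPair.mem_edges_iff (h : DualPair V W) {g : Set E4} {T : Tile} (hT : IsPiece V g T)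
    {ε : Set (E4 × E4)} :
    ε ∈ T.edges ↔ ∃ a b, CellPair V W 3 a b ∧ a ⊆ g ∧ b ⊆ dual V g ∧ ε = a ×ˢ b := by
  obtain ⟨hg, rfl⟩ | ⟨hg, rfl⟩ | ⟨v, rfl, hg, rfl⟩ := hT
  · have hd := h.dual_mem_cells (by norm_num) hg
    constructor
    · rintro ⟨a, ha, rfl⟩
      obtain ⟨ha, hag⟩ := (h.mem_cells_cell hg).1 ha
      exact ⟨a, _, ⟨2, 1, by norm_num, by norm_num, by norm_num, ha, hd⟩, hag, subset_rfl, rfl⟩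
    · rintro ⟨a, b, ⟨i, j, hi, hj, hij, ha, hb⟩, hag, hbg, rfl⟩
      have hj1 := h.symm.cell_le_of_subset hb hd hbg
      obtain rfl : j = 1 := by omega
      obtain rfl : i = 2 := by omega
      rw [h.symm.cell_eq_of_subset hb hd hbg]
      exact ⟨a, (h.mem_cells_cell hg).2 ⟨ha, hag⟩, rfl⟩
  · have hd := h.dual_mem_cells (by norm_num) hg
    constructor
    · rintro (⟨ν, hν, rfl⟩ | ⟨v, hv, rfl⟩)
      · obtain ⟨hb, hbg⟩ := (h.symm.mem_cells_cell hd).1 hν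
        exact ⟨g, {ν}, ⟨2, 1, by norm_num, by norm_num, by norm_num, hg, hb⟩, subset_rfl, hbg, rfl⟩
      · obtain ⟨ha, hag⟩ := (h.mem_cells_cell hg).1 hv
        exact ⟨{v}, _, ⟨1, 2, by norm_num, by norm_num, by norm_num, ha, hd⟩, hag, subset_rfl, rfl⟩
    · rintro ⟨a, b, ⟨i, j, hi, hj, hij, ha, hb⟩, hag, hbg, rfl⟩
      have hi2 := h.cell_le_of_subset ha hg hag
      have hj2 := h.symm.cell_le_of_subset hb hd hbg
      obtain ⟨rfl, rfl⟩ | ⟨rfl, rfl⟩ : (i = 2 ∧ j = 1) ∨ (i = 1 ∧ j = 2) := by omega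
      · obtain ⟨ν, hν, rfl⟩ := h.symm.exists_vertex hb
        rw [h.cell_eq_of_subset ha hg hag]
        exact Or.inl ⟨ν, (h.symm.mem_cells_cell hd).2 ⟨hb, hbg⟩, rfl⟩
      · obtain ⟨v, hv, rfl⟩ := h.exists_vertex ha
        rw [h.symm.cell_eq_of_subset hb hd hbg]
        exact Or.inr ⟨v, (h.mem_cells_cell hg).2 ⟨ha, hag⟩, rfl⟩
  · have hd := h.dual_mem_cells (by norm_num) hg
    constructor
    · rintro ⟨b, hb, rfl⟩
      obtain ⟨hb, hbg⟩ := (h.symm.mem_cells_cell hd).1 hb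
      exact ⟨_, b, ⟨1, 2, by norm_num, by norm_num, by norm_num, hg, hb⟩, subset_rfl, hbg, rfl⟩
    · rintro ⟨a, b, ⟨i, j, hi, hj, hij, ha, hb⟩, hag, hbg, rfl⟩
      have hi1 := h.cell_le_of_subset ha hg hag
      obtain rfl : i = 1 := by omega
      obtain rfl : j = 2 := by omega
      rw [h.cell_eq_of_subset ha hg hag]
      exact ⟨b, (h.symm.mem_cells_cell hd).2 ⟨hb, hbg⟩, rfl⟩

lemma DualPair.mem_vertices_iff (h : DualPair V W) {g : Set E4} {T : Tile} (hT : IsPiece V g T)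
    {x ν : E4} :
    (x, ν) ∈ T.vertices ↔ (x ∈ V ∧ x ∈ g) ∧ ν ∈ W ∧ ν ∈ dual V g := by
  have key : ∀ {V W : Finset E4}, DualPair V W → ∀ {g : Set E4} {k : ℕ}, g ∈ cells (P V) k →
      ∀ x, x ∈ vertices g ↔ x ∈ V ∧ x ∈ g := fun h g k hg x => by
    rw [← h.singleton_mem_cells_iff, ← Set.singleton_subset_iff (s := g)]
    exact h.mem_cells_cell hg
  obtain ⟨hg, rfl⟩ | ⟨hg, rfl⟩ | ⟨v, rfl, hg, rfl⟩ := hT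
  · have hd := h.dual_mem_cells (by norm_num) hg
    obtain ⟨w, hw, heq⟩ := h.symm.exists_vertex hd
    have h1 : ν ∈ dual V g ↔ ν ∈ W ∧ ν ∈ dual V g := by
      rw [heq]
      exact ⟨fun h1 => ⟨by rw [Set.mem_singleton_iff.1 h1]; exact hw, h1⟩, fun h1 => h1.2⟩
    exact and_congr (key h hg x) h1
  · exact and_congr (key h hg x) (key h.symm (h.dual_mem_cells (by norm_num) hg) ν)
  · refine and_congr ?_ (key h.symm (h.dual_mem_cells (by norm_num) hg) ν)
    have hv := h.singleton_mem_cells_iff.1 hg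
    exact ⟨fun h1 => ⟨(Set.mem_singleton_iff.1 h1 : x = v) ▸ hv, h1⟩, fun h1 => h1.2⟩

lemma DualPair.finite_tiles (h : DualPair V W) : (tiles V).Finite :=
  (((h.finite_cells 3).image _).union ((h.finite_cells 2).image _)).union
    (V.finite_toSet.image _)

lemma DualPair.isPiece_subset (h : DualPair V W) {g : Set E4} {T : Tile} (hT : IsPiece V g T)
    {x ν : E4} (hp : (x, ν) ∈ T.carrier) : x ∈ CH V ∧ ν ∈ CH W ∧ ⟪x, ν⟫ = 0 := by
  obtain ⟨k, hk, hg⟩ := hT.exists_cell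
  rw [hT.carrier_eq] at hp
  have h2 := (h.mem_polarFace_iff hk hg).1 hp.2
  exact ⟨h.cell_subset hg hp.1, h2.1, h2.2 x hp.1⟩

lemma DualPair.mem_Ptilde_iff (h : DualPair V W) {x ν : E4} :
    (x, ν) ∈ Ptilde V ↔ x ∈ CH V ∧ ν ∈ CH W ∧ ⟪x, ν⟫ = 0 := by
  constructor
  · rintro ⟨-, hx, hν, hP, h0, -⟩
    exact ⟨h.P_subset hx, ⟨h.P_subset_halfSphere_iff.1 hP, hν⟩, h0.2⟩
  · rintro ⟨hx, hν, h0⟩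
    have hxP := h.mem_P_of_inner_eq_zero hx hν.1 (ne_zero_of_mem_S3 hν.2) h0
    refine ⟨⟨?_, ?_, h0⟩, hxP, hν.2, h.P_subset_halfSphere_iff.2 hν.1, ⟨hx.2, h0⟩, hxP⟩
    · rw [real_inner_self_eq_norm_sq, mem_S3.1 hx.2]; norm_num
    · rw [real_inner_self_eq_norm_sq, mem_S3.1 hν.2]; norm_num

/-- A normal vector (x, ν) lies in the piece whose first factor is the cell exposed by `ν`. -/
lemma DualPair.Ptilde_eq (h : DualPair V W) : Ptilde V = ⋃ T ∈ tiles V, T.carrier := by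
  ext ⟨x, ν⟩
  rw [h.mem_Ptilde_iff, Set.mem_iUnion₂]
  constructor
  · rintro ⟨hx, hν, h0⟩
    have hxf : x ∈ face V ν := ⟨hx, h0⟩
    have hpos := sdim_pos ⟨x, hxf⟩ (face_subset_CH.trans (CH_subset_S3 V))
    have hg : face V ν ∈ cells (P V) (sdim (face V ν)) := h.mem_cells.2 ⟨ν, hν, rfl, rfl⟩
    obtain ⟨T, hT⟩ := h.exists_piece (by omega) hg
    refine ⟨T, h.mem_tiles_iff.2 ⟨_, hT⟩, ?_⟩
    rw [hT.carrier_eq]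
    exact ⟨hxf, (h.mem_polarFace_iff (by omega) hg).2 ⟨hν, fun y hy => hy.2⟩⟩
  · rintro ⟨T, hT, hp⟩
    obtain ⟨g, hT⟩ := h.mem_tiles_iff.1 hT
    exact h.isPiece_subset hT hp

/-- The intersection is a × b with a = g ∩ g' and b = g* ∩ g'* ⊆ a*, so the dimensions add up to at
most 4 if both factors are non-empty. Sum 3 is a common edge, and sum 2 is a common vertex. -/
lemma DualPair.edge_to_edge (h : DualPair V W) {g g' : Set E4} {T T' : Tile} (hT : IsPiece V g T)
    (hT' : IsPiece V g' T') (hne : T ≠ T') :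
    T.carrier ∩ T'.carrier = ∅ ∨
      (∃ p ∈ T.vertices ∩ T'.vertices, T.carrier ∩ T'.carrier = {p}) ∨
      T.carrier ∩ T'.carrier ∈ T.edges ∩ T'.edges := by
  obtain ⟨k, hk, hg⟩ := hT.exists_cell
  obtain ⟨k', hk', hg'⟩ := hT'.exists_cell
  rw [hT.carrier_eq, hT'.carrier_eq, Set.prod_inter_prod]
  rcases (g ∩ g').eq_empty_or_nonempty with h0 | hane
  · left; rw [h0, Set.empty_prod]
  rcases (dual V g ∩ dual V g').eq_empty_or_nonempty with h0 | hbne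
  · left; rw [h0, Set.prod_empty]
  right
  have hd := h.dual_mem_cells hk hg
  have hd' := h.dual_mem_cells hk' hg'
  have ha := h.inter_mem_cells hg hg'
  have hb := h.symm.inter_mem_cells hd hd'
  have hi := sdim_pos hane ((h.cell_subset ha).trans (CH_subset_S3 V))
  have hj := sdim_pos hbne ((h.symm.cell_subset hb).trans (CH_subset_S3 W))
  set a := g ∩ g' with hadef
  set b := dual V g ∩ dual V g' with hbdef
  have hba : b ⊆ dual V a := Set.inter_subset_left.trans (dual_anti Set.inter_subset_left)
  have hda := h.dual_mem_cells (by omega) ha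
  have hij := h.symm.cell_le_of_subset hb hda hba
  have hi3 := h.cell_le_three ha
  obtain h4 | h3 | h2 : sdim a + sdim b = 4 ∨ sdim a + sdim b = 3 ∨
    (sdim a = 1 ∧ sdim b = 1) := by omega
  -- Sum 4 gives b = a*. Then g* and g'* lie between `b` and a*, so they are equal, and g = g' by
  -- biduality.
  · exfalso
    rw [show sdim b = 4 - sdim a by omega] at hb
    have heq := h.symm.cell_eq_of_subset hb hda hba
    have hag : dual V g ⊆ dual V a := dual_anti Set.inter_subset_left
    have hag' : dual V g' ⊆ dual V a := dual_anti Set.inter_subset_right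
    rw [← heq] at hag hag'
    have h5 : dual V g = b := hag.antisymm Set.inter_subset_left
    have h6 : dual V g' = b := hag'.antisymm Set.inter_subset_right
    have h7 : g = g' := by rw [← h.dual_dual hk hg, h5, ← h6, h.dual_dual hk' hg']
    rw [← h7] at hT'
    exact hne (h.piece_unique hT hT')
  · right
    have hp : CellPair V W 3 a b := ⟨_, _, by omega, by omega, h3, ha, hb⟩
    exact ⟨(h.mem_edges_iff hT).2 ⟨a, b, hp, Set.inter_subset_left, Set.inter_subset_left, rfl⟩,
      (h.mem_edges_iff hT').2 ⟨a, b, hp, Set.inter_subset_right, Set.inter_subset_right, rfl⟩⟩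
  · left
    rw [h2.1] at ha
    rw [h2.2] at hb
    obtain ⟨v, hv, hav⟩ := h.exists_vertex ha
    obtain ⟨ν, hν, hbν⟩ := h.symm.exists_vertex hb
    have hva : v ∈ g ∩ g' := by rw [← hadef, hav]; rfl
    have hνb : ν ∈ dual V g ∩ dual V g' := by rw [← hbdef, hbν]; rfl
    refine ⟨(v, ν), ⟨(h.mem_vertices_iff hT).2 ⟨⟨hv, hva.1⟩, hν, hνb.1⟩,
      (h.mem_vertices_iff hT').2 ⟨⟨hv, hva.2⟩, hν, hνb.2⟩⟩, ?_⟩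
    rw [hav, hbν, Set.singleton_prod_singleton]

/-- Used to see that a point common to two pieces only as a vertex is not interior to either. -/
lemma DualPair.vertices_subset (h : DualPair V W) {g : Set E4} {T : Tile} (hT : IsPiece V g T) :
    T.vertices ⊆ ⋃₀ T.edges := by
  rintro ⟨v, ν⟩ hp
  obtain ⟨⟨hv, hvg⟩, hν, hνg⟩ := (h.mem_vertices_iff hT).1 hp
  obtain ⟨k, hk, hg⟩ := hT.exists_cell
  have hd := h.dual_mem_cells hk hg
  have h3 := h.cell_le_three hg
  interval_cases k
  · exact absurd rfl hk
  · obtain ⟨e, he, hνe, heg⟩ := h.symm.exists_edge_between hd hν hνg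
    exact ⟨g ×ˢ e, (h.mem_edges_iff hT).2 ⟨g, e, ⟨1, 2, by norm_num, by norm_num, by norm_num,
      hg, he⟩, subset_rfl, heg, rfl⟩, hvg, hνe⟩
  · exact ⟨g ×ˢ {ν}, (h.mem_edges_iff hT).2 ⟨g, {ν}, ⟨2, 1, by norm_num, by norm_num, by norm_num,
      hg, h.symm.singleton_mem_cells hν⟩, subset_rfl, Set.singleton_subset_iff.2 hνg, rfl⟩, hvg, rfl⟩
  · obtain ⟨e, he, hve, heg⟩ := h.exists_edge_between hg hv hvg
    exact ⟨e ×ˢ dual V g, (h.mem_edges_iff hT).2 ⟨e, _, ⟨2, 1, by norm_num, by norm_num,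
      by norm_num, he, hd⟩, heg, subset_rfl, rfl⟩, hve, hνg⟩

lemma DualPair.disjoint_inner (h : DualPair V W) {g g' : Set E4} {T T' : Tile}
    (hT : IsPiece V g T) (hT' : IsPiece V g' T') (hne : T ≠ T') :
    Disjoint T.inner T'.inner := by
  rw [Set.disjoint_left]
  rintro p ⟨hp, hpe⟩ ⟨hp', -⟩
  have hmem : p ∈ T.carrier ∩ T'.carrier := ⟨hp, hp'⟩
  obtain h0 | ⟨q, hq, heq⟩ | he := h.edge_to_edge hT hT' hne
  · rw [h0] at hmem; exact hmem
  · rw [heq] at hmem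
    rw [Set.mem_singleton_iff.1 hmem] at hpe
    exact hpe (h.vertices_subset hT hq.1)
  · exact hpe ⟨_, he.1, hmem⟩

lemma CellPair.nonempty {m : ℕ} {a b : Set E4} (hab : CellPair V W m a b) (h : DualPair V W) :
    (a ×ˢ b).Nonempty := by
  obtain ⟨i, j, hi, hj, -, ha, hb⟩ := hab
  exact (h.cell_nonempty hi ha).prod (h.symm.cell_nonempty hj hb)

/-- The edge `a × b` belongs exactly to the pieces with first factor `a` or `b*`. -/
lemma DualPair.eq_or_eq_of_edge (h : DualPair V W) {g a b : Set E4} {k : ℕ} (hk : k ≠ 0)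
    (hg : g ∈ cells (P V) k) (hab : CellPair V W 3 a b) (hag : a ⊆ g) (hbg : b ⊆ dual V g) :
    g = a ∨ g = dual W b := by
  obtain ⟨i, j, hi, hj, hij, ha, hb⟩ := hab
  have hgb : g ⊆ dual W b := by
    rw [← h.dual_dual hk hg]; exact dual_anti hbg
  have hdb := h.symm.dual_mem_cells hj hb
  have h1 := h.cell_le_of_subset ha hg hag
  have h2 := h.cell_le_of_subset hg hdb hgb
  obtain rfl | rfl : k = i ∨ k = 4 - j := by omega
  · exact Or.inl (h.cell_eq_of_subset ha hg hag).symm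
  · exact Or.inr (h.cell_eq_of_subset hg hdb hgb)

/-- The only pieces with the edge a × b are a × a* and b* × b. Their first factors differ since
their dimensions are i and 4 - j = i + 1; the neighbour is the one that is not `T`. -/
lemma DualPair.existsUnique_neighbor (h : DualPair V W) {g : Set E4} {T : Tile}
    (hT : IsPiece V g T) {ε : Set (E4 × E4)} (hε : ε ∈ T.edges) :
    ∃! T' : Tile, T' ∈ tiles V ∧ T' ≠ T ∧ ε ∈ T'.edges := by
  obtain ⟨a, b, hab, hag, hbg, rfl⟩ := (h.mem_edges_iff hT).1 hε
  obtain ⟨k, hk, hg⟩ := hT.exists_cell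
  obtain ⟨i, j, hi, hj, hij, ha, hb⟩ := id hab
  have hdb := h.symm.dual_mem_cells hj hb
  have hdd := h.symm.dual_dual hj hb
  have hab' : a ⊆ dual W b := by
    refine hag.trans ?_
    rw [← h.dual_dual hk hg]; exact dual_anti hbg
  have hba : b ⊆ dual V a := hdd ▸ dual_anti hab'
  have hne : a ≠ dual W b := fun heq => by
    have h1 := h.sdim_cell ha
    have h2 := h.sdim_cell hdb
    rw [← heq] at h2
    omega
  obtain ⟨g', hg'ne, k', hk', hg', hag', hbg', hother⟩ : ∃ g', g' ≠ g ∧ ∃ k', k' ≠ 0 ∧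
      g' ∈ cells (P V) k' ∧ a ⊆ g' ∧ b ⊆ dual V g' ∧ ∀ g'', g'' = a ∨ g'' = dual W b →
      g'' ≠ g → g'' = g' := by
    obtain rfl | rfl := h.eq_or_eq_of_edge hk hg hab hag hbg
    · exact ⟨dual W b, hne.symm, _, by omega, hdb, hab', hdd.symm.subset,
        fun g'' h1 h2 => h1.resolve_left h2⟩
    · exact ⟨a, hne, i, hi, ha, subset_rfl, hba, fun g'' h1 h2 => h1.resolve_right h2⟩
  obtain ⟨T', hT'⟩ := h.exists_piece hk' hg'
  -- A piece determines its first factor, because its carrier is a non-empty product.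
  have hdist : ∀ {g₁ g₂ : Set E4} {T₁ T₂ : Tile}, IsPiece V g₁ T₁ → IsPiece V g₂ T₂ →
      T₁ = T₂ → g₁ = g₂ := by
    intro g₁ g₂ T₁ T₂ h₁ h₂ heq
    obtain ⟨k₁, hk₁, hc₁⟩ := h₁.exists_cell
    have hne₁ : (g₁ ×ˢ dual V g₁).Nonempty :=
      (h.cell_nonempty hk₁ hc₁).prod (h.symm.cell_nonempty (by
        have := h.cell_le_three hc₁; omega) (h.dual_mem_cells hk₁ hc₁))
    have h3 := h₁.carrier_eq
    rw [heq, h₂.carrier_eq] at h3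
    exact ((Set.prod_eq_prod_iff_of_nonempty hne₁).1 h3.symm).1
  refine ⟨T', ⟨h.mem_tiles_iff.2 ⟨_, hT'⟩, fun heq => hg'ne (hdist hT' hT heq),
    (h.mem_edges_iff hT').2 ⟨a, b, hab, hag', hbg', rfl⟩⟩, ?_⟩
  rintro T'' ⟨hT'', hTT'', he''⟩
  obtain ⟨g'', hT''⟩ := h.mem_tiles_iff.1 hT''
  obtain ⟨a'', b'', hab'', hag'', hbg'', heq⟩ := (h.mem_edges_iff hT'').1 he''
  obtain ⟨rfl, rfl⟩ := (Set.prod_eq_prod_iff_of_nonempty (hab.nonempty h)).1 heq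
  obtain ⟨k'', hk'', hg''⟩ := hT''.exists_cell
  have h1 := hother g'' (h.eq_or_eq_of_edge hk'' hg'' hab hag'' hbg'') fun h2 => by
    rw [h2] at hT''
    exact hTT'' (h.piece_unique hT'' hT)
  rw [h1] at hT''
  exact h.piece_unique hT'' hT'

/-! ### Shapes of the pieces -/

lemma DualPair.hemispherical (h : DualPair V W) (hne : V.Nonempty) :
    Hemispherical (V : Set E4) := by
  obtain ⟨u, hu, -⟩ := h.interior
  obtain ⟨v, hv⟩ := hne
  have hu0 : u ≠ 0 := by
    rintro rfl
    simpa using hu v hv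
  refine ⟨_, normalize_mem_S3 hu0, fun x hx => ?_⟩
  rw [real_inner_smul_right]
  exact mul_pos (inv_pos.2 (norm_pos_iff.2 hu0)) (hu x hx)

lemma DualPair.isSphericalPolygon (h : DualPair V W) {f : Set E4} {ν : E4}
    (hf : f ∈ cells (P V) 3) (hν : ν ∈ dual V f) : IsSphericalPolygon ν f := by
  obtain ⟨hνW, hνf⟩ := (h.mem_polarFace_iff (by norm_num) hf).1 hν
  refine ⟨hνW.2, fun x hx => ⟨(h.cell_subset hf hx).2, hνf x hx⟩, h.sdim_cell hf, ?_⟩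
  obtain ⟨μ, hμ, rfl, h3⟩ := h.mem_cells.1 hf
  have hZV : zeros V μ ⊆ V := fun v hv => (mem_zeros.1 hv).1
  obtain ⟨v, hv⟩ := h.zeros_nonempty hμ.1 (by rw [h3]; norm_num)
  obtain ⟨x₀, hx₀, hpos⟩ := h.hemispherical ⟨v, hZV hv⟩
  exact ⟨zeros V μ, fun w hw => h.left_sphere w (hZV hw), ⟨x₀, hx₀, fun w hw => hpos w (hZV hw)⟩,
    h.face_eq_CH hμ.1⟩

lemma tileDist_right {x y ν : E4} (hν : ν ∈ S3) :
    tileDist (x, ν) (y, ν) = InnerProductGeometry.angle x y := by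
  rw [tileDist, InnerProductGeometry.angle_self (ne_zero_of_mem_S3 hν)]
  simp [Real.sqrt_sq (InnerProductGeometry.angle_nonneg x y)]

lemma tileDist_left {x y v : E4} (hv : v ∈ S3) :
    tileDist (v, x) (v, y) = InnerProductGeometry.angle x y := by
  rw [tileDist, InnerProductGeometry.angle_self (ne_zero_of_mem_S3 hv)]
  simp [Real.sqrt_sq (InnerProductGeometry.angle_nonneg x y)]

lemma angle_circ {p q : E4} (hp : ‖p‖ = 1) (hq : ‖q‖ = 1) (hpq : ⟪p, q⟫ = 0) {a s t : ℝ}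
    (ha : a ≤ Real.pi) (hs : s ∈ Set.Icc 0 a) (ht : t ∈ Set.Icc 0 a) :
    InnerProductGeometry.angle (circ p q s) (circ p q t) = |s - t| := by
  rw [InnerProductGeometry.angle, inner_circ hp hq hpq, norm_circ hp hq hpq, norm_circ hp hq hpq,
    mul_one, div_one, ← Real.cos_abs, Real.arccos_cos (abs_nonneg _)]
  rw [abs_le]
  constructor <;> linarith [hs.1, hs.2, ht.1, ht.2]

/-! ### Determinants and orientations -/

lemma det4_apply (a b c d : E4) : det4 a b c d =
    a 0 * (b 1 * (c 2 * d 3 - c 3 * d 2) - b 2 * (c 1 * d 3 - c 3 * d 1)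
      + b 3 * (c 1 * d 2 - c 2 * d 1))
    - a 1 * (b 0 * (c 2 * d 3 - c 3 * d 2) - b 2 * (c 0 * d 3 - c 3 * d 0)
      + b 3 * (c 0 * d 2 - c 2 * d 0))
    + a 2 * (b 0 * (c 1 * d 3 - c 3 * d 1) - b 1 * (c 0 * d 3 - c 3 * d 0)
      + b 3 * (c 0 * d 1 - c 1 * d 0))
    - a 3 * (b 0 * (c 1 * d 2 - c 2 * d 1) - b 1 * (c 0 * d 2 - c 2 * d 0)
      + b 2 * (c 0 * d 1 - c 1 * d 0)) := by
  simp [det4, Matrix.det_succ_row_zero, Fin.sum_univ_succ, Fin.succAbove]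
  ring

lemma inner_E4 (x y : E4) : ⟪x, y⟫ = x 0 * y 0 + x 1 * y 1 + x 2 * y 2 + x 3 * y 3 := by
  simp [PiLp.inner_apply, Fin.sum_univ_succ]
  ring

/-- The Gram matrix of the four rows is diagonal. -/
lemma det4_sq_of_orthogonal {a b c d : E4} (hab : ⟪a, b⟫ = 0) (hac : ⟪a, c⟫ = 0)
    (had : ⟪a, d⟫ = 0) (hbc : ⟪b, c⟫ = 0) (hbd : ⟪b, d⟫ = 0) (hcd : ⟪c, d⟫ = 0) :
    det4 a b c d ^ 2 = ⟪a, a⟫ * ⟪b, b⟫ * ⟪c, c⟫ * ⟪d, d⟫ := by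
  set M := Matrix.of fun i j : Fin 4 => (![a, b, c, d] i) j with hM
  have h1 : M * M.transpose = Matrix.diagonal ![⟪a, a⟫, ⟪b, b⟫, ⟪c, c⟫, ⟪d, d⟫] := by
    have h2 : ∀ i j, (M * M.transpose) i j = ⟪![a, b, c, d] i, ![a, b, c, d] j⟫ := fun i j => by
      rw [inner_E4, Matrix.mul_apply, Fin.sum_univ_four]; rfl
    ext i j
    rw [h2]
    fin_cases i <;> fin_cases j <;>
      simp [hab, hac, had, hbc, hbd, hcd, real_inner_comm a, real_inner_comm b c,
        real_inner_comm b d, real_inner_comm c d]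
  have h3 := congrArg Matrix.det h1
  rw [Matrix.det_mul, Matrix.det_transpose, Matrix.det_diagonal, Fin.prod_univ_four] at h3
  rw [sq]
  exact h3

lemma det4_ne_zero_of_orthogonal {a b c d : E4} (hab : ⟪a, b⟫ = 0) (hac : ⟪a, c⟫ = 0)
    (had : ⟪a, d⟫ = 0) (hbc : ⟪b, c⟫ = 0) (hbd : ⟪b, d⟫ = 0) (hcd : ⟪c, d⟫ = 0)
    (ha : a ≠ 0) (hb : b ≠ 0) (hc : c ≠ 0) (hd : d ≠ 0) : det4 a b c d ≠ 0 := fun h0 => by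
  have h1 := det4_sq_of_orthogonal hab hac had hbc hbd hcd
  have := mul_pos (mul_pos (mul_pos (real_inner_self_pos.2 ha) (real_inner_self_pos.2 hb))
    (real_inner_self_pos.2 hc)) (real_inner_self_pos.2 hd)
  rw [← h1, h0] at this
  norm_num at this

lemma det4_eq_zero_of_orthogonal {a b c d n : E4} (hn : n ≠ 0) (ha : ⟪a, n⟫ = 0)
    (hb : ⟪b, n⟫ = 0) (hc : ⟪c, n⟫ = 0) (hd : ⟪d, n⟫ = 0) : det4 a b c d = 0 := by
  rw [det4, ← Matrix.exists_mulVec_eq_zero_iff]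
  refine ⟨fun i => n i, fun h0 => hn (by ext i; exact congrFun h0 i), ?_⟩
  ext i
  have h1 : ∀ y : E4, ⟪y, n⟫ = 0 → ∑ j, y j * n j = 0 := fun y hy => by
    rw [inner_E4] at hy
    rw [Fin.sum_univ_four]; exact hy
  fin_cases i
  exacts [h1 a ha, h1 b hb, h1 c hc, h1 d hd]

lemma det4_swap_right (a b c d : E4) : det4 a b c d = -det4 a b d c := by
  simp only [det4_apply]; ring

lemma det4_add_smul (a b c d e : E4) (s t : ℝ) :
    det4 a b c (s • d + t • e) = s * det4 a b c d + t * det4 a b c e := by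
  simp only [det4_apply, PiLp.add_apply, PiLp.smul_apply, smul_eq_mul]; ring

/-- With the other three vectors in n^⊥, the determinant sees only the component of the last vector
along `n`. This is how one normal direction is exchanged for another below. -/
lemma inner_mul_det4 {a b c n : E4} (hn : n ≠ 0) (ha : ⟪a, n⟫ = 0) (hb : ⟪b, n⟫ = 0)
    (hc : ⟪c, n⟫ = 0) (y : E4) : ⟪n, n⟫ * det4 a b c y = ⟪y, n⟫ * det4 a b c n := by
  have h1 := det4_eq_zero_of_orthogonal (d := ⟪n, n⟫ • y + (-⟪y, n⟫) • n) hn ha hb hc (by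
    rw [inner_add_left, real_inner_smul_left, real_inner_smul_left]; ring)
  rw [det4_add_smul] at h1
  linarith

/-- The image in `ℝ⁴` of a pair of tangent vectors under the differential of `(x, ν) ↦ x + ν`. -/
def total (w : E4 × E4) : E4 := w.1 + w.2

/-- The orientation form of the surface of all `x + ν`, whose normal at `x + ν` is `ν - x`. -/
noncomputable def orient (p w₁ w₂ : E4 × E4) : ℝ :=
  det4 (p.1 + p.2) (total w₁) (total w₂) (p.2 - p.1)

/-- The tangent plane at `p` of the piece with first factor `g`. -/
def Tan (g : Set E4) (p : E4 × E4) : Set (E4 × E4) :=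
  {w | w.1 ∈ Submodule.span ℝ g ∧ ⟪p.1, w.1⟫ = 0 ∧ w.2 ∈ (Submodule.span ℝ g)ᗮ ∧ ⟪p.2, w.2⟫ = 0}

lemma orient_left (x ν ξ₁ ξ₂ : E4) :
    orient (x, ν) (ξ₁, 0) (ξ₂, 0) = 2 * det4 x ξ₁ ξ₂ ν := by
  simp only [orient, total, det4_apply, PiLp.add_apply, PiLp.sub_apply, PiLp.zero_apply]; ring

lemma orient_right (x ν η₁ η₂ : E4) :
    orient (x, ν) (0, η₁) (0, η₂) = 2 * det4 ν η₁ η₂ (-x) := by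
  simp only [orient, total, det4_apply, PiLp.add_apply, PiLp.sub_apply, PiLp.zero_apply,
    PiLp.neg_apply]
  ring

lemma orient_mixed (x ν ξ η : E4) (a₁ b₁ a₂ b₂ : ℝ) :
    orient (x, ν) (a₁ • ξ, b₁ • η) (a₂ • ξ, b₂ • η) =
      -2 * (a₁ * b₂ - a₂ * b₁) * det4 x ξ ν η := by
  simp only [orient, total, det4_apply, PiLp.add_apply, PiLp.sub_apply, PiLp.smul_apply,
    smul_eq_mul]
  ring

lemma mem_span_singleton_orthogonal {x y : E4} :
    y ∈ (Submodule.span ℝ ({x} : Set E4))ᗮ ↔ ⟪x, y⟫ = 0 := by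
  rw [mem_orthogonal_span]; simp

lemma eq_zero_of_mem_span_singleton {x y : E4} (hy : y ∈ Submodule.span ℝ ({x} : Set E4))
    (hxy : ⟪x, y⟫ = 0) : y = 0 :=
  inner_self_eq_zero.1 (Submodule.inner_right_of_mem_orthogonal hy
    (mem_span_singleton_orthogonal.2 hxy))

lemma det4_neg_right (a b c d : E4) : det4 a b c (-d) = -det4 a b c d := by
  simp only [det4_apply, PiLp.neg_apply]; ring

/-- Unifies the three orientation conventions. By `orient_left`, `orient_right` and `orient_mixed`
each is the sign of `orient`; the factor -2 in the mixed case accounts for the reversed orientation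
of the rectangles. -/
lemma DualPair.pos_iff (h : DualPair V W) {g : Set E4} {T : Tile} (hT : IsPiece V g T)
    {p w₁ w₂ : E4 × E4} (hp : p ∈ T.carrier) :
    T.pos p w₁ w₂ ↔ w₁ ∈ Tan g p ∧ w₂ ∈ Tan g p ∧ 0 < orient p w₁ w₂ := by
  obtain ⟨x, ν⟩ := p
  have hxν := h.isPiece_subset hT hp
  rw [hT.carrier_eq] at hp
  obtain ⟨hx : x ∈ g, hν : ν ∈ dual V g⟩ := hp
  obtain ⟨hg, rfl⟩ | ⟨hg, rfl⟩ | ⟨v, rfl, hg, rfl⟩ := hT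
  · have hspan : (Submodule.span ℝ g)ᗮ = Submodule.span ℝ {ν} := by
      have hd := h.dual_mem_cells (by norm_num) hg
      rw [← h.span_dual (by norm_num) hg, (h.symm.subsingleton_of_sdim (h.symm.cell_subset hd)
        (h.symm.sdim_cell hd)).eq_singleton_of_mem hν]
    have hmem : ∀ ξ : E4, ξ ∈ Submodule.span ℝ g ↔ ⟪ν, ξ⟫ = 0 := fun ξ => by
      rw [← Submodule.orthogonal_orthogonal (Submodule.span ℝ g), hspan,
        mem_span_singleton_orthogonal]
    constructor
    · rintro ⟨ξ₁, ξ₂, rfl, rfl, h1, h2, h3, h4, h5⟩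
      refine ⟨⟨(hmem _).2 h2, h1, Submodule.zero_mem _, inner_zero_right _⟩,
        ⟨(hmem _).2 h4, h3, Submodule.zero_mem _, inner_zero_right _⟩, ?_⟩
      rw [orient_left]
      exact mul_pos two_pos h5
    · rintro ⟨⟨h1, h2, h3, h4⟩, ⟨h5, h6, h7, h8⟩, h9⟩
      obtain ⟨ξ₁, η₁⟩ := w₁
      obtain ⟨ξ₂, η₂⟩ := w₂
      rw [hspan] at h3 h7
      obtain rfl : η₁ = 0 := eq_zero_of_mem_span_singleton h3 h4
      obtain rfl : η₂ = 0 := eq_zero_of_mem_span_singleton h7 h8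
      rw [orient_left] at h9
      exact ⟨ξ₁, ξ₂, rfl, rfl, h2, (hmem _).1 h1, h6, (hmem _).1 h5, by linarith⟩
  · constructor
    · rintro ⟨ξ, η, h1, h2, h3, h4, h5, h6, h7, a₁, b₁, a₂, b₂, rfl, rfl, h8⟩
      refine ⟨⟨Submodule.smul_mem _ _ h1, ?_, Submodule.smul_mem _ _ h4, ?_⟩,
        ⟨Submodule.smul_mem _ _ h1, ?_, Submodule.smul_mem _ _ h4, ?_⟩, ?_⟩
      · rw [real_inner_smul_right, h3, mul_zero]
      · rw [real_inner_smul_right, h6, mul_zero]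
      · rw [real_inner_smul_right, h3, mul_zero]
      · rw [real_inner_smul_right, h6, mul_zero]
      · rw [orient_mixed]
        exact mul_pos (by linarith) h7
    · rintro ⟨⟨h1, h2, h3, h4⟩, ⟨h5, h6, h7, h8⟩, h9⟩
      obtain ⟨ξ₁, η₁⟩ := w₁
      obtain ⟨ξ₂, η₂⟩ := w₂
      have hS : finrank ℝ (Submodule.span ℝ g) = 2 := h.sdim_cell hg
      have hx1 := mem_S3.1 hxν.1.2
      have hν1 := mem_S3.1 hxν.2.1.2
      have hνS : ν ∈ (Submodule.span ℝ g)ᗮ := by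
        rw [← h.span_dual (by norm_num) hg]; exact Submodule.subset_span hν
      have hxS : x ∈ Submodule.span ℝ g := Submodule.subset_span hx
      obtain ⟨ξ, hξS, hξ1, hxξ, hξ⟩ := exists_plane_basis hS hxS hx1
      obtain ⟨η, hηS, hη1, hνη, hη⟩ := exists_plane_basis (by rw [finrank_orthogonal, hS]) hνS hν1
      have horth : ∀ {y z : E4}, y ∈ Submodule.span ℝ g → z ∈ (Submodule.span ℝ g)ᗮ →
        ⟪y, z⟫ = 0 := fun hy hz => Submodule.inner_right_of_mem_orthogonal hy hz
      have hdet : det4 x ξ ν η ≠ 0 :=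
        det4_ne_zero_of_orthogonal hxξ (horth hxS hνS) (horth hxS hηS) (horth hξS hνS)
          (horth hξS hηS) hνη (ne_zero_of_mem_S3 (mem_S3.2 hx1)) (ne_zero_of_mem_S3 (mem_S3.2 hξ1))
          (ne_zero_of_mem_S3 (mem_S3.2 hν1)) (ne_zero_of_mem_S3 (mem_S3.2 hη1))
      -- The sign of `η` is adjusted so that the frame (x, ξ, ν, η) is positive.
      obtain ⟨η, hηS, hη1, hνη, hη, hdet⟩ : ∃ η ∈ (Submodule.span ℝ g)ᗮ, ‖η‖ = 1 ∧ ⟪ν, η⟫ = 0 ∧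
          (∀ y ∈ (Submodule.span ℝ g)ᗮ, y = ⟪y, ν⟫ • ν + ⟪y, η⟫ • η) ∧ 0 < det4 x ξ ν η := by
        rcases hdet.lt_or_gt with hlt | hgt
        · refine ⟨-η, Submodule.neg_mem _ hηS, by rwa [norm_neg], by rw [inner_neg_right, hνη,
            neg_zero], fun y hy => ?_, by rw [det4_neg_right]; linarith⟩
          rw [inner_neg_right, smul_neg, neg_smul, neg_neg]
          exact hη y hy
        · exact ⟨η, hηS, hη1, hνη, hη, hgt⟩
      have e1 := hξ _ h1
      have e2 := hξ _ h5
      have e3 := hη _ h3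
      have e4 := hη _ h7
      rw [real_inner_comm] at e1 e2 e3 e4
      simp only at h2 h4 h6 h8 e1 e2 e3 e4
      rw [h2, zero_smul, zero_add] at e1
      rw [h6, zero_smul, zero_add] at e2
      rw [h4, zero_smul, zero_add] at e3
      rw [h8, zero_smul, zero_add] at e4
      refine ⟨ξ, η, hξS, hξ1, hxξ, hηS, hη1, hνη, hdet, ⟪ξ₁, ξ⟫, ⟪η₁, η⟫, ⟪ξ₂, ξ⟫, ⟪η₂, η⟫,
        Prod.ext e1 e3, Prod.ext e2 e4, ?_⟩
      rw [e1, e2, e3, e4, orient_mixed] at h9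
      have h10 := pos_of_mul_pos_left h9 hdet.le
      linarith
  · obtain rfl : x = v := hx
    have hmem : ∀ η : E4, η ∈ (Submodule.span ℝ {x})ᗮ ↔ ⟪x, η⟫ = 0 := fun η =>
      mem_span_singleton_orthogonal
    constructor
    · rintro ⟨η₁, η₂, rfl, rfl, h1, h2, h3, h4, h5⟩
      refine ⟨⟨Submodule.zero_mem _, inner_zero_right _, (hmem _).2 h1, h2⟩,
        ⟨Submodule.zero_mem _, inner_zero_right _, (hmem _).2 h3, h4⟩, ?_⟩
      rw [orient_right]
      exact mul_pos two_pos h5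
    · rintro ⟨⟨h1, h2, h3, h4⟩, ⟨h5, h6, h7, h8⟩, h9⟩
      obtain ⟨ξ₁, η₁⟩ := w₁
      obtain ⟨ξ₂, η₂⟩ := w₂
      obtain rfl : ξ₁ = 0 := eq_zero_of_mem_span_singleton h1 h2
      obtain rfl : ξ₂ = 0 := eq_zero_of_mem_span_singleton h5 h6
      rw [orient_right] at h9
      exact ⟨η₁, η₂, rfl, rfl, (hmem _).1 h3, h4, (hmem _).1 h7, h8, by linarith⟩

/-! ### Adjacent pieces induce opposite orientations -/

/-- The direction `m` orthogonal to an edge `a` at a vertex `ν` of the dual edge: the face with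
normal `ν` lies on one side of `m^⊥`, the dual edge on the other side. -/
lemma DualPair.exists_separating (h : DualPair V W) {a : Set E4} {ν : E4} (ha : a ∈ cells (P V) 2)
    (hν : {ν} ∈ cells (P W) 1) (hνa : ν ∈ dual V a) :
    ∃ m : E4, m ≠ 0 ∧ (∀ x ∈ a, ⟪m, x⟫ = 0) ∧ ⟪m, ν⟫ = 0 ∧
      (∀ y ∈ dual W {ν}, ⟪m, y⟫ ≤ 0) ∧ (∃ y ∈ dual W {ν}, ⟪m, y⟫ < 0) ∧
      (∀ y ∈ dual V a, 0 ≤ ⟪m, y⟫) ∧ ∃ y ∈ dual V a, 0 < ⟪m, y⟫ := by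
  have hd := h.dual_mem_cells (by norm_num) ha
  have hf := h.symm.dual_mem_cells (by norm_num) hν
  have hdf := h.symm.dual_dual (by norm_num) hν
  have hdmem := fun y => h.mem_polarFace_iff (y := y) (by norm_num) ha
  have hfmem := fun y => h.symm.mem_polarFace_iff (y := y) (by norm_num) hν
  have hνW := h.symm.cell_subset hν rfl
  have hν1 := mem_S3.1 hνW.2
  obtain ⟨μ, hμ, hμν⟩ : ∃ μ ∈ dual V a, μ ≠ ν := by
    by_contra! hcon
    have h1 : dual V a ⊆ {ν} := fun y hy => hcon y hy
    have h2 := h.symm.cell_le_of_subset hd hν h1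
    norm_num at h2
  have hμW := ((hdmem μ).1 hμ).1
  -- `m` is the direction in which the dual edge leaves its endpoint `ν`.
  set m := μ - ⟪μ, ν⟫ • ν with hm
  have hm0 : m ≠ 0 := fun h0 => by
    rw [hm, sub_eq_zero] at h0
    exact hμν (h.symm.eq_of_smul hνW hμW h0.symm).symm
  have hmν : ⟪m, ν⟫ = 0 := by
    rw [hm, inner_sub_left, real_inner_smul_left, real_inner_self_eq_norm_sq, hν1]; ring
  have hνS : ν ∈ (Submodule.span ℝ a)ᗮ := mem_orthogonal_span.2 ((hdmem ν).1 hνa).2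
  have hμS : μ ∈ (Submodule.span ℝ a)ᗮ := mem_orthogonal_span.2 ((hdmem μ).1 hμ).2
  have hmS : m ∈ (Submodule.span ℝ a)ᗮ := Submodule.sub_mem _ hμS (Submodule.smul_mem _ _ hνS)
  have hyν : ∀ y ∈ dual W {ν}, ⟪ν, y⟫ = 0 := fun y hy => ((hfmem y).1 hy).2 ν rfl
  have hmy : ∀ y ∈ dual W {ν}, ⟪m, y⟫ = ⟪μ, y⟫ := fun y hy => by
    rw [hm, inner_sub_left, real_inner_smul_left, hyν y hy]; ring
  have hle : ∀ y ∈ dual W {ν}, ⟪m, y⟫ ≤ 0 := fun y hy => by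
    rw [hmy y hy, real_inner_comm]
    exact h.inner_nonpos ((hfmem y).1 hy).1.1 hμW.1
  have hlt : ∃ y ∈ dual W {ν}, ⟪m, y⟫ < 0 := by
    -- If `m` vanished on the whole face `ν*`, then `μ` would lie in its dual, which is just `ν`.
    by_contra! hcon
    have h1 : μ ∈ dual V (dual W {ν}) := by
      rw [h.mem_polarFace_iff (by norm_num) hf]
      refine ⟨hμW, fun y hy => ?_⟩
      rw [real_inner_comm, ← hmy y hy]
      exact le_antisymm (hle y hy) (hcon y hy)
    rw [hdf] at h1
    exact hμν h1
  refine ⟨m, hm0, fun x hx => ?_, hmν, hle, hlt, fun y hy => ?_, μ, hμ, ?_⟩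
  · exact Submodule.inner_left_of_mem_orthogonal (Submodule.subset_span hx) hmS
  -- In the plane a^⊥, the vector `m` is a multiple of `q`. Comparison with a point `z` of the face
  -- where `m` is negative, with ⟪y, z⟫ ≤ 0, shows that ⟪m, y⟫ is not negative.
  · obtain ⟨q, hqS, hq1, hνq, hq⟩ := exists_plane_basis (S := (Submodule.span ℝ a)ᗮ) (by
      rw [finrank_orthogonal, show finrank ℝ (Submodule.span ℝ a) = 2 from h.sdim_cell ha]) hνS hν1
    obtain ⟨z, hz, hmz⟩ := hlt
    have hyW := ((hdmem y).1 hy).1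
    have e1 : y = ⟪y, ν⟫ • ν + ⟪y, q⟫ • q := hq y (mem_orthogonal_span.2 ((hdmem y).1 hy).2)
    have e2 := hq m hmS
    rw [hmν, zero_smul, zero_add] at e2
    have h1 : ⟪y, z⟫ = ⟪y, q⟫ * ⟪q, z⟫ := by
      nth_rewrite 1 [e1]
      rw [inner_add_left, real_inner_smul_left, real_inner_smul_left, hyν z hz]; ring
    have h2 : ⟪m, z⟫ = ⟪m, q⟫ * ⟪q, z⟫ := by
      nth_rewrite 1 [e2]
      rw [real_inner_smul_left]
    have h3 : ⟪m, y⟫ = ⟪m, q⟫ * ⟪y, q⟫ := by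
      nth_rewrite 1 [e2]
      rw [real_inner_smul_left, real_inner_comm y q]
    have h4 : ⟪y, z⟫ ≤ 0 := by
      rw [real_inner_comm]; exact h.inner_nonpos ((hfmem z).1 hz).1.1 hyW.1
    have h5 : ⟪q, z⟫ ≠ 0 := fun h0 => by rw [h2, h0, mul_zero] at hmz; exact lt_irrefl _ hmz
    have h6 : 0 ≤ ⟪m, y⟫ * ⟪q, z⟫ ^ 2 := by
      have := mul_nonneg_of_nonpos_of_nonpos hmz.le h4
      rw [h1, h2] at this
      rw [h3]; linarith
    exact nonneg_of_mul_nonneg_left h6 (by positivity)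
  · have h1 : ⟪m, μ⟫ = ⟪m, m⟫ := by
      nth_rewrite 3 [hm]
      rw [inner_sub_right, real_inner_smul_right, hmν]; ring
    rw [h1]
    exact real_inner_self_pos.2 hm0

/-! ### Tangent cones of the pieces and induced boundary orientations -/

lemma hasDerivAt_normalize {x y : E4} (hx : ‖x‖ = 1) (hy : ‖y‖ = 1) :
    HasDerivAt (fun t : ℝ => ‖x + t • y‖⁻¹ • (x + t • y)) (y - ⟪y, x⟫ • x) 0 := by
  have hn : ∀ t : ℝ, ‖x + t • y‖ = Real.sqrt (1 + t * (2 * ⟪y, x⟫) + t ^ 2) := fun t => by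
    rw [← Real.sqrt_sq (norm_nonneg (x + t • y)), norm_add_sq_real, norm_smul, hx, hy,
      real_inner_smul_right, real_inner_comm y x, mul_one, Real.norm_eq_abs, sq_abs]
    congr 1; ring
  have h1 : HasDerivAt (fun t : ℝ => 1 + t * (2 * ⟪y, x⟫) + t ^ 2) (2 * ⟪y, x⟫) 0 := by
    have := (((hasDerivAt_id (0 : ℝ)).mul_const (2 * ⟪y, x⟫)).const_add 1).add
      ((hasDerivAt_id (0 : ℝ)).pow 2)
    exact this.congr_deriv (by simp)
  have h2 : HasDerivAt (fun t : ℝ => ‖x + t • y‖⁻¹) (-⟪y, x⟫) 0 := by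
    simp only [hn]
    exact ((h1.sqrt (by norm_num)).inv (by norm_num)).congr_deriv (by norm_num)
  have h3 : HasDerivAt (fun t : ℝ => x + t • y) y 0 := by
    simpa using ((hasDerivAt_id (0 : ℝ)).smul_const y).const_add x
  refine (h2.smul h3).congr_deriv ?_
  simp only [zero_smul, add_zero, hx, inv_one, one_smul, neg_smul]
  abel

/-- The vector is the initial velocity of the radially projected rays from `x` towards `y` and from
`ν` towards `μ`, which stay in the two factors. -/
lemma tangent_mem {g b : Set E4} {x y ν μ : E4} (hx1 : ‖x‖ = 1) (hy1 : ‖y‖ = 1)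
    (hν1 : ‖ν‖ = 1) (hμ1 : ‖μ‖ = 1)
    (hg : ∀ t : ℝ, 0 < t → ‖x + t • y‖⁻¹ • (x + t • y) ∈ g)
    (hb : ∀ t : ℝ, 0 < t → ‖ν + t • μ‖⁻¹ • (ν + t • μ) ∈ b) :
    (y - ⟪y, x⟫ • x, μ - ⟪μ, ν⟫ • ν) ∈ posTangentConeAt (g ×ˢ b) (x, ν) := by
  set γ : ℝ → E4 × E4 :=
    fun t => (‖x + t • y‖⁻¹ • (x + t • y), ‖ν + t • μ‖⁻¹ • (ν + t • μ)) with hγ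
  have hd : HasDerivAt γ (y - ⟪y, x⟫ • x, μ - ⟪μ, ν⟫ • ν) 0 :=
    (hasDerivAt_normalize hx1 hy1).prodMk (hasDerivAt_normalize hν1 hμ1)
  have hγ0 : γ 0 = (x, ν) := by simp [hγ, hx1, hν1]
  refine mem_tangentConeAt_of_seq (nhdsWithin (0 : ℝ) (Set.Ioi 0)) (fun t => t⁻¹.toNNReal)
    (fun t => γ t - (x, ν)) ?_ ?_ ?_
  · have h1 := hd.continuousAt.tendsto
    rw [hγ0] at h1
    have h2 := (h1.mono_left (nhdsWithin_le_nhds (s := Set.Ioi 0))).sub_const (x, ν)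
    rwa [sub_self] at h2
  · filter_upwards [self_mem_nhdsWithin] with t ht
    rw [add_sub_cancel]
    exact ⟨hg t ht, hb t ht⟩
  · have h1 := hasDerivAt_iff_tendsto_slope_zero.1 hd
    have h2 := h1.mono_left (nhdsWithin_mono (0 : ℝ) (s := Set.Ioi 0) (fun t ht => ne_of_gt ht))
    refine h2.congr' ?_
    filter_upwards [self_mem_nhdsWithin] with t ht
    rw [NNReal.smul_def, Real.coe_toNNReal _ (inv_nonneg.2 (le_of_lt ht)), zero_add, hγ0]

lemma DualPair.normalize_mem_face (h : DualPair V W) {ν x y : E4} (hx : x ∈ face V ν)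
    (hy : y ∈ face V ν) {t : ℝ} (ht : 0 < t) : ‖x + t • y‖⁻¹ • (x + t • y) ∈ face V ν := by
  have hy' := smul_mem_cone ht.le hy.1.1
  refine ⟨normalize_mem_CH (add_mem_cone hx.1.1 hy')
    (h.add_ne_zero hx.1.1 (ne_zero_of_mem_S3 hx.1.2) hy'), ?_⟩
  rw [real_inner_smul_left, inner_add_left, real_inner_smul_left, hx.2, hy.2]; ring

lemma DualPair.normalize_mem_cell (h : DualPair V W) {g : Set E4} {k : ℕ} (hg : g ∈ cells (P V) k)
    {x y : E4} (hx : x ∈ g) (hy : y ∈ g) {t : ℝ} (ht : 0 < t) :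
    ‖x + t • y‖⁻¹ • (x + t • y) ∈ g := by
  obtain ⟨ν, -, rfl, -⟩ := h.mem_cells.1 hg
  exact h.normalize_mem_face hx hy ht

lemma total_inner_nonneg_of_mem_posTangentConeAt {s : Set (E4 × E4)} {p n : E4 × E4} {m : E4}
    (hs : ∀ q ∈ s, 0 ≤ ⟪m, total q⟫) (hp : ⟪m, total p⟫ = 0) (hn : n ∈ posTangentConeAt s p) :
    0 ≤ ⟪m, total n⟫ := by
  obtain ⟨ι, l, hl, c, d, hd, hds, hcd⟩ := exists_fun_of_mem_tangentConeAt hn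
  have hcont : Continuous fun q : E4 × E4 => ⟪m, total q⟫ := by unfold total; fun_prop
  refine ge_of_tendsto ((hcont.tendsto n).comp hcd) ?_
  filter_upwards [hds] with i hi
  have h1 := hs _ hi
  have h2 : total (p + d i) = total p + total (d i) := by
    simp only [total, Prod.fst_add, Prod.snd_add]; abel
  have h3 : total (c i • d i) = (c i : ℝ) • total (d i) := by
    simp only [total, NNReal.smul_def, Prod.smul_fst, Prod.smul_snd, smul_add]
  rw [h2, inner_add_right, hp, zero_add] at h1
  simp only [Function.comp]
  rw [h3, real_inner_smul_right]
  exact mul_nonneg (c i).2 h1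

/-- On the unit sphere 2⟪x, d⟫ = -‖d‖², so the increment in the direction of `x` is of second order
and disappears in the limit. -/
lemma inner_eq_zero_of_tendsto {ι : Type*} {l : Filter ι} [l.NeBot] {x w : E4} {c : ι → ℝ}
    {d : ι → E4} (hx : ‖x‖ = 1) (hd : Filter.Tendsto d l (nhds 0)) (hds : ∀ᶠ i in l, ‖x + d i‖ = 1)
    (hcd : Filter.Tendsto (fun i => c i • d i) l (nhds w)) : ⟪x, w⟫ = 0 := by
  have h1 : Filter.Tendsto (fun i => ⟪x, c i • d i⟫) l (nhds ⟪x, w⟫) :=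
    tendsto_const_nhds.inner hcd
  have h2 : Filter.Tendsto (fun i => -(1 / 2 : ℝ) * ⟪c i • d i, d i⟫) l (nhds 0) := by
    have := (hcd.inner (𝕜 := ℝ) hd).const_mul (-(1 / 2 : ℝ))
    rwa [inner_zero_right, mul_zero] at this
  refine tendsto_nhds_unique h1 (h2.congr' ?_)
  filter_upwards [hds] with i hi
  have h3 := norm_add_sq_real x (d i)
  rw [hi, hx] at h3
  rw [real_inner_smul_left, real_inner_smul_right, real_inner_self_eq_norm_sq]
  linear_combination (c i / 2) * h3

lemma mem_of_mem_tangentConeAt {a b : Set E4} {x ν : E4} {w : E4 × E4} (haS : a ⊆ S3) (hbS : b ⊆ S3)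
    (hx : x ∈ a) (hν : ν ∈ b) (hw : w ∈ tangentConeAt ℝ (a ×ˢ b) (x, ν)) :
    w.1 ∈ Submodule.span ℝ a ∧ ⟪x, w.1⟫ = 0 ∧ w.2 ∈ Submodule.span ℝ b ∧ ⟪ν, w.2⟫ = 0 := by
  obtain ⟨ι, l, hl, c, d, hd, hds, hcd⟩ := exists_fun_of_mem_tangentConeAt hw
  have hd1 : Filter.Tendsto (fun i => (d i).1) l (nhds 0) := (continuous_fst.tendsto _).comp hd
  have hd2 : Filter.Tendsto (fun i => (d i).2) l (nhds 0) := (continuous_snd.tendsto _).comp hd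
  have hc1 : Filter.Tendsto (fun i => c i • (d i).1) l (nhds w.1) :=
    (continuous_fst.tendsto _).comp hcd
  have hc2 : Filter.Tendsto (fun i => c i • (d i).2) l (nhds w.2) :=
    (continuous_snd.tendsto _).comp hcd
  refine ⟨?_, ?_, ?_, ?_⟩
  · refine (Submodule.closed_of_finiteDimensional (Submodule.span ℝ a)).mem_of_tendsto hc1 ?_
    filter_upwards [hds] with i hi
    have h1 := Submodule.sub_mem _ (Submodule.subset_span (R := ℝ) hi.1) (Submodule.subset_span hx)
    exact Submodule.smul_mem _ _ (by simpa using h1)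
  · refine inner_eq_zero_of_tendsto (mem_S3.1 (haS hx)) hd1 ?_ hc1
    filter_upwards [hds] with i hi using mem_S3.1 (haS hi.1)
  · refine (Submodule.closed_of_finiteDimensional (Submodule.span ℝ b)).mem_of_tendsto hc2 ?_
    filter_upwards [hds] with i hi
    have h1 := Submodule.sub_mem _ (Submodule.subset_span (R := ℝ) hi.2) (Submodule.subset_span hν)
    exact Submodule.smul_mem _ _ (by simpa using h1)
  · refine inner_eq_zero_of_tendsto (mem_S3.1 (hbS hν)) hd2 ?_ hc2
    filter_upwards [hds] with i hi using mem_S3.1 (hbS hi.2)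

lemma DualPair.orthogonal_of_mem_Tan (h : DualPair V W) {g : Set E4} {T : Tile}
    (hT : IsPiece V g T) {p w : E4 × E4} (hp : p ∈ T.carrier) (hw : w ∈ Tan g p) :
    ⟪p.1, w.1⟫ = 0 ∧ ⟪p.1, w.2⟫ = 0 ∧ ⟪p.2, w.1⟫ = 0 ∧ ⟪p.2, w.2⟫ = 0 ∧ ⟪w.1, w.2⟫ = 0 := by
  obtain ⟨k, hk, hg⟩ := hT.exists_cell
  rw [hT.carrier_eq] at hp
  obtain ⟨h1, h2, h3, h4⟩ := hw
  have hν : p.2 ∈ (Submodule.span ℝ g)ᗮ :=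
    mem_orthogonal_span.2 ((h.mem_polarFace_iff hk hg).1 hp.2).2
  exact ⟨h2, Submodule.inner_right_of_mem_orthogonal (Submodule.subset_span hp.1) h3,
    Submodule.inner_left_of_mem_orthogonal h1 hν, h4, Submodule.inner_right_of_mem_orthogonal h1 h3⟩

lemma DualPair.total_orthogonal (h : DualPair V W) {g : Set E4} {T : Tile}
    (hT : IsPiece V g T) {p w : E4 × E4} (hp : p ∈ T.carrier) (hw : w ∈ Tan g p) :
    ⟪p.1 + p.2, total w⟫ = 0 ∧ ⟪total w, p.2 - p.1⟫ = 0 := by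
  obtain ⟨h1, h2, h3, h4, -⟩ := h.orthogonal_of_mem_Tan hT hp hw
  rw [real_inner_comm]
  simp only [total, inner_add_right, h1, h2, h3, h4, inner_sub_right,
    real_inner_comm p.1, real_inner_comm p.2]
  norm_num

lemma DualPair.sum_orthogonal (h : DualPair V W) {g : Set E4} {T : Tile}
    (hT : IsPiece V g T) {p : E4 × E4} (hp : p ∈ T.carrier) :
    ⟪p.1 + p.2, p.2 - p.1⟫ = 0 ∧ ⟪p.1 + p.2, p.1 + p.2⟫ = 2 ∧ ⟪p.2 - p.1, p.2 - p.1⟫ = 2 := by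
  obtain ⟨h1, h2, h3⟩ := h.isPiece_subset (x := p.1) (ν := p.2) hT hp
  have h4 := mem_S3.1 h1.2
  have h5 := mem_S3.1 h2.2
  simp only [inner_add_left, inner_sub_left, inner_add_right, inner_sub_right, h3,
    real_inner_comm p.1 p.2, real_inner_self_eq_norm_sq, h4, h5]
  norm_num

lemma total_ne_zero {w : E4 × E4} (hw : ⟪w.1, w.2⟫ = 0) (hw0 : w ≠ 0) : total w ≠ 0 := fun h0 => by
  have h1 : ⟪total w, total w⟫ = ⟪w.1, w.1⟫ + ⟪w.2, w.2⟫ := by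
    simp only [total, inner_add_left, inner_add_right, hw, real_inner_comm w.1 w.2]; ring
  rw [h0, inner_zero_left] at h1
  have h2 := real_inner_self_nonneg (x := w.1)
  have h3 := real_inner_self_nonneg (x := w.2)
  exact hw0 (Prod.ext (inner_self_eq_zero.1 (by linarith : ⟪w.1, w.1⟫ = 0))
    (inner_self_eq_zero.1 (by linarith : ⟪w.2, w.2⟫ = 0)))

/-- If the piece `T` lies on the positive side of `m^⊥`, where `m` is conormal to a line with
direction `w` in the tangent plane at `p`, then the induced orientation is that of `(w, m)`. -/
lemma DualPair.boundaryPos_iff (h : DualPair V W) {g : Set E4} {T : Tile}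
    (hT : IsPiece V g T) {p w : E4 × E4} {m : E4} (hp : p ∈ T.carrier) (hw : w ∈ Tan g p)
    (hm0 : m ≠ 0) (hm1 : ⟪p.1, m⟫ = 0) (hm2 : ⟪p.2, m⟫ = 0) (hmw : ⟪total w, m⟫ = 0)
    (hs : ∀ q ∈ T.carrier, 0 ≤ ⟪m, total q⟫) (hex : ∃ q ∈ T.carrier, 0 < ⟪m, total q⟫) :
    BoundaryPos T p w ↔ 0 < det4 (p.1 + p.2) (total w) m (p.2 - p.1) := by
  have hmm : 0 < ⟪m, m⟫ := real_inner_self_pos.2 hm0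
  -- The three fixed vectors x + ν, `total w` and ν - x lie in m^⊥, so the form depends on `n` only
  -- through its pairing with `m`.
  have key : ∀ n, ⟪m, m⟫ * orient p w n =
      ⟪m, total n⟫ * det4 (p.1 + p.2) (total w) m (p.2 - p.1) := fun n => by
    have h1 := inner_mul_det4 (a := p.1 + p.2) (b := total w) (c := p.2 - p.1) hm0
      (by rw [inner_add_left, hm1, hm2, add_zero]) hmw
      (by rw [inner_sub_left, hm1, hm2, sub_zero]) (total n)
    rw [det4_swap_right, det4_swap_right _ _ _ m, real_inner_comm m (total n)] at h1
    rw [orient]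
    linarith
  constructor
  · rintro ⟨n, hn, hpos⟩
    obtain ⟨-, -, h1⟩ := (h.pos_iff hT hp).1 hpos
    have h2 := total_inner_nonneg_of_mem_posTangentConeAt hs (by
      rw [total, inner_add_right, real_inner_comm, hm1, real_inner_comm, hm2, add_zero]) hn
    have h3 := mul_pos hmm h1
    rw [key] at h3
    exact pos_of_mul_pos_right h3 h2
  · intro hdet
    obtain ⟨⟨y, μ⟩, hq, hqm⟩ := hex
    obtain ⟨x, ν⟩ := p
    obtain ⟨k, hk, hg⟩ := hT.exists_cell
    have hd := h.dual_mem_cells hk hg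
    have hc := hT.carrier_eq
    rw [hc] at hp hq
    obtain ⟨hx : x ∈ g, hν : ν ∈ dual V g⟩ := hp
    obtain ⟨hy : y ∈ g, hμ : μ ∈ dual V g⟩ := hq
    have hgS : ∀ z ∈ g, ‖z‖ = 1 := fun z hz => mem_S3.1 (h.cell_subset hg hz).2
    have hdS : ∀ z ∈ dual V g, ‖z‖ = 1 := fun z hz => mem_S3.1 (h.symm.cell_subset hd hz).2
    -- The inward vector is the velocity at `p` of the path towards the point `(y, μ)` strictly on
    -- the positive side.
    have htan := tangent_mem (hgS x hx) (hgS y hy) (hdS ν hν) (hdS μ hμ)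
      (fun t ht => h.normalize_mem_cell hg hx hy ht)
      (fun t ht => h.symm.normalize_mem_cell hd hν hμ ht)
    refine ⟨_, hc ▸ htan, (h.pos_iff hT (by rw [hc]; exact ⟨hx, hν⟩)).2 ⟨hw, ⟨?_, ?_, ?_, ?_⟩, ?_⟩⟩
    · exact Submodule.sub_mem _ (Submodule.subset_span hy)
        (Submodule.smul_mem _ _ (Submodule.subset_span hx))
    · rw [inner_sub_right, real_inner_smul_right, real_inner_self_eq_norm_sq, hgS x hx,
        real_inner_comm]; ring
    · rw [← h.span_dual hk hg]
      exact Submodule.sub_mem _ (Submodule.subset_span hμ)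
        (Submodule.smul_mem _ _ (Submodule.subset_span hν))
    · rw [inner_sub_right, real_inner_smul_right, real_inner_self_eq_norm_sq, hdS ν hν,
        real_inner_comm]; ring
    · refine pos_of_mul_pos_right (a := ⟪m, m⟫) ?_ hmm.le
      rw [key]
      refine mul_pos ?_ hdet
      have h1 : ⟪m, x⟫ = 0 := by rw [real_inner_comm]; exact hm1
      have h2 : ⟪m, ν⟫ = 0 := by rw [real_inner_comm]; exact hm2
      rw [total, inner_add_right] at hqm ⊢
      rw [inner_sub_right, inner_sub_right, real_inner_smul_right, real_inner_smul_right, h1, h2]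
      linarith

/-- The pieces have conormals `m` and `-m`, so their boundary orientations are the two signs of one
determinant. It is non-zero because its four vectors are non-zero and pairwise orthogonal. -/
lemma DualPair.oppositeAlong_of_separating (h : DualPair V W) {g g' a b : Set E4} {T T' : Tile}
    {m : E4} (hT : IsPiece V g T) (hT' : IsPiece V g' T') (hag : a ⊆ g) (hbg : b ⊆ dual V g)
    (hag' : a ⊆ g') (hbg' : b ⊆ dual V g') (hm0 : m ≠ 0) (hma : ∀ x ∈ a, ⟪x, m⟫ = 0)
    (hmb : ∀ y ∈ b, ⟪y, m⟫ = 0)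
    (hs : ∀ q ∈ T.carrier, 0 ≤ ⟪m, total q⟫) (hex : ∃ q ∈ T.carrier, 0 < ⟪m, total q⟫)
    (hs' : ∀ q ∈ T'.carrier, ⟪m, total q⟫ ≤ 0) (hex' : ∃ q ∈ T'.carrier, ⟪m, total q⟫ < 0) :
    OppositeAlong T T' (a ×ˢ b) := by
  have key : ∀ {g : Set E4} {T : Tile}, IsPiece V g T → a ⊆ g → b ⊆ dual V g →
      ∀ p ∈ a ×ˢ b, ∀ w ∈ tangentConeAt ℝ (a ×ˢ b) p, p ∈ T.carrier ∧ w ∈ Tan g p ∧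
      ⟪total w, m⟫ = 0 := by
    rintro g T hT hag hbg ⟨x, ν⟩ ⟨hx, hν⟩ w hw
    obtain ⟨k, hk, hg⟩ := hT.exists_cell
    have hd := h.dual_mem_cells hk hg
    obtain ⟨h1, h2, h3, h4⟩ := mem_of_mem_tangentConeAt
      ((hag.trans (h.cell_subset hg)).trans (CH_subset_S3 V))
      ((hbg.trans (h.symm.cell_subset hd)).trans (CH_subset_S3 W)) hx hν hw
    refine ⟨by rw [hT.carrier_eq]; exact ⟨hag hx, hbg hν⟩, ⟨Submodule.span_mono hag h1, h2, ?_, h4⟩,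
      ?_⟩
    · rw [← h.span_dual hk hg]; exact Submodule.span_mono hbg h3
    · rw [total, inner_add_left,
        Submodule.inner_right_of_mem_orthogonal h1 (mem_orthogonal_span.2 hma),
        Submodule.inner_right_of_mem_orthogonal h3 (mem_orthogonal_span.2 hmb), add_zero]
  intro p hp w hw hw0
  obtain ⟨hpT, hwT, hmw⟩ := key hT hag hbg p hp w hw
  obtain ⟨hpT', hwT', -⟩ := key hT' hag' hbg' p hp w hw
  have hTan_neg : ∀ {g : Set E4}, w ∈ Tan g p → -w ∈ Tan g p := fun hw =>
    ⟨Submodule.neg_mem _ hw.1, by rw [Prod.fst_neg, inner_neg_right, hw.2.1, neg_zero],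
      Submodule.neg_mem _ hw.2.2.1, by rw [Prod.snd_neg, inner_neg_right, hw.2.2.2, neg_zero]⟩
  have htot : total (-w) = -total w := by simp only [total, Prod.fst_neg, Prod.snd_neg, neg_add]
  have hm1 := hma p.1 hp.1
  have hm2 := hmb p.2 hp.2
  have hmw' : ⟪total (-w), m⟫ = 0 := by rw [htot, inner_neg_left, hmw, neg_zero]
  have hsn : ∀ q ∈ T'.carrier, 0 ≤ ⟪-m, total q⟫ := fun q hq => by
    rw [inner_neg_left]; linarith [hs' q hq]
  have hexn : ∃ q ∈ T'.carrier, 0 < ⟪-m, total q⟫ := by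
    obtain ⟨q, hq, hlt⟩ := hex'
    exact ⟨q, hq, by rw [inner_neg_left]; linarith⟩
  have n1 : ∀ {x : E4}, ⟪x, m⟫ = 0 → ⟪x, -m⟫ = 0 := fun hx => by rw [inner_neg_right, hx, neg_zero]
  rw [h.boundaryPos_iff hT hpT hwT hm0 hm1 hm2 hmw hs hex,
    h.boundaryPos_iff hT hpT (hTan_neg hwT) hm0 hm1 hm2 hmw' hs hex,
    h.boundaryPos_iff hT' hpT' hwT' (neg_ne_zero.2 hm0) (n1 hm1) (n1 hm2) (n1 hmw) hsn hexn,
    h.boundaryPos_iff hT' hpT' (hTan_neg hwT') (neg_ne_zero.2 hm0) (n1 hm1) (n1 hm2) (n1 hmw') hsn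
      hexn, htot]
  obtain ⟨o1, o2⟩ := h.total_orthogonal hT hpT hwT
  obtain ⟨o3, o4, o5⟩ := h.sum_orthogonal hT hpT
  have hmz : ⟪p.1 + p.2, m⟫ = 0 := by rw [inner_add_left, hm1, hm2, add_zero]
  have hmn : ⟪m, p.2 - p.1⟫ = 0 := by rw [real_inner_comm, inner_sub_left, hm1, hm2, sub_zero]
  have hne : det4 (p.1 + p.2) (total w) m (p.2 - p.1) ≠ 0 :=
    det4_ne_zero_of_orthogonal o1 hmz o3 hmw o2 hmn
      (fun h0 => by rw [h0, inner_zero_left] at o4; norm_num at o4)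
      (total_ne_zero (h.orthogonal_of_mem_Tan hT hpT hwT).2.2.2.2 hw0) hm0
      (fun h0 => by rw [h0, inner_zero_left] at o5; norm_num at o5)
  have e1 : det4 (p.1 + p.2) (-total w) m (p.2 - p.1) =
      -det4 (p.1 + p.2) (total w) m (p.2 - p.1) := by
    simp only [det4_apply, PiLp.neg_apply]; ring
  have e2 : det4 (p.1 + p.2) (total w) (-m) (p.2 - p.1) =
      -det4 (p.1 + p.2) (total w) m (p.2 - p.1) := by
    simp only [det4_apply, PiLp.neg_apply]; ring
  have e3 : det4 (p.1 + p.2) (-total w) (-m) (p.2 - p.1) =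
      det4 (p.1 + p.2) (total w) m (p.2 - p.1) := by
    simp only [det4_apply, PiLp.neg_apply]; ring
  rw [e1, e2, e3]
  rcases hne.lt_or_gt with hlt | hgt
  · refine ⟨?_, ?_, ?_⟩ <;> constructor <;> intros <;> linarith
  · refine ⟨?_, ?_, ?_⟩ <;> constructor <;> intros <;> linarith

/-- If `a` is an edge and `b` a vertex of P*, this is `exists_separating`; if `a` is a vertex, it is
the same for the reversed pair, where the roles of the two pieces are exchanged and `m` changes
sign. -/
lemma DualPair.exists_conormal (h : DualPair V W) {a b : Set E4} (hab : CellPair V W 3 a b)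
    (hba : b ⊆ dual V a) :
    ∃ m : E4, m ≠ 0 ∧ (∀ x ∈ a, ⟪x, m⟫ = 0) ∧ (∀ y ∈ b, ⟪y, m⟫ = 0) ∧
      (∀ q ∈ a ×ˢ dual V a, 0 ≤ ⟪m, total q⟫) ∧ (∃ q ∈ a ×ˢ dual V a, 0 < ⟪m, total q⟫) ∧
      (∀ q ∈ dual W b ×ˢ b, ⟪m, total q⟫ ≤ 0) ∧ ∃ q ∈ dual W b ×ˢ b, ⟪m, total q⟫ < 0 := by
  obtain ⟨i, j, hi, hj, hij, ha, hb⟩ := hab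
  obtain ⟨rfl, rfl⟩ | ⟨rfl, rfl⟩ : (i = 2 ∧ j = 1) ∨ (i = 1 ∧ j = 2) := by omega
  · obtain ⟨ν, hν, rfl⟩ := h.symm.exists_vertex hb
    obtain ⟨m, hm0, hma, hmν, h1, ⟨y, hy, h2⟩, h3, z, hz, h4⟩ :=
      h.exists_separating ha hb (hba rfl)
    obtain ⟨x, hx⟩ := h.cell_nonempty two_ne_zero ha
    refine ⟨m, hm0, fun x hx => by rw [real_inner_comm, hma x hx], ?_, ?_, ⟨(x, z), ⟨hx, hz⟩, ?_⟩,
      ?_, ⟨(y, ν), ⟨hy, rfl⟩, ?_⟩⟩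
    · rintro _ rfl; rw [real_inner_comm, hmν]
    · rintro ⟨x, y⟩ ⟨hx, hy⟩
      rw [total, inner_add_right, hma x hx, zero_add]; exact h3 y hy
    · rw [total, inner_add_right, hma x hx, zero_add]; exact h4
    · rintro ⟨y, ν'⟩ ⟨hy, hν'⟩
      obtain rfl : ν' = ν := hν'
      rw [total, inner_add_right, hmν, add_zero]; exact h1 y hy
    · rw [total, inner_add_right, hmν, add_zero]; exact h2
  · obtain ⟨v, hv, rfl⟩ := h.exists_vertex ha
    have hvb : v ∈ dual W b := by
      rw [← Set.singleton_subset_iff, ← h.dual_dual one_ne_zero ha]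
      exact dual_anti hba
    obtain ⟨m, hm0, hmb, hmv, h1, ⟨y, hy, h2⟩, h3, z, hz, h4⟩ :=
      h.symm.exists_separating hb ha hvb
    obtain ⟨x, hx⟩ := h.symm.cell_nonempty two_ne_zero hb
    refine ⟨-m, neg_ne_zero.2 hm0, ?_, fun x hx => ?_, ?_, ⟨(v, y), ⟨rfl, hy⟩, ?_⟩,
      ?_, ⟨(z, x), ⟨hz, hx⟩, ?_⟩⟩
    · rintro _ rfl; rw [inner_neg_right, real_inner_comm, hmv, neg_zero]
    · rw [inner_neg_right, real_inner_comm, hmb x hx, neg_zero]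
    · rintro ⟨v', y⟩ ⟨hv', hy⟩
      obtain rfl : v' = v := hv'
      rw [total, inner_neg_left, inner_add_right, hmv, zero_add]
      linarith [h1 y hy]
    · rw [total, inner_neg_left, inner_add_right, hmv, zero_add]
      linarith
    · rintro ⟨y, x⟩ ⟨hy, hx⟩
      rw [total, inner_neg_left, inner_add_right, hmb x hx, add_zero]
      linarith [h3 y hy]
    · rw [total, inner_neg_left, inner_add_right, hmb x hx, add_zero]
      linarith

lemma DualPair.oppositeAlong (h : DualPair V W) {g g' : Set E4} {T T' : Tile}
    (hT : IsPiece V g T) (hT' : IsPiece V g' T') (hne : T ≠ T') {ε : Set (E4 × E4)}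
    (hε : ε ∈ T.edges) (hε' : ε ∈ T'.edges) : OppositeAlong T T' ε := by
  obtain ⟨a, b, hab, hag, hbg, rfl⟩ := (h.mem_edges_iff hT).1 hε
  obtain ⟨a', b', -, hag', hbg', heq⟩ := (h.mem_edges_iff hT').1 hε'
  obtain ⟨rfl, rfl⟩ := (Set.prod_eq_prod_iff_of_nonempty (hab.nonempty h)).1 heq
  obtain ⟨k, hk, hg⟩ := hT.exists_cell
  obtain ⟨k', hk', hg'⟩ := hT'.exists_cell
  obtain ⟨i, j, hi, hj, hij, ha, hb⟩ := id hab
  have hba : b ⊆ dual V a := hbg.trans (dual_anti hag)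
  obtain ⟨m, hm0, hma, hmb, h1, h2, h3, h4⟩ := h.exists_conormal hab hba
  have hgg : g ≠ g' := fun heq => by
    rw [← heq] at hT'
    exact hne (h.piece_unique hT hT')
  have hd : dual V (dual W b) = b := h.symm.dual_dual hj hb
  obtain rfl | rfl := h.eq_or_eq_of_edge hk hg hab hag hbg <;>
  obtain rfl | rfl := h.eq_or_eq_of_edge hk' hg' hab hag' hbg'
  · exact absurd rfl hgg
  · have c1 := hT.carrier_eq
    have c2 := hT'.carrier_eq
    rw [hd] at c2
    rw [← c1] at h1 h2
    rw [← c2] at h3 h4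
    exact h.oppositeAlong_of_separating hT hT' hag hbg hag' hbg' hm0 hma hmb h1 h2 h3 h4
  · have c1 := hT'.carrier_eq
    have c2 := hT.carrier_eq
    rw [hd] at c2
    rw [← c1] at h1 h2
    rw [← c2] at h3 h4
    refine h.oppositeAlong_of_separating hT hT' hag hbg hag' hbg' (neg_ne_zero.2 hm0)
      (fun x hx => by rw [inner_neg_right, hma x hx, neg_zero])
      (fun x hx => by rw [inner_neg_right, hmb x hx, neg_zero])
      (fun q hq => by rw [inner_neg_left]; linarith [h3 q hq]) ?_
      (fun q hq => by rw [inner_neg_left]; linarith [h1 q hq]) ?_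
    · obtain ⟨q, hq, hlt⟩ := h4
      exact ⟨q, hq, by rw [inner_neg_left]; linarith⟩
    · obtain ⟨q, hq, hlt⟩ := h2
      exact ⟨q, hq, by rw [inner_neg_left]; linarith⟩
  · exact absurd rfl hgg

/-! ### The rectangles -/

lemma hasDerivAt_circ (p q : E4) (s : ℝ) :
    HasDerivAt (circ p q) (-Real.sin s • p + Real.cos s • q) s :=
  ((Real.hasDerivAt_cos s).smul_const p).add ((Real.hasDerivAt_sin s).smul_const q)

lemma arcs_eq (p q r o : E4) (s t : ℝ) : arcs ![p, q, r, o] s t = (circ p q s, circ r o t) := rfl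

lemma isRectangle_of_arcs {e : Set E4} {p q r o : E4} {a b : ℝ}
    (hpS : p ∈ Submodule.span ℝ e) (hqS : q ∈ Submodule.span ℝ e)
    (hrS : r ∈ (Submodule.span ℝ e)ᗮ) (hoS : o ∈ (Submodule.span ℝ e)ᗮ)
    (hp : ‖p‖ = 1) (hq : ‖q‖ = 1) (hr : ‖r‖ = 1) (ho : ‖o‖ = 1) (hpq : ⟪p, q⟫ = 0)
    (hro : ⟪r, o⟫ = 0) (hdet : 0 < det4 p q r o) (ha : 0 < a) (haπ : a < Real.pi) (hb : 0 < b)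
    (hbπ : b < Real.pi) (he : e = circ p q '' Set.Icc 0 a) (hd : dual V e = circ r o '' Set.Icc 0 b) :
    IsRectangle (edgeTile V e) e (dual V e) := by
  have horth : ∀ {y z : E4}, y ∈ Submodule.span ℝ e → z ∈ (Submodule.span ℝ e)ᗮ → ⟪y, z⟫ = 0 :=
    fun hy hz => Submodule.inner_right_of_mem_orthogonal hy hz
  have h1 := horth hpS hrS
  have h2 := horth hpS hoS
  have h3 := horth hqS hrS
  have h4 := horth hqS hoS
  refine ⟨![p, q, r, o], a, b, ?_, hdet, ha, haπ, hb, hbπ, he, hd, ?_, ?_, ?_⟩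
  · rw [orthonormal_iff_ite]
    intro i j
    fin_cases i <;> fin_cases j <;> simp [hp, hq, hr, ho, hpq, hro, h1, h2, h3, h4,
      real_inner_comm p, real_inner_comm q r, real_inner_comm q o, real_inner_comm r o]
  · simp only [arcs_eq]
    change e ×ˢ dual V e = _
    rw [hd]
    nth_rewrite 1 [he]
    exact Set.prod_image_image_eq
  · rintro ⟨s, t⟩ ⟨hs, ht⟩ ⟨s', t'⟩ ⟨hs', ht'⟩
    simp only [arcs_eq, tileDist]
    rw [angle_circ hp hq hpq haπ.le hs hs', angle_circ hr ho hro hbπ.le ht ht', sq_abs, sq_abs]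
  · rintro ⟨s, t⟩ -
    simp only [arcs_eq]
    have d1 : deriv (fun t => (circ p q s, circ r o t)) t =
        (0, -Real.sin t • r + Real.cos t • o) :=
      ((hasDerivAt_const t (circ p q s)).prodMk (hasDerivAt_circ r o t)).deriv
    have d2 : deriv (fun s => (circ p q s, circ r o t)) s =
        (-Real.sin s • p + Real.cos s • q, 0) :=
      ((hasDerivAt_circ p q s).prodMk (hasDerivAt_const s (circ r o t))).deriv
    rw [d1, d2]
    have hcs : ∀ θ : ℝ, Real.sin θ ^ 2 + Real.cos θ ^ 2 = 1 := Real.sin_sq_add_cos_sq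
    have hn : ∀ {p q : E4}, ‖p‖ = 1 → ‖q‖ = 1 → ⟪p, q⟫ = 0 → ∀ s,
        ‖-Real.sin s • p + Real.cos s • q‖ = 1 ∧
        ⟪circ p q s, -Real.sin s • p + Real.cos s • q⟫ = 0 := fun {p q} hp hq hpq s => by
      constructor
      · have : ‖-Real.sin s • p + Real.cos s • q‖ ^ 2 = 1 := by
          rw [← real_inner_self_eq_norm_sq]
          simp only [inner_add_left, inner_add_right, real_inner_smul_left, real_inner_smul_right,
            hpq, real_inner_comm p q, real_inner_self_eq_norm_sq, norm_smul, hp, hq,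
            Real.norm_eq_abs, mul_one, sq_abs]
          linear_combination hcs s
        nlinarith [norm_nonneg (-Real.sin s • p + Real.cos s • q)]
      · simp only [circ, inner_add_left, inner_add_right, real_inner_smul_left,
          real_inner_smul_right, hpq, real_inner_comm p q, real_inner_self_eq_norm_sq, hp, hq]
        ring
    -- The pair in question is ((0, η), (ξ, 0)), with the t-derivative in front: its coefficients 0,
    -- 1, 1, 0 have determinant -1, which is the reversal of orientation.
    refine ⟨_, _, Submodule.add_mem _ (Submodule.smul_mem _ _ hpS) (Submodule.smul_mem _ _ hqS),
      (hn hp hq hpq s).1, (hn hp hq hpq s).2,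
      Submodule.add_mem _ (Submodule.smul_mem _ _ hrS) (Submodule.smul_mem _ _ hoS),
      (hn hr ho hro t).1, (hn hr ho hro t).2, ?_, 0, 1, 1, 0, by simp, by simp, by norm_num⟩
    have : det4 (circ p q s) (-Real.sin s • p + Real.cos s • q) (circ r o t)
        (-Real.sin t • r + Real.cos t • o) = (Real.sin s ^ 2 + Real.cos s ^ 2) *
        (Real.sin t ^ 2 + Real.cos t ^ 2) * det4 p q r o := by
      simp only [circ, det4_apply, PiLp.add_apply, PiLp.smul_apply, smul_eq_mul]
      ring
    rw [this, hcs, hcs, one_mul, one_mul]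
    exact hdet

/-- The same arc traversed from its other end; this changes the sign of the determinant of the frame
in `isRectangle`. -/
lemma circ_reverse (p q : E4) (b t : ℝ) :
    circ (circ p q b) (Real.sin b • p - Real.cos b • q) t = circ p q (b - t) := by
  simp only [circ, Real.cos_sub, Real.sin_sub]
  module

lemma DualPair.isRectangle (h : DualPair V W) {e : Set E4} (he : e ∈ cells (P V) 2) :
    IsRectangle (edgeTile V e) e (dual V e) := by
  obtain ⟨p, q, a, hpS, hqS, hp, hq, hpq, ha, haπ, hea⟩ := h.exists_arc he
  obtain ⟨r, o, b, hrS, hoS, hr, ho, hro, hb, hbπ, hdb⟩ :=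
    h.symm.exists_arc (h.dual_mem_cells two_ne_zero he)
  rw [h.span_dual two_ne_zero he] at hrS hoS
  have horth : ∀ {y z : E4}, y ∈ Submodule.span ℝ e → z ∈ (Submodule.span ℝ e)ᗮ → ⟪y, z⟫ = 0 :=
    fun hy hz => Submodule.inner_right_of_mem_orthogonal hy hz
  have hdet : det4 p q r o ≠ 0 := det4_ne_zero_of_orthogonal hpq (horth hpS hrS) (horth hpS hoS)
    (horth hqS hrS) (horth hqS hoS) hro (ne_zero_of_mem_S3 (mem_S3.2 hp))
    (ne_zero_of_mem_S3 (mem_S3.2 hq)) (ne_zero_of_mem_S3 (mem_S3.2 hr))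
    (ne_zero_of_mem_S3 (mem_S3.2 ho))
  rcases hdet.lt_or_gt with hlt | hgt
  · refine isRectangle_of_arcs (r := circ r o b) (o := Real.sin b • r - Real.cos b • o) hpS hqS
      (Submodule.add_mem _ (Submodule.smul_mem _ _ hrS) (Submodule.smul_mem _ _ hoS))
      (Submodule.sub_mem _ (Submodule.smul_mem _ _ hrS) (Submodule.smul_mem _ _ hoS))
      hp hq (norm_circ hr ho hro b) ?_ hpq ?_ ?_ ha haπ hb hbπ hea ?_
    · have : ‖Real.sin b • r - Real.cos b • o‖ ^ 2 = 1 := by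
        rw [← real_inner_self_eq_norm_sq]
        simp only [inner_sub_left, inner_sub_right, real_inner_smul_left, real_inner_smul_right,
          hro, real_inner_comm r o, real_inner_self_eq_norm_sq, norm_smul, hr, ho,
          Real.norm_eq_abs, mul_one, sq_abs]
        linear_combination Real.sin_sq_add_cos_sq b
      nlinarith [norm_nonneg (Real.sin b • r - Real.cos b • o)]
    · simp only [circ, inner_add_left, inner_sub_right, real_inner_smul_left,
        real_inner_smul_right, hro, real_inner_comm r o, real_inner_self_eq_norm_sq, hr, ho]
      ring
    · have : det4 p q (circ r o b) (Real.sin b • r - Real.cos b • o) =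
          -(Real.sin b ^ 2 + Real.cos b ^ 2) * det4 p q r o := by
        simp only [circ, det4_apply, PiLp.add_apply, PiLp.sub_apply, PiLp.smul_apply, smul_eq_mul]
        ring
      rw [this, Real.sin_sq_add_cos_sq]
      linarith
    · rw [hdb]
      ext y
      constructor
      · rintro ⟨t, ⟨h0, h1⟩, rfl⟩
        exact ⟨b - t, ⟨by linarith, by linarith⟩, by rw [circ_reverse, sub_sub_cancel]⟩
      · rintro ⟨t, ⟨h0, h1⟩, rfl⟩
        exact ⟨b - t, ⟨by linarith, by linarith⟩, by rw [circ_reverse]⟩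
  · exact isRectangle_of_arcs hpS hqS hrS hoS hp hq hr ho hpq hro hgt ha haπ hb hbπ hea hdb

/-! ### The homeomorphism to the sphere -/

/-- Quaternionic coordinates on the orthogonal complement of `u`. -/
noncomputable def proj (u : E4) : E4 →L[ℝ] E3 :=
  LinearMap.toContinuousLinearMap
    { toFun := fun x => !₂[-u 1 * x 0 + u 0 * x 1 - u 3 * x 2 + u 2 * x 3,
        -u 2 * x 0 + u 3 * x 1 + u 0 * x 2 - u 1 * x 3,
        -u 3 * x 0 - u 2 * x 1 + u 1 * x 2 + u 0 * x 3]
      map_add' := fun x y => by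
        ext i; fin_cases i <;> simp <;> ring
      map_smul' := fun c x => by
        ext i; fin_cases i <;> simp <;> ring }

lemma proj_apply (u x : E4) : proj u x = !₂[-u 1 * x 0 + u 0 * x 1 - u 3 * x 2 + u 2 * x 3,
        -u 2 * x 0 + u 3 * x 1 + u 0 * x 2 - u 1 * x 3,
        -u 3 * x 0 - u 2 * x 1 + u 1 * x 2 + u 0 * x 3] := rfl

/-- A right inverse of `proj u`, up to the factor `⟪u, u⟫`. -/
noncomputable def lift (u : E4) (y : E3) : E4 :=
  !₂[-u 1 * y 0 - u 2 * y 1 - u 3 * y 2, u 0 * y 0 + u 3 * y 1 - u 2 * y 2,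
    -u 3 * y 0 + u 0 * y 1 + u 1 * y 2, u 2 * y 0 - u 1 * y 1 + u 0 * y 2]

lemma proj_lift (u : E4) (y : E3) : proj u (lift u y) = ⟪u, u⟫ • y := by
  rw [inner_E4]
  ext i; fin_cases i <;> simp [proj_apply, lift] <;> ring

lemma proj_self (u : E4) : proj u u = 0 := by
  ext i; fin_cases i <;> simp [proj_apply] <;> ring

/-- In quaternions `proj u x` is the imaginary part of x ū and `lift u y` is y u. The identity is x
ū u = ⟪u, u⟫ x, split into real and imaginary parts of x ū. -/
lemma lift_proj (u x : E4) : ⟪u, u⟫ • x = ⟪u, x⟫ • u + lift u (proj u x) := by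
  rw [inner_E4, inner_E4]
  ext i; fin_cases i <;> simp [proj_apply, lift] <;> ring

lemma exists_smul_of_proj_eq_zero {u x : E4} (hu : u ≠ 0) (hx : proj u x = 0) :
    ∃ t : ℝ, x = t • u := by
  have h1 := lift_proj u x
  have h2 : lift u 0 = 0 := by ext i; fin_cases i <;> simp [lift]
  rw [hx, h2, add_zero] at h1
  have hne : ⟪u, u⟫ ≠ 0 := (real_inner_self_pos.2 hu).ne'
  refine ⟨⟪u, u⟫⁻¹ * ⟪u, x⟫, ?_⟩
  rw [mul_smul, ← h1, smul_smul, inv_mul_cancel₀ hne, one_smul]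

lemma det3_apply (a b c : E3) : det3 a b c =
    a 0 * (b 1 * c 2 - b 2 * c 1) - a 1 * (b 0 * c 2 - b 2 * c 0)
      + a 2 * (b 0 * c 1 - b 1 * c 0) := by
  simp [det3, Matrix.det_fin_three]
  ring

/-- Fixes the orientation of ℝ³ under `proj u`: a frame is positive there exactly when it is
completed by -u to a positive frame of ℝ⁴. -/
lemma det3_proj (u a b c : E4) :
    det3 (proj u a) (proj u b) (proj u c) = ⟪u, u⟫ * det4 a b c (-u) := by
  rw [inner_E4, det3_apply, det4_apply]
  simp [proj_apply]
  ring

lemma det3_normalize (y y₁ y₂ : E3) (r c₁ c₂ : ℝ) :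
    det3 (r • y) (r • y₁ + c₁ • y) (r • y₂ + c₂ • y) = r ^ 3 * det3 y y₁ y₂ := by
  simp only [det3_apply, PiLp.add_apply, PiLp.smul_apply, smul_eq_mul]
  ring

/-- The linear map `(x, ν) ↦ x + ν`, projected along `u`. -/
noncomputable def totalProj (u : E4) : E4 × E4 →L[ℝ] E3 :=
  (proj u).comp (ContinuousLinearMap.fst ℝ E4 E4 + ContinuousLinearMap.snd ℝ E4 E4)

lemma totalProj_apply (u : E4) (p : E4 × E4) : totalProj u p = proj u (total p) := rfl

/-- The radial projection of `x + ν` to the unit sphere of the orthogonal complement of `u`. -/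
noncomputable def sphereMap (u : E4) (p : E4 × E4) : E3 := ‖totalProj u p‖⁻¹ • totalProj u p

lemma DualPair.exists_interior (h : DualPair V W) : ∃ u, u ≠ 0 ∧
    (∀ v ∈ V, 0 < ⟪v, u⟫) ∧ (∀ w ∈ W, ⟪w, u⟫ < 0) ∧
    (∀ x ∈ CH V, 0 < ⟪x, u⟫) ∧ ∀ y ∈ CH W, ⟪y, u⟫ < 0 := by
  obtain ⟨u, h1, h2⟩ := h.interior
  refine ⟨u, ?_, h1, h2, fun x hx => inner_pos_of_mem_cone h1 hx.1 (ne_zero_of_mem_S3 hx.2),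
    fun y hy => inner_neg_of_mem_cone h2 hy.1 (ne_zero_of_mem_S3 hy.2)⟩
  rintro rfl
  -- If `u` were 0, then `W` would be empty and the cone over `V` the whole space, in which `u`
  -- could not be positive.
  have h3 : EuclideanSpace.single (0 : Fin 4) (1 : ℝ) ∈ cone V := (h.mem_left _).2 fun w hw => by
    have := h2 w hw
    rw [inner_zero_right] at this
    exact absurd this (lt_irrefl _)
  have h4 := inner_pos_of_mem_cone h1 h3 (by simp)
  rw [inner_zero_right] at h4
  exact lt_irrefl _ h4

variable {u : E4}

/-- Otherwise x + ν = t u. But x + ν pairs to 1 with both `x` and `ν`, whereas `u` pairs with them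
with opposite signs. -/
lemma DualPair.totalProj_ne_zero (h : DualPair V W) (hu0 : u ≠ 0) (huV : ∀ x ∈ CH V, 0 < ⟪x, u⟫)
    (huW : ∀ y ∈ CH W, ⟪y, u⟫ < 0) {p : E4 × E4} (hp : p ∈ Ptilde V) : totalProj u p ≠ 0 := by
  obtain ⟨x, ν⟩ := p
  obtain ⟨hx, hν, h0⟩ := h.mem_Ptilde_iff.1 hp
  rw [totalProj_apply]
  intro hz
  obtain ⟨t, ht⟩ := exists_smul_of_proj_eq_zero hu0 hz
  simp only [total] at ht
  have h1 : ⟪x, x + ν⟫ = 1 := by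
    rw [inner_add_right, h0, real_inner_self_eq_norm_sq, mem_S3.1 hx.2]; norm_num
  have h2 : ⟪ν, x + ν⟫ = 1 := by
    rw [inner_add_right, real_inner_comm, h0, real_inner_self_eq_norm_sq, mem_S3.1 hν.2]; norm_num
  rw [ht, real_inner_smul_right] at h1 h2
  have h3 := huV x hx
  have h4 := huW ν hν
  have h5 : 0 < t := by by_contra hle; nlinarith
  nlinarith

lemma inner_le_one_of_mem_S3 {x y : E4} (hx : x ∈ S3) (hy : y ∈ S3) : ⟪x, y⟫ ≤ 1 := by
  have := real_inner_le_norm x y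
  rwa [mem_S3.1 hx, mem_S3.1 hy, mul_one] at this

/-- Equal images mean x + ν = t u + l (x' + ν') with l > 0. Pairing with `x`, `ν`, `x'`, `ν'` and
using polarity gives four inequalities: t > 0 contradicts those for `ν` and `x'`, and t < 0 those
for `x` and `ν'`. So t = 0, l = 1, and then ⟪x, x'⟫ = 1. -/
lemma DualPair.sphereMap_injOn (h : DualPair V W) (hu0 : u ≠ 0) (huV : ∀ x ∈ CH V, 0 < ⟪x, u⟫)
    (huW : ∀ y ∈ CH W, ⟪y, u⟫ < 0) : Set.InjOn (sphereMap u) (Ptilde V) := by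
  rintro ⟨x, ν⟩ hp ⟨x', ν'⟩ hp' heq
  have hne := h.totalProj_ne_zero hu0 huV huW hp
  have hne' := h.totalProj_ne_zero hu0 huV huW hp'
  obtain ⟨hx, hν, h0⟩ := h.mem_Ptilde_iff.1 hp
  obtain ⟨hx', hν', h0'⟩ := h.mem_Ptilde_iff.1 hp'
  set r := ‖totalProj u (x, ν)‖
  set r' := ‖totalProj u (x', ν')‖
  have hr : 0 < r := norm_pos_iff.2 hne
  have hr' : 0 < r' := norm_pos_iff.2 hne'
  set l := r / r' with hl
  have hl0 : 0 < l := div_pos hr hr'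
  have hproj : proj u (x + ν - l • (x' + ν')) = 0 := by
    have h1 : totalProj u (x, ν) = l • totalProj u (x', ν') := by
      have h2 : r⁻¹ • totalProj u (x, ν) = r'⁻¹ • totalProj u (x', ν') := heq
      calc totalProj u (x, ν) = r • (r⁻¹ • totalProj u (x, ν)) := by
            rw [smul_smul, mul_inv_cancel₀ hr.ne', one_smul]
        _ = _ := by rw [h2, smul_smul, hl, div_eq_mul_inv]
    rw [map_sub, map_smul, sub_eq_zero]
    exact h1
  obtain ⟨t, ht⟩ := exists_smul_of_proj_eq_zero hu0 hproj
  rw [sub_eq_iff_eq_add] at ht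
  have nx : ⟪x, x⟫ = 1 := by rw [real_inner_self_eq_norm_sq, mem_S3.1 hx.2]; norm_num
  have nν : ⟪ν, ν⟫ = 1 := by rw [real_inner_self_eq_norm_sq, mem_S3.1 hν.2]; norm_num
  have nx' : ⟪x', x'⟫ = 1 := by rw [real_inner_self_eq_norm_sq, mem_S3.1 hx'.2]; norm_num
  have nν' : ⟪ν', ν'⟫ = 1 := by rw [real_inner_self_eq_norm_sq, mem_S3.1 hν'.2]; norm_num
  have exx := inner_le_one_of_mem_S3 hx.2 hx'.2
  have eνν := inner_le_one_of_mem_S3 hν.2 hν'.2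
  have exν := h.inner_nonpos hx.1 hν'.1
  have eνx := h.inner_nonpos hx'.1 hν.1
  have px := huV x hx
  have px' := huV x' hx'
  have pν := huW ν hν
  have pν' := huW ν' hν'
  have key : ∀ y : E4, ⟪y, x⟫ + ⟪y, ν⟫ = t * ⟪y, u⟫ + l * (⟪y, x'⟫ + ⟪y, ν'⟫) := fun y => by
    have := congrArg (fun z => ⟪y, z⟫) ht
    simpa only [inner_add_right, real_inner_smul_right] using this
  have k1 := key x
  have k2 := key ν
  have k3 := key x'
  have k4 := key ν'
  rw [nx, h0] at k1
  rw [nν, real_inner_comm x ν, h0] at k2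
  rw [nx', h0', real_inner_comm x x'] at k3
  rw [nν', real_inner_comm x' ν', h0', real_inner_comm ν ν', real_inner_comm x ν'] at k4
  rw [real_inner_comm x' ν] at k2
  have b1 : 1 ≤ t * ⟪x, u⟫ + l := by nlinarith
  have b2 : 1 ≤ t * ⟪ν, u⟫ + l := by nlinarith
  have b3 : t * ⟪x', u⟫ + l ≤ 1 := by linarith
  have b4 : t * ⟪ν', u⟫ + l ≤ 1 := by linarith
  have ht0 : t = 0 := by
    rcases lt_trichotomy t 0 with hlt | h0 | hgt
    · nlinarith
    · exact h0
    · nlinarith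
  rw [ht0, zero_mul, zero_add] at b1 b2 b3 b4
  have hl1 : l = 1 := le_antisymm b3 b1
  rw [ht0, hl1] at k3
  have hxx : ⟪x, x'⟫ = 1 := by linarith
  have hxeq : x = x' := (inner_eq_one_iff_of_norm_eq_one (mem_S3.1 hx.2) (mem_S3.1 hx'.2)).1 hxx
  rw [ht0, hl1, zero_smul, zero_add, one_smul, hxeq] at ht
  rw [hxeq, add_left_cancel ht]

/-- `x` is the nearest point of the cone to x + ν, since the cone lies on the nonpositive side of
ν^⊥. -/
lemma DualPair.infDist_eq (h : DualPair V W) {x ν : E4} (hx : x ∈ cone V) (hν : ν ∈ cone W)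
    (hxν : ⟪x, ν⟫ = 0) : Metric.infDist (x + ν) (cone V) = ‖ν‖ := by
  refine le_antisymm ?_ ((Metric.le_infDist ⟨x, hx⟩).2 fun k hk => ?_)
  · have := Metric.infDist_le_dist_of_mem (x := x + ν) hx
    rwa [dist_eq_norm, add_sub_cancel_left] at this
  · rw [dist_eq_norm]
    have h1 := h.inner_nonpos hk hν
    have h2 : ‖ν‖ * ‖ν‖ ≤ ‖x + ν - k‖ * ‖ν‖ := by
      refine le_trans ?_ (real_inner_le_norm _ _)
      rw [inner_sub_left, inner_add_left, hxν, real_inner_self_eq_norm_mul_norm]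
      linarith
    rcases (norm_nonneg ν).eq_or_lt with h0 | h0
    · rw [← h0]; exact norm_nonneg _
    · exact le_of_mul_le_mul_right h2 h0

/-- `u` is interior to the cone, so u + ε z is in it for small ε; then rescale by 1/ε. -/
lemma DualPair.exists_smul_add_mem_cone (h : DualPair V W) (huW : ∀ w ∈ W, ⟪w, u⟫ < 0) (z : E4) :
    ∃ t : ℝ, z + t • u ∈ cone V := by
  obtain ⟨ε, hε, hpos⟩ := finite_eventually_pos (V := W) (p := -u) (q := -z) fun w hw => by
    rw [inner_neg_right]; linarith [huW w hw]
  refine ⟨ε⁻¹, ?_⟩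
  have h1 : u + ε • z ∈ cone V := (h.mem_left _).2 fun w hw => by
    have := hpos w hw
    rw [smul_neg, ← neg_add, inner_neg_right] at this
    linarith
  have h2 := smul_mem_cone (inv_nonneg.2 hε.le) h1
  rwa [smul_add, smul_smul, inv_mul_cancel₀ hε.ne', one_smul, add_comm] at h2

lemma DualPair.sphereMap_surjOn (h : DualPair V W) (hu0 : u ≠ 0) (huV : ∀ v ∈ V, 0 < ⟪v, u⟫)
    (huW : ∀ w ∈ W, ⟪w, u⟫ < 0) {y : E3} (hy : ‖y‖ = 1) : ∃ p ∈ Ptilde V, sphereMap u p = y := by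
  have huu : 0 < ⟪u, u⟫ := real_inner_self_pos.2 hu0
  set z := lift u y
  -- For the Moreau decomposition x + ν of the point of the line, φ is ‖x‖ - ‖ν‖; written with
  -- distances, it is visibly continuous. It is nonpositive where the line is in the polar cone and
  -- nonnegative where it is in the cone.
  let φ : ℝ → ℝ := fun t =>
    Metric.infDist (z + t • u) (cone W) - Metric.infDist (z + t • u) (cone V)
  have hc : Continuous fun t : ℝ => z + t • u := by fun_prop
  have hφ : Continuous φ :=
    ((Metric.continuous_infDist_pt _).comp hc).sub ((Metric.continuous_infDist_pt _).comp hc)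
  obtain ⟨t, ht : φ t = 0⟩ : (0 : ℝ) ∈ Set.range φ := by
    refine mem_range_of_exists_le_of_exists_ge hφ ?_ ?_
    · obtain ⟨t, ht⟩ := h.symm.exists_smul_add_mem_cone (u := -u) (fun v hv => by
        rw [inner_neg_right]; linarith [huV v hv]) z
      rw [smul_neg, ← neg_smul] at ht
      refine ⟨-t, ?_⟩
      simp only [φ, Metric.infDist_zero_of_mem ht]
      linarith [Metric.infDist_nonneg (x := z + -t • u) (s := cone V)]
    · obtain ⟨t, ht⟩ := h.exists_smul_add_mem_cone huW z
      refine ⟨t, ?_⟩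
      simp only [φ, Metric.infDist_zero_of_mem ht]
      linarith [Metric.infDist_nonneg (x := z + t • u) (s := cone W)]
  obtain ⟨x, hx, hν, h0⟩ := exists_moreau h.isClosed_cone (z + t • u)
  set ν := z + t • u - x with hνdef
  have hν := (h.mem_right ν).2 hν
  have hz : z + t • u = x + ν := by rw [hνdef]; abel
  have h1 := h.infDist_eq hx hν h0
  have h2 := h.symm.infDist_eq hν hx (by rw [real_inner_comm]; exact h0)
  rw [add_comm ν x] at h2
  simp only [φ, hz, h1, h2] at ht
  have hnorm : ‖x‖ = ‖ν‖ := by linarith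
  have hproj : proj u (x + ν) = ⟪u, u⟫ • y := by
    rw [← hz, map_add, map_smul, proj_self, smul_zero, add_zero, proj_lift]
  have hx0 : x ≠ 0 := fun hx0 => by
    rw [hx0, norm_zero] at hnorm
    rw [hx0, norm_eq_zero.1 hnorm.symm, add_zero, map_zero] at hproj
    rcases smul_eq_zero.1 hproj.symm with h3 | h3
    · exact huu.ne' h3
    · rw [h3, norm_zero] at hy; exact zero_ne_one hy
  -- Both components are non-zero with the same norm, so normalising them rescales their sum and
  -- keeps the direction of its projection.
  have hν0 : ν ≠ 0 := norm_ne_zero_iff.1 (hnorm ▸ norm_ne_zero_iff.2 hx0)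
  refine ⟨(‖x‖⁻¹ • x, ‖ν‖⁻¹ • ν), h.mem_Ptilde_iff.2 ⟨normalize_mem_CH hx hx0,
    normalize_mem_CH hν hν0, by rw [real_inner_smul_left, real_inner_smul_right, h0]; ring⟩, ?_⟩
  have h3 : totalProj u (‖x‖⁻¹ • x, ‖ν‖⁻¹ • ν) = (‖x‖⁻¹ * ⟪u, u⟫) • y := by
    rw [totalProj_apply, total]
    simp only
    rw [← hnorm, ← smul_add, map_smul, hproj, smul_smul]
  have h4 : 0 < ‖x‖⁻¹ * ⟪u, u⟫ := mul_pos (inv_pos.2 (norm_pos_iff.2 hx0)) huu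
  rw [sphereMap, h3, norm_smul, hy, mul_one, Real.norm_of_nonneg h4.le, smul_smul,
    inv_mul_cancel₀ h4.ne', one_smul]

lemma DualPair.isCompact_Ptilde (h : DualPair V W) : IsCompact (Ptilde V) := by
  have h1 : Ptilde V = (CH V ×ˢ CH W) ∩ {p | ⟪p.1, p.2⟫ = 0} := by
    ext ⟨x, ν⟩
    rw [h.mem_Ptilde_iff]
    exact ⟨fun hp => ⟨⟨hp.1, hp.2.1⟩, hp.2.2⟩, fun hp => ⟨hp.1.1, hp.1.2, hp.2⟩⟩
  have hS : IsCompact S3 := isCompact_sphere 0 1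
  rw [h1]
  refine ((hS.inter_left h.isClosed_cone).prod (hS.inter_left h.symm.isClosed_cone)).inter_right ?_
  exact isClosed_eq (by fun_prop) continuous_const

lemma sphereMap_continuousAt {p : E4 × E4} (hp : totalProj u p ≠ 0) :
    ContinuousAt (sphereMap u) p := by
  have hc := (totalProj u).continuous.continuousAt (x := p)
  exact (hc.norm.inv₀ (norm_ne_zero_iff.2 hp)).smul hc

lemma DualPair.exists_homeomorph (h : DualPair V W) (hu0 : u ≠ 0) (huV : ∀ v ∈ V, 0 < ⟪v, u⟫)
    (huW : ∀ w ∈ W, ⟪w, u⟫ < 0) (huV' : ∀ x ∈ CH V, 0 < ⟪x, u⟫)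
    (huW' : ∀ y ∈ CH W, ⟪y, u⟫ < 0) :
    ∃ φ : Ptilde V ≃ₜ Metric.sphere (0 : E3) 1, ∀ p : Ptilde V, sphereMap u p = φ p := by
  have hne := fun p : Ptilde V => h.totalProj_ne_zero hu0 huV' huW' p.2
  let f : Ptilde V → Metric.sphere (0 : E3) 1 := fun p => ⟨sphereMap u p, by
    rw [mem_sphere_zero_iff_norm, sphereMap, norm_smul, norm_inv, norm_norm,
      inv_mul_cancel₀ (norm_ne_zero_iff.2 (hne p))]⟩
  have hf : Continuous f := by
    refine Continuous.subtype_mk (continuous_iff_continuousAt.2 fun p => ?_) _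
    exact (sphereMap_continuousAt (hne p)).comp continuous_subtype_val.continuousAt
  have hbij : Function.Bijective f := by
    refine ⟨fun p q hpq => Subtype.ext (h.sphereMap_injOn hu0 huV' huW' p.2 q.2
      (congrArg Subtype.val hpq)), fun y => ?_⟩
    obtain ⟨p, hp, hpy⟩ := h.sphereMap_surjOn hu0 huV huW (mem_sphere_zero_iff_norm.1 y.2)
    exact ⟨⟨p, hp⟩, Subtype.ext hpy⟩
  have : CompactSpace (Ptilde V) := isCompact_iff_compactSpace.1 h.isCompact_Ptilde
  let φ : Ptilde V ≃ₜ Metric.sphere (0 : E3) 1 :=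
    Continuous.homeoOfEquivCompactToT2 (f := Equiv.ofBijective f hbij) hf
  exact ⟨φ, fun p => rfl⟩

/-- The derivative of the normalising factor only adds multiples of the position vector, which
`det3_normalize` discards. What remains is the form `orient` with -u in place of ν - x, and these
two vectors have positive inner product. -/
lemma DualPair.orientationPreservingOn (h : DualPair V W) (hu0 : u ≠ 0)
    (huV : ∀ x ∈ CH V, 0 < ⟪x, u⟫) (huW : ∀ y ∈ CH W, ⟪y, u⟫ < 0) {g : Set E4} {T : Tile}
    (hT : IsPiece V g T) : OrientationPreservingOn (sphereMap u) T := by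
  intro p hp
  have hpT : p ∈ T.carrier := hp.1
  obtain ⟨hx, hν, h0⟩ := h.isPiece_subset (x := p.1) (ν := p.2) hT hpT
  have hne : totalProj u p ≠ 0 :=
    h.totalProj_ne_zero hu0 huV huW (h.mem_Ptilde_iff.2 ⟨hx, hν, h0⟩ : (p.1, p.2) ∈ Ptilde V)
  have hd : DifferentiableAt ℝ (fun q => ‖totalProj u q‖⁻¹) p :=
    ((totalProj u).differentiableAt.norm ℝ hne).inv (norm_ne_zero_iff.2 hne)
  have hF := hd.hasFDerivAt.smul (totalProj u).hasFDerivAt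
  refine ⟨_, hF.hasFDerivWithinAt, fun w₁ w₂ hpos => ?_⟩
  obtain ⟨hw₁, hw₂, hor⟩ := (h.pos_iff hT hpT).1 hpos
  simp only [sphereMap, add_apply, smul_apply,
    ContinuousLinearMap.smulRight_apply]
  rw [det3_normalize]
  refine mul_pos (pow_pos (inv_pos.2 (norm_pos_iff.2 hne)) 3) ?_
  rw [totalProj_apply, totalProj_apply, totalProj_apply, det3_proj]
  refine mul_pos (real_inner_self_pos.2 hu0) ?_
  obtain ⟨o1, -, o3⟩ := h.sum_orthogonal hT hpT
  have hn0 : p.2 - p.1 ≠ 0 := fun hz => by rw [hz, inner_zero_left] at o3; norm_num at o3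
  have key := inner_mul_det4 hn0 o1 (h.total_orthogonal hT hpT hw₁).2
    (h.total_orthogonal hT hpT hw₂).2 (-u)
  refine pos_of_mul_pos_right (a := ⟪p.2 - p.1, p.2 - p.1⟫) ?_ (by rw [o3]; norm_num)
  have e : total p = p.1 + p.2 := rfl
  rw [e, key]
  refine mul_pos ?_ hor
  have h1 := huV _ hx
  have h2 := huW _ hν
  rw [inner_neg_left, inner_sub_right, real_inner_comm p.2 u, real_inner_comm p.1 u]
  linarith

end

end SphPoly

/-! ### Assembly of the proposition -/

theorem proposition5p1 (V : Finset E4) (hV : IsVertexSet V) :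
    -- the pieces: spherical polygons, one for each face of `P`
    (∀ f ∈ faces (P V), ∃ ν : E4, dual V f = {ν} ∧ IsSphericalPolygon ν f ∧
      (faceTile V f).carrier = (fun x => (x, ν)) '' f ∧
      ∀ x ∈ f, ∀ y ∈ f, tileDist (x, ν) (y, ν) = InnerProductGeometry.angle x y) ∧
    -- spherical polygons, one for each face of `P*`
    (Set.BijOn (fun v => dual V {v}) (V : Set E4) (faces (Pdual V)) ∧
      ∀ v ∈ V, IsSphericalPolygon v (dual V {v}) ∧
        (vertexTile V v).carrier = (fun ν => (v, ν)) '' dual V {v} ∧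
        ∀ x ∈ dual V {v}, ∀ y ∈ dual V {v},
          tileDist (v, x) (v, y) = InnerProductGeometry.angle x y) ∧
    -- Euclidean rectangles, one for each edge of `P`
    (Set.BijOn (dual V) (edges (P V)) (edges (Pdual V)) ∧
      ∀ e ∈ edges (P V), IsRectangle (edgeTile V e) e (dual V e)) ∧
    -- `P̃` is tiled by these finitely many pieces
    (tiles V).Finite ∧
    Ptilde V = ⋃ T ∈ tiles V, T.carrier ∧
    (∀ T ∈ tiles V, ∀ T' ∈ tiles V, T ≠ T' → Disjoint T.inner T'.inner) ∧
    -- the tiling is edge-to-edge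
    (∀ T ∈ tiles V, ∀ T' ∈ tiles V, T ≠ T' →
      T.carrier ∩ T'.carrier = ∅ ∨
      (∃ p ∈ T.vertices ∩ T'.vertices, T.carrier ∩ T'.carrier = {p}) ∨
      T.carrier ∩ T'.carrier ∈ T.edges ∩ T'.edges) ∧
    (∀ T ∈ tiles V, ∀ ε ∈ T.edges, ∃! T' : Tile, T' ∈ tiles V ∧ T' ≠ T ∧ ε ∈ T'.edges) ∧
    -- the orientations of adjacent pieces fit together
    (∀ T ∈ tiles V, ∀ T' ∈ tiles V, T ≠ T' → ∀ ε ∈ T.edges ∩ T'.edges, OppositeAlong T T' ε) ∧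
    -- `P̃` is homeomorphic to the 2-sphere, by a homeomorphism that carries the orientations of
    -- all pieces to the orientation of the 2-sphere
    ∃ (h : Ptilde V ≃ₜ Metric.sphere (0 : E3) 1) (F : E4 × E4 → E3),
      (∀ p : Ptilde V, F p = h p) ∧ ∀ T ∈ tiles V, OrientationPreservingOn F T := by
  obtain ⟨W, h⟩ := hV.exists_dualPair
  have hdual : ∀ v ∈ V, dual V {v} ∈ cells (P W) 3 := fun v hv =>
    h.dual_mem_cells one_ne_zero (h.singleton_mem_cells hv)
  refine ⟨fun f hf => ?_, ⟨?_, fun v hv => ⟨?_, ?_, ?_⟩⟩, ⟨?_, fun e he => h.isRectangle he⟩,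
    h.finite_tiles, h.Ptilde_eq, ?_, ?_, ?_, ?_, ?_⟩
  · have hd := h.dual_mem_cells (by norm_num) hf
    obtain ⟨ν, hν, heq⟩ := h.symm.exists_vertex hd
    refine ⟨ν, heq, h.isSphericalPolygon hf (by rw [heq]; rfl), ?_, fun x _ y _ =>
      tileDist_right (h.right_sphere ν hν)⟩
    change f ×ˢ dual V f = _
    rw [heq, Set.prod_singleton]
  · rw [h.Pdual_eq]
    exact (h.bijOn_dual one_ne_zero (by norm_num)).comp h.bijOn_singleton
  · refine h.symm.isSphericalPolygon (hdual v hv) ?_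
    rw [h.dual_dual one_ne_zero (h.singleton_mem_cells hv)]; rfl
  · exact Set.singleton_prod
  · exact fun x _ y _ => tileDist_left (h.left_sphere v hv)
  · rw [h.Pdual_eq]
    exact h.bijOn_dual two_ne_zero (by norm_num)
  · intro T hT T' hT' hne
    obtain ⟨g, hg⟩ := h.mem_tiles_iff.1 hT
    obtain ⟨g', hg'⟩ := h.mem_tiles_iff.1 hT'
    exact h.disjoint_inner hg hg' hne
  · intro T hT T' hT' hne
    obtain ⟨g, hg⟩ := h.mem_tiles_iff.1 hT
    obtain ⟨g', hg'⟩ := h.mem_tiles_iff.1 hT'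
    exact h.edge_to_edge hg hg' hne
  · intro T hT ε hε
    obtain ⟨g, hg⟩ := h.mem_tiles_iff.1 hT
    exact h.existsUnique_neighbor hg hε
  · intro T hT T' hT' hne ε hε
    obtain ⟨g, hg⟩ := h.mem_tiles_iff.1 hT
    obtain ⟨g', hg'⟩ := h.mem_tiles_iff.1 hT'
    exact h.oppositeAlong hg hg' hne hε.1 hε.2
  · obtain ⟨u, hu0, huV, huW, huV', huW'⟩ := h.exists_interior
    obtain ⟨φ, hφ⟩ := h.exists_homeomorph hu0 huV huW huV' huW'
    refine ⟨φ, sphereMap u, hφ, fun T hT => ?_⟩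
    obtain ⟨g, hg⟩ := h.mem_tiles_iff.1 hT
    exact h.orientationPreservingOn hu0 huV' huW' hg
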